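/- **Setting.** Let $X$ be an $\mathbb{R}^d$-valued random vector with law $\nu$, $\varphi:\mathbb{R}^d\to\mathbb{R}$ a Borel function, $\Psi:\mathbb{R}\to\mathbb{R}$ continuous and $\alpha\in(0,1)$. The set of values-at-risk is $\{\xi\in\mathbb{R}:\mathbb{P}(\varphi(X)\le\xi)=\alpha\}$, and $C^*_\alpha=\Psi\text{-CVaR}_\alpha(\varphi(X)):=\mathbb{E}[\Psi(\varphi(X))\mid\varphi(X)\ge \mathrm{VaR}_\alpha]$ with $\mathrm{VaR}_\alpha:=\inf\{\xi:\mathbb{P}(\varphi(X)\le\xi)\ge\alpha\}$. Let $\psi(\theta):=\log\mathbb{E}[e^{\langle\theta,X\rangle}]$, assumed finite for every $\theta\in\mathbb{R}^d$, and let $\nu_\theta(dx):=e^{\langle\theta,x\rangle-\psi(\theta)}\nu(dx)$ be the Esscher transform of the law of $X$. Put $$Q_1(\theta,\xi):=\mathbb{E}\big[\mathbf 1_{\{\varphi(X)>\xi\}}e^{-\langle\theta,X\rangle+\psi(\theta)}\big],\qquad Q_2(\mu,\xi):=\mathbb{E}\big[(\Psi(\varphi(X))-\xi)^2\mathbf 1_{\{\varphi(X)>\xi\}}e^{-\langle\mu,X\rangle+\psi(\mu)}\big].$$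 **Assumptions.** - $(H^{es}_\delta)$: $\lim_{|\theta|\to\infty}\big(\psi(\theta)-2\psi(\theta/2)\big)=+\infty$, and there is $\delta>0$ such that $\theta\mapsto\psi(\theta)-\delta|\theta|^2$ is concave. - $(A2)_1$: $\varphi(X)$ has a continuous distribution function and $\Psi(\varphi(X))\in L^2$. - (A3): $\mathbb{P}\big((\Psi(\varphi(X))-\xi)^2\mathbf 1_{\{\varphi(X)\ge\xi\}}>0\big)>0$ for every value-at-risk $\xi$. - $\mathbb{E}\big[|X|(1+\Psi(\varphi(X))^2)e^{\langle\theta,X\rangle}\big]<\infty$ for every $\theta\in\mathbb{R}^d$. - There are $K\in\mathbb{R}$ and $\lambda\ge0$ with $|\Psi(\varphi(x))|\le Ke^{\frac\lambda4|x|}$ for all $x\in\mathbb{R}^d$ and $\mathbb{E}[|X|^2e^{\lambda|X|}]<\infty$. - (A1): $(\gamma_n)_{n\ge1}$ is a deterministic positive sequence with $\sum_n\gamma_n=\infty$ and $\sum_n\gamma_n^2<\infty$. **Procedure.** On a filtered probability space $(\Omega,(\mathcal F_n)_{n\ge0},\mathbb{P})$ let $Z_n=(\xi_n,C_n,\theta_n,\mu_n)\in\mathbb{R}\times\mathbb{R}\times\mathbb{R}^d\times\mathbb{R}^d$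 have an arbitrary $\mathcal F_0$-measurable initial value $Z_0$. For $n\ge1$ let $X^{(\theta_{n-1})}_n,X^{(\mu_{n-1})}_n,X^{(-\theta_{n-1})}_n,X^{(-\mu_{n-1})}_n$ be $\mathcal F_n$-measurable random vectors whose conditional laws given $\mathcal F_{n-1}$ are $\nu_{\theta_{n-1}},\nu_{\mu_{n-1}},\nu_{-\theta_{n-1}},\nu_{-\mu_{n-1}}$ respectively (their joint conditional law is arbitrary), and let $$\begin{aligned} \xi_n&=\xi_{n-1}-\gamma_nL_1(\xi_{n-1},\theta_{n-1},X^{(\theta_{n-1})}_n),& C_n&=C_{n-1}-\gamma_nL_2(\xi_{n-1},C_{n-1},\mu_{n-1},X^{(\mu_{n-1})}_n),\\ \theta_n&=\theta_{n-1}-\gamma_nL_3(\xi_{n-1},\theta_{n-1},X^{(-\theta_{n-1})}_n),& \mu_n&=\mu_{n-1}-\gamma_nL_4(\xi_{n-1},\mu_{n-1},X^{(-\mu_{n-1})}_n), \end{aligned}$$ where $$\begin{aligned} L_1(\xi,\theta,x)&=e^{-\frac{\psi(\theta)+\psi(-\theta)}2}\Big(1-\tfrac1{1-\alpha}\mathbf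 1_{\{\varphi(x)>\xi\}}e^{\psi(\theta)-\langle x,\theta\rangle}\Big),\\ L_2(\xi,C,\mu,x)&=C-\Psi(\xi)-\tfrac1{1-\alpha}(\Psi(\varphi(x))-\Psi(\xi))\mathbf 1_{\{\varphi(x)>\xi\}}e^{\psi(\mu)-\langle\mu,x\rangle},\\ L_3(\xi,\theta,x)&=\mathbf 1_{\{\varphi(x)>\xi\}}(\nabla\psi(\theta)-x),\\ L_4(\xi,\mu,x)&=\frac{e^{-\frac\lambda2\sqrt d\,|\nabla\psi(-\mu)|}}{1+\xi^2}(\Psi(\varphi(x))-\xi)^2\mathbf 1_{\{\varphi(x)>\xi\}}(\nabla\psi(\mu)-x). \end{aligned}$$ **Theorem 4.1 (Esscher transform extension).** Under these assumptions $Z_n$ converges almost surely to $(\xi^*_\alpha,C^*_\alpha,\theta^*_\alpha,\mu^*_\alpha)$, where $\xi^*_\alpha$ is a square integrable random variable, $\theta^*_\alpha$ and $\mu^*_\alpha$ are square integrable $\mathbb{R}^d$-valued random vectors, and almost surely $\xi^*_\alpha$ is a value-at-risk, $\theta^*_\alpha\in\arg\min Q_1(\cdot,\xi^*_\alpha)$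 and $\mu^*_\alpha\in\arg\min Q_2(\cdot,\xi^*_\alpha)$. -/

import Mathlib

open MeasureTheory Filter Topology

noncomputable section

namespace EsscherVaR

/-- `ℝ^d` with its Euclidean norm and inner product. -/
abbrev Vec (d : ℕ) : Type := EuclideanSpace ℝ (Fin d)

/-- Points at which a real function attains its minimum over the whole space. -/
def argmin {β : Type*} (f : β → ℝ) : Set β := {x | ∀ y, f x ≤ f y}

variable {d : ℕ}

/-! In what follows `ν` is the law of the random vector `X` and `φ X` is the loss. -/

/-- The distribution function `ξ ↦ ℙ(φ(X) ≤ ξ)` of the loss. -/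
def lossCDF (ν : Measure (Vec d)) (φ : Vec d → ℝ) (ξ : ℝ) : ℝ := ν.real {x | φ x ≤ ξ}

/-- The set of values-at-risk at level `α`: all solutions `ξ` of `ℙ(φ(X) ≤ ξ) = α`. -/
def VaRSet (ν : Measure (Vec d)) (φ : Vec d → ℝ) (α : ℝ) : Set ℝ := {ξ | lossCDF ν φ ξ = α}

/-- The lowest `α`-quantile of the loss. -/
def VaR (ν : Measure (Vec d)) (φ : Vec d → ℝ) (α : ℝ) : ℝ := sInf {ξ | α ≤ lossCDF ν φ ξ}

/-- `Ψ-CVaR_α = 𝔼[Ψ(φ(X)) | φ(X) ≥ VaR_α]`. -/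
def PsiCVaR (ν : Measure (Vec d)) (φ : Vec d → ℝ) (Ψ : ℝ → ℝ) (α : ℝ) : ℝ :=
  ∫ x, Ψ (φ x) ∂(ProbabilityTheory.cond ν {x | VaR ν φ α ≤ φ x})

/-- Cumulant generating function (log-Laplace transform) `ψ(θ) = log 𝔼[exp ⟨θ, X⟩]`. -/
def cumulant (ν : Measure (Vec d)) (θ : Vec d) : ℝ :=
  Real.log (∫ x, Real.exp (inner ℝ θ x) ∂ν)

/-- The Esscher transform of the law of `X`, that is the law `exp(⟨θ, x⟩ - ψ(θ)) ν(dx)`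
of `X^{(θ)}`. -/
def esscher (ν : Measure (Vec d)) (θ : Vec d) : Measure (Vec d) :=
  ν.tilted (fun x => inner ℝ θ x)

/-- The condition `(H^es_δ)` on the cumulant generating function:
`ψ(θ) - 2 ψ(θ/2) → +∞` as `|θ| → ∞`, and `ψ - δ|·|²` is concave for some `δ > 0`. -/
def EsscherCondition (ψ : Vec d → ℝ) : Prop :=
  Tendsto (fun θ => ψ θ - 2 * ψ ((1 / 2 : ℝ) • θ)) (Bornology.cobounded (Vec d)) atTop ∧
    ∃ δ : ℝ, 0 < δ ∧ ConcaveOn ℝ Set.univ (fun θ => ψ θ - δ * ‖θ‖ ^ 2)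

/-- Admissible step sequences `(γ_n)_{n ≥ 1}`: positive, `∑ γ_n = ∞`, `∑ γ_n² < ∞`.
The value `γ 0` plays no role. -/
def IsStepSequence (γ : ℕ → ℝ) : Prop :=
  (∀ n, 1 ≤ n → 0 < γ n) ∧
    Tendsto (fun n => ∑ k ∈ Finset.Icc 1 n, γ k) atTop atTop ∧
    Summable (fun n => γ n ^ 2)

/-- The indicator `1_{φ(x) > ξ}`. -/
def ind (φ : Vec d → ℝ) (ξ : ℝ) (x : Vec d) : ℝ :=
  Set.indicator {y | ξ < φ y} (fun _ => (1 : ℝ)) x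

/-- `Q₁(θ, ξ) = 𝔼[1_{φ(X) > ξ} exp(-⟨θ, X⟩ + ψ(θ))]`. -/
def Q1 (ν : Measure (Vec d)) (φ : Vec d → ℝ) (θ : Vec d) (ξ : ℝ) : ℝ :=
  ∫ x, ind φ ξ x * Real.exp (-inner ℝ θ x + cumulant ν θ) ∂ν

/-- `Q₂(μ, ξ) = 𝔼[(Ψ(φ(X)) - ξ)² 1_{φ(X) > ξ} exp(-⟨μ, X⟩ + ψ(μ))]`. -/
def Q2 (ν : Measure (Vec d)) (φ : Vec d → ℝ) (Ψ : ℝ → ℝ) (μ : Vec d) (ξ : ℝ) : ℝ :=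
  ∫ x, (Ψ (φ x) - ξ) ^ 2 * ind φ ξ x * Real.exp (-inner ℝ μ x + cumulant ν μ) ∂ν

/-- Innovation function of the VaR component. -/
def L1 (ν : Measure (Vec d)) (φ : Vec d → ℝ) (α : ℝ) (ξ : ℝ) (θ x : Vec d) : ℝ :=
  Real.exp (-(cumulant ν θ + cumulant ν (-θ)) / 2) *
    (1 - 1 / (1 - α) * ind φ ξ x * Real.exp (cumulant ν θ - inner ℝ x θ))

/-- The weighted functional `w̄(ξ, μ, x)`. -/
def wBar (ν : Measure (Vec d)) (φ : Vec d → ℝ) (Ψ : ℝ → ℝ) (α : ℝ) (ξ : ℝ)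
    (μ x : Vec d) : ℝ :=
  Ψ ξ + 1 / (1 - α) * (Ψ (φ x) - Ψ ξ) * ind φ ξ x * Real.exp (cumulant ν μ - inner ℝ μ x)

/-- Innovation function of the CVaR component. -/
def L2 (ν : Measure (Vec d)) (φ : Vec d → ℝ) (Ψ : ℝ → ℝ) (α : ℝ) (ξ c : ℝ)
    (μ x : Vec d) : ℝ :=
  c - wBar ν φ Ψ α ξ μ x

/-- Innovation function of the variance reducer of the VaR component. -/
def L3 (ν : Measure (Vec d)) (φ : Vec d → ℝ) (ξ : ℝ) (θ x : Vec d) : Vec d :=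
  ind φ ξ x • (gradient (cumulant ν) θ - x)

/-- Innovation function of the variance reducer of the CVaR component. -/
def L4 (ν : Measure (Vec d)) (φ : Vec d → ℝ) (Ψ : ℝ → ℝ) (lam : ℝ) (ξ : ℝ)
    (μ x : Vec d) : Vec d :=
  (Real.exp (-(lam / 2 * √(d : ℝ) * ‖gradient (cumulant ν) (-μ)‖)) / (1 + ξ ^ 2) *
    (Ψ (φ x) - ξ) ^ 2 * ind φ ξ x) • (gradient (cumulant ν) μ - x)

/-- `κ` is the conditional distribution of the random vector `Y` given the σ-algebra `m`:
`ℙ(S ∩ {Y ∈ A}) = 𝔼[1_S κ(·)(A)]` for all `S` in `m` and all Borel sets `A`. -/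
def HasCondLaw {Ω : Type*} [MeasurableSpace Ω] (P : Measure Ω) (m : MeasurableSpace Ω)
    (Y : Ω → Vec d) (κ : Ω → Measure (Vec d)) : Prop :=
  ∀ S, MeasurableSet[m] S → ∀ A, MeasurableSet A → P (S ∩ Y ⁻¹' A) = ∫⁻ ω in S, κ ω A ∂P

/-- The recursive importance sampling procedure `Z_n = (ξ_n, C_n, θ_n, μ_n)`.

`ℱ n` is the information available after step `n`. At step `n + 1` the procedure draws
samples `X^{(θ_n)}`, `X^{(μ_n)}`, `X^{(-θ_n)}` and `X^{(-μ_n)}` (here `X₁ (n+1)`, …,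
`X₄ (n+1)`), that is, random vectors whose conditional laws given the past `ℱ n` are the
Esscher transforms of the law of `X` with these parameters. Nothing is required of the
joint conditional law of the four samples: they may be drawn independently or from
one common innovation. -/
structure IsEsscherRecursion {Ω : Type*} [mΩ : MeasurableSpace Ω] (P : Measure Ω)
    (ℱ : Filtration ℕ mΩ) (ν : Measure (Vec d)) (φ : Vec d → ℝ) (Ψ : ℝ → ℝ)
    (α lam : ℝ) (γ : ℕ → ℝ) (X₁ X₂ X₃ X₄ : ℕ → Ω → Vec d)
    (ξ C : ℕ → Ω → ℝ) (θ μ : ℕ → Ω → Vec d) : Prop where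
  /-- The starting value is known at time `0`. -/
  meas_ξ_zero : Measurable[ℱ 0] (ξ 0)
  meas_C_zero : Measurable[ℱ 0] (C 0)
  meas_θ_zero : Measurable[ℱ 0] (θ 0)
  meas_μ_zero : Measurable[ℱ 0] (μ 0)
  /-- The samples of step `n + 1` are known at time `n + 1`. -/
  meas_X₁ : ∀ n, Measurable[ℱ (n + 1)] (X₁ (n + 1))
  meas_X₂ : ∀ n, Measurable[ℱ (n + 1)] (X₂ (n + 1))
  meas_X₃ : ∀ n, Measurable[ℱ (n + 1)] (X₃ (n + 1))
  meas_X₄ : ∀ n, Measurable[ℱ (n + 1)] (X₄ (n + 1))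
  /-- Given the past, the samples follow the tilted laws. -/
  law_X₁ : ∀ n, HasCondLaw P (ℱ n) (X₁ (n + 1)) (fun ω => esscher ν (θ n ω))
  law_X₂ : ∀ n, HasCondLaw P (ℱ n) (X₂ (n + 1)) (fun ω => esscher ν (μ n ω))
  law_X₃ : ∀ n, HasCondLaw P (ℱ n) (X₃ (n + 1)) (fun ω => esscher ν (-θ n ω))
  law_X₄ : ∀ n, HasCondLaw P (ℱ n) (X₄ (n + 1)) (fun ω => esscher ν (-μ n ω))
  /-- The recursion `Z_{n+1} = Z_n - γ_{n+1} L(Z_n, X_{n+1})`, component by component. -/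
  step_ξ : ∀ n ω, ξ (n + 1) ω =
    ξ n ω - γ (n + 1) * L1 ν φ α (ξ n ω) (θ n ω) (X₁ (n + 1) ω)
  step_C : ∀ n ω, C (n + 1) ω =
    C n ω - γ (n + 1) * L2 ν φ Ψ α (ξ n ω) (C n ω) (μ n ω) (X₂ (n + 1) ω)
  step_θ : ∀ n ω, θ (n + 1) ω =
    θ n ω - γ (n + 1) • L3 ν φ (ξ n ω) (θ n ω) (X₃ (n + 1) ω)
  step_μ : ∀ n ω, μ (n + 1) ω =
    μ n ω - γ (n + 1) • L4 ν φ Ψ lam (ξ n ω) (μ n ω) (X₄ (n + 1) ω)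

end EsscherVaR

end

open EsscherVaR

namespace EsscherVaR

/-! ### Exponential moments -/

/-! Write D(θ) = exp(-(ψ(θ)+ψ(-θ))/2) and let F be the distribution function of the loss. The
difficulty is a circularity: the step of ξ is damped by D(θ), which may vanish if θ escapes, while θ
is known to be pulled inward only once ξ settles at a level where its objective is coercive.

The circle is broken path by path. Under ν_θ the likelihood ratio has second moment exp(ψ(θ)+ψ(-θ)),
so the damping makes the second moment of `L1` bounded uniformly in (ξ, θ) and the noise series of ξ
converges. What remains is a scalar recursion whose drift has the sign of F(ξ) - α. It converges for
arbitrary nonnegative weights (`exists_tendsto_of_sign_drift`), and a limit l with F(l) ≠ α would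
force Σ γ D(θ) < ∞. But the outward push on log(1+‖θ‖²) is at most a multiple of γ D(θ)², so θ would
be bounded, D(θ) bounded below and Σ γ finite, a contradiction (`summable_of_summable_damped`).

Both Esscher parameters are instances of one scheme with a weight G and a prefactor p
(`IsDampedWeight`). Under ν_{-t} the mean increment is p exp(-(ψ(t)+ψ(-t))) times the gradient of
the convex objective t ↦ E[G exp(-⟨t,X⟩+ψ(t))]; only the convexity inequality is used
(`le_integral_inner_weightedIncr`). A reverse Hölder bound turns ψ(t) - 2ψ(t/2) → ∞ into coercivity
(`le_weightedObj`), and the same limit makes ψ strictly convex (`cumulant_midpoint_lt`), so the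
minimiser exists and is unique when G has positive mass. Concavity of ψ - δ‖·‖² makes the tilted
laws sub-Gaussian around means of linear growth, whence increments with second moment O(1+‖t‖²). The
Lyapunov function log(1+‖t‖²) then gives boundedness, and the squared distance to the minimiser
gives convergence (`exists_tendsto_argmin`).

The component C averages samples whose conditional mean is a continuous function of ξ alone. The
limits are square integrable because they are bounded: the values-at-risk form a compact set, over
which the minimisers are uniformly bounded. -/

/-- The vector of signs attached to a family of booleans. -/
def signVec {d : ℕ} (s : Fin d → Bool) : Vec d := WithLp.toLp 2 (fun i => if s i then 1 else -1)

lemma norm_signVec {d : ℕ} (s : Fin d → Bool) : ‖signVec s‖ = √(d : ℝ) := by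
  rw [EuclideanSpace.norm_eq]
  congr 1
  have h : ∀ i : Fin d, ‖signVec s i‖ ^ 2 = 1 := by
    intro i
    by_cases hs : s i <;> simp [signVec, hs]
  rw [Finset.sum_congr rfl fun i _ => h i]
  simp

/-- The sign pattern of x realises its ℓ¹ norm, which dominates the Euclidean norm. -/
lemma exists_norm_le_inner_signVec {d : ℕ} (x : Vec d) : ∃ s, ‖x‖ ≤ inner ℝ (signVec s) x := by
  refine ⟨fun i => decide (0 ≤ x i), ?_⟩
  have h1 : inner ℝ (signVec fun i => decide (0 ≤ x i)) x = ∑ i, |x i| := by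
    rw [PiLp.inner_apply]
    refine Finset.sum_congr rfl fun i _ => ?_
    by_cases h : 0 ≤ x i
    · simp [signVec, h, abs_of_nonneg h]
    · simp [signVec, h, abs_of_neg (not_le.1 h)]
  rw [h1, EuclideanSpace.norm_eq]
  refine Real.sqrt_le_iff.2 ⟨Finset.sum_nonneg fun i _ => abs_nonneg _, ?_⟩
  simpa using Finset.sum_sq_le_sq_sum_of_nonneg (s := Finset.univ) (f := fun i => |x i|)
    (fun i _ => abs_nonneg _)

/-- Reduces exp(a‖x‖) to finitely many exponentials of linear forms, whose moments the cumulant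
controls. The √d in the prefactor of `L4` is the norm of these sign vectors. -/
lemma exp_mul_norm_le {d : ℕ} {a : ℝ} (ha : 0 ≤ a) (x : Vec d) :
    Real.exp (a * ‖x‖) ≤ ∑ s : Fin d → Bool, Real.exp (inner ℝ (a • signVec s) x) := by
  obtain ⟨s, hs⟩ := exists_norm_le_inner_signVec x
  calc Real.exp (a * ‖x‖) ≤ Real.exp (inner ℝ (a • signVec s) x) := by
        rw [real_inner_smul_left]; gcongr
    _ ≤ _ := Finset.single_le_sum (f := fun s => Real.exp (inner ℝ (a • signVec s) x))
        (fun _ _ => (Real.exp_pos _).le) (Finset.mem_univ s)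

lemma sq_le_two_mul_exp_add_exp_neg (y : ℝ) : y ^ 2 ≤ 2 * (Real.exp y + Real.exp (-y)) := by
  rcases le_total 0 y with h | h
  · nlinarith [Real.quadratic_le_exp_of_nonneg h, Real.exp_pos (-y)]
  · nlinarith [Real.quadratic_le_exp_of_nonneg (neg_nonneg.2 h), Real.exp_pos y]

lemma abs_inner_le_of_norm_le {d : ℕ} {R : ℝ} {t : Vec d} (ht : ‖t‖ ≤ R) (x : Vec d) :
    |inner ℝ t x| ≤ R * ‖x‖ :=
  (abs_real_inner_le_norm t x).trans (by gcongr)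

lemma exp_inner_le {d : ℕ} {R : ℝ} {t : Vec d} (ht : ‖t‖ ≤ R) (x : Vec d) :
    Real.exp (inner ℝ t x) ≤ Real.exp (R * ‖x‖) :=
  Real.exp_le_exp.2 ((le_abs_self _).trans (abs_inner_le_of_norm_le ht x))

/-- All exponential moments of `ν` are finite. -/
def ExpMoments {d : ℕ} (ν : Measure (Vec d)) : Prop :=
  ∀ θ : Vec d, Integrable (fun x => Real.exp (inner ℝ θ x)) ν

/-! ### The cumulant generating function and the tilted laws -/

section Tilting

variable {d : ℕ} {ν : Measure (Vec d)}

lemma ExpMoments.integrable_exp_mul_norm (hψ : ExpMoments ν) (a : ℝ) :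
    Integrable (fun x => Real.exp (a * ‖x‖)) ν := by
  have h : Integrable (fun x => ∑ s : Fin d → Bool, Real.exp (inner ℝ (|a| • signVec s) x)) ν :=
    integrable_finsetSum _ fun s _ => hψ _
  refine h.mono' (by fun_prop) (ae_of_all _ fun x => ?_)
  rw [Real.norm_of_nonneg (Real.exp_pos _).le]
  refine le_trans ?_ (exp_mul_norm_le (abs_nonneg a) x)
  gcongr
  exact le_abs_self a

lemma ExpMoments.integrable_of_le (hψ : ExpMoments ν) {E : Type*} [NormedAddCommGroup E]
    {f : Vec d → E} (hf : AEStronglyMeasurable f ν) {B a : ℝ}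
    (h : ∀ x, ‖f x‖ ≤ B * Real.exp (a * ‖x‖)) : Integrable f ν :=
  ((hψ.integrable_exp_mul_norm a).const_mul B).mono' hf (ae_of_all _ h)

lemma exp_cumulant [IsProbabilityMeasure ν] (hψ : ExpMoments ν) (t : Vec d) :
    Real.exp (cumulant ν t) = ∫ x, Real.exp (inner ℝ t x) ∂ν :=
  Real.exp_log (integral_exp_pos (hψ t))

lemma cumulant_zero [IsProbabilityMeasure ν] : cumulant ν 0 = 0 := by
  simp [cumulant]

instance isProbabilityMeasure_esscher_of_expMoments [IsProbabilityMeasure ν]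
    [hψ : Fact (ExpMoments ν)] (t : Vec d) : IsProbabilityMeasure (esscher ν t) :=
  isProbabilityMeasure_tilted (hψ.out t)

lemma integral_esscher [IsProbabilityMeasure ν] (hψ : ExpMoments ν) {E : Type*}
    [NormedAddCommGroup E] [NormedSpace ℝ E] (t : Vec d) (g : Vec d → E) :
    ∫ x, g x ∂(esscher ν t) = ∫ x, Real.exp (inner ℝ t x - cumulant ν t) • g x ∂ν := by
  rw [esscher, integral_tilted]
  simp_rw [Real.exp_sub, exp_cumulant hψ]

lemma integrable_esscher_iff (hψ : ExpMoments ν) {E : Type*}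
    [NormedAddCommGroup E] [NormedSpace ℝ E] (t : Vec d) (g : Vec d → E) :
    Integrable g (esscher ν t) ↔ Integrable (fun x => Real.exp (inner ℝ t x) • g x) ν :=
  integrable_tilted_iff (hψ t) g

lemma ExpMoments.integrable_esscher_of_le (hψ : ExpMoments ν) {E : Type*} [NormedAddCommGroup E]
    [NormedSpace ℝ E] (t : Vec d)
    {f : Vec d → E} (hf : AEStronglyMeasurable f ν) {B a : ℝ}
    (h : ∀ x, ‖f x‖ ≤ B * Real.exp (a * ‖x‖)) : Integrable f (esscher ν t) := by
  rw [integrable_esscher_iff hψ]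
  refine hψ.integrable_of_le (B := B) (a := ‖t‖ + a) (by fun_prop) fun x => ?_
  rw [norm_smul, Real.norm_of_nonneg (Real.exp_pos _).le, add_mul, Real.exp_add]
  calc _ ≤ Real.exp (‖t‖ * ‖x‖) * (B * Real.exp (a * ‖x‖)) := by
        gcongr
        · exact real_inner_le_norm t x
        · exact h x
    _ = _ := by ring

lemma norm_le_exp_norm {d : ℕ} (x : Vec d) : ‖x‖ ≤ Real.exp (1 * ‖x‖) := by
  have := Real.add_one_le_exp ‖x‖
  rw [one_mul]; linarith

/-- The gradient of the cumulant generating function is the mean of the tilted law. -/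
lemma hasFDerivAt_cumulant [IsProbabilityMeasure ν] (hψ : ExpMoments ν) (t : Vec d) :
    HasFDerivAt (cumulant ν)
      ((∫ x, Real.exp (inner ℝ t x) ∂ν)⁻¹ •
        ∫ x, Real.exp (inner ℝ t x) • innerSL ℝ x ∂ν) t := by
  have h : HasFDerivAt (fun t => ∫ x, Real.exp (inner ℝ t x) ∂ν)
      (∫ x, Real.exp (inner ℝ t x) • innerSL ℝ x ∂ν) t := by
    -- In the exponent ‖t‖ + 2, one unit pays for the ball around t and one absorbs the factor ‖x‖
    -- of the derivative.
    refine hasFDerivAt_integral_of_dominated_of_fderiv_le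
      (F := fun (t : Vec d) x => Real.exp (inner ℝ t x))
      (F' := fun t x => Real.exp (inner ℝ t x) • innerSL ℝ x)
      (bound := fun x => Real.exp ((‖t‖ + 2) * ‖x‖)) (Metric.ball_mem_nhds t one_pos)
      (Eventually.of_forall fun s => (by fun_prop)) (hψ t)
      (by fun_prop) (ae_of_all _ fun x s hs => ?_) (hψ.integrable_exp_mul_norm _)
      (ae_of_all _ fun x s hs => ?_)
    · rw [norm_smul, innerSL_apply_norm, Real.norm_of_nonneg (Real.exp_pos _).le]
      have hs' : ‖s‖ ≤ ‖t‖ + 1 := by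
        rw [Metric.mem_ball, dist_eq_norm] at hs
        linarith [norm_le_norm_add_norm_sub' s t]
      calc _ ≤ Real.exp ((‖t‖ + 1) * ‖x‖) * Real.exp (1 * ‖x‖) := by
            gcongr
            · exact (le_abs_self _).trans (abs_inner_le_of_norm_le hs' x)
            · exact norm_le_exp_norm x
        _ = _ := by rw [← Real.exp_add]; ring_nf
    · have h1 : HasFDerivAt (fun s : Vec d => (inner ℝ s x : ℝ)) (innerSL ℝ x) s := by
        have := (innerSL ℝ x).hasFDerivAt (x := s)
        refine this.congr_of_eventuallyEq (Eventually.of_forall fun y => ?_)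
        simp [real_inner_comm]
      exact h1.exp
  exact h.log (integral_exp_pos (hψ t)).ne'

lemma differentiable_cumulant [IsProbabilityMeasure ν] (hψ : ExpMoments ν) :
    Differentiable ℝ (cumulant ν) := fun t => (hasFDerivAt_cumulant hψ t).differentiableAt

lemma continuous_cumulant [IsProbabilityMeasure ν] (hψ : ExpMoments ν) :
    Continuous (cumulant ν) := (differentiable_cumulant hψ).continuous

lemma measurable_gradient_cumulant : Measurable (gradient (cumulant ν)) :=
  (InnerProductSpace.toDual ℝ (Vec d)).symm.continuous.measurable.comp (measurable_fderiv ℝ _)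

lemma inner_gradient_cumulant [IsProbabilityMeasure ν] (hψ : ExpMoments ν) (t v : Vec d) :
    inner ℝ (gradient (cumulant ν) t) v = ∫ x, inner ℝ v x ∂(esscher ν t) := by
  have hint : Integrable (fun x => Real.exp (inner ℝ t x) • innerSL ℝ x) ν := by
    refine hψ.integrable_of_le (B := 1) (a := ‖t‖ + 1) (by fun_prop) fun x => ?_
    rw [norm_smul, innerSL_apply_norm, Real.norm_of_nonneg (Real.exp_pos _).le, one_mul, add_mul,
      Real.exp_add]
    gcongr
    · exact real_inner_le_norm t x
    · exact norm_le_exp_norm x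
  rw [gradient, InnerProductSpace.toDual_symm_apply, (hasFDerivAt_cumulant hψ t).fderiv,
    integral_esscher hψ]
  simp_rw [Real.exp_sub, exp_cumulant hψ]
  rw [_root_.smul_apply, ContinuousLinearMap.integral_apply hint, smul_eq_mul,
    ← integral_const_mul]
  refine integral_congr_ae (ae_of_all _ fun x => ?_)
  simp [real_inner_comm, div_eq_inv_mul, mul_assoc]

lemma integrable_inner_esscher (hψ : ExpMoments ν) (t v : Vec d) :
    Integrable (fun x => (inner ℝ v x : ℝ)) (esscher ν t) := by
  refine hψ.integrable_esscher_of_le t (B := ‖v‖) (a := 1) (by fun_prop) fun x => ?_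
  refine (abs_real_inner_le_norm v x).trans ?_
  gcongr
  exact norm_le_exp_norm x

/-- Tilts compose, so the Laplace transform of a tilted law is an increment of ψ. Bounds on ψ
thereby become moment bounds for the sampling laws. -/
lemma integral_exp_inner_esscher [IsProbabilityMeasure ν] (hψ : ExpMoments ν) (t v : Vec d) :
    ∫ x, Real.exp (inner ℝ v x) ∂(esscher ν t) = Real.exp (cumulant ν (t + v) - cumulant ν t) := by
  rw [integral_esscher hψ, Real.exp_sub, exp_cumulant hψ (t + v), ← integral_div]
  refine integral_congr_ae (ae_of_all _ fun x => ?_)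
  simp only [smul_eq_mul, inner_add_left, Real.exp_add, Real.exp_sub]
  ring

lemma integrable_exp_inner_esscher (hψ : ExpMoments ν) (t v : Vec d) :
    Integrable (fun x => Real.exp (inner ℝ v x)) (esscher ν t) := by
  refine hψ.integrable_esscher_of_le t (B := 1) (a := ‖v‖) (by fun_prop) fun x => ?_
  rw [Real.norm_of_nonneg (Real.exp_pos _).le, one_mul]
  exact exp_inner_le le_rfl x

/-- The cumulant generating function lies above its tangent planes. -/
lemma tangent_le_cumulant [IsProbabilityMeasure ν] (hψ : ExpMoments ν) (t v : Vec d) :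
    cumulant ν t + inner ℝ (gradient (cumulant ν) t) v ≤ cumulant ν (t + v) := by
  have : Fact (ExpMoments ν) := ⟨hψ⟩
  set a := (inner ℝ (gradient (cumulant ν) t) v : ℝ) with ha
  -- Jensen's inequality for the exponential: the tilted law gives ⟨v, x⟩ the mean a, and exp y ≥
  -- exp a · (1 + y - a).
  have h1 : Real.exp a ≤ Real.exp (cumulant ν (t + v) - cumulant ν t) := by
    rw [← integral_exp_inner_esscher hψ]
    have h2 : ∫ x, Real.exp a * (1 + (inner ℝ v x - a)) ∂(esscher ν t) = Real.exp a := by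
      have h3 : Integrable (fun x => (inner ℝ v x : ℝ) - a) (esscher ν t) :=
        (integrable_inner_esscher hψ t v).sub (integrable_const _)
      rw [integral_const_mul, integral_add (integrable_const _) h3,
        integral_sub (integrable_inner_esscher hψ t v) (integrable_const _),
        ← inner_gradient_cumulant hψ]
      simp [← ha]
    rw [← h2]
    refine integral_mono ?_ (integrable_exp_inner_esscher hψ t v) fun x => ?_
    · exact ((integrable_const _).add
        ((integrable_inner_esscher hψ t v).sub (integrable_const _))).const_mul _
    · have := Real.add_one_le_exp (inner ℝ v x - a)
      calc _ ≤ Real.exp a * Real.exp (inner ℝ v x - a) := by gcongr; linarith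
        _ = _ := by rw [← Real.exp_add]; ring_nf
  have := Real.exp_le_exp.1 h1
  linarith

/-- The tangent plane at 0 taken in opposite directions: the slopes cancel. This is what keeps the
damping exponentials below 1. -/
lemma cumulant_add_cumulant_neg_nonneg [IsProbabilityMeasure ν] (hψ : ExpMoments ν) (t : Vec d) :
    0 ≤ cumulant ν t + cumulant ν (-t) := by
  have h1 := tangent_le_cumulant hψ 0 t
  have h2 := tangent_le_cumulant hψ 0 (-t)
  simp only [zero_add, cumulant_zero, inner_neg_right] at h1 h2
  linarith

/-- Upper quadratic bound at the tangent plane when `ψ - δ|·|²` is concave. -/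
lemma cumulant_le_quadratic [IsProbabilityMeasure ν] (hψ : ExpMoments ν) {δ : ℝ}
    (hδ : ConcaveOn ℝ Set.univ (fun θ => cumulant ν θ - δ * ‖θ‖ ^ 2)) (t v : Vec d) :
    cumulant ν (t + v) ≤
      cumulant ν t + inner ℝ (gradient (cumulant ν) t) v + δ * ‖v‖ ^ 2 := by
  set a := (inner ℝ (gradient (cumulant ν) t) v : ℝ) with ha
  have hd : HasDerivAt (fun s : ℝ => cumulant ν (t + s • v)) a 0 := by
    have h1 := (differentiable_cumulant hψ (t + (0 : ℝ) • v)).hasFDerivAt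
    have h2 : HasDerivAt (fun s : ℝ => t + s • v) v 0 := by
      simpa using ((hasDerivAt_id (0 : ℝ)).smul_const v).const_add t
    have h3 := h1.comp_hasDerivAt (0 : ℝ) h2
    simp only [zero_smul, add_zero] at h3
    rw [ha, gradient, InnerProductSpace.toDual_symm_apply]
    exact h3
  have hlim := hd.tendsto_slope_zero_right
  simp only [zero_add, zero_smul, add_zero, smul_eq_mul] at hlim
  -- Concavity on the segment from t to t + v bounds the full increment by the slope at s plus (1 -
  -- s) δ‖v‖²; then s → 0 turns the slope into a.
  have hlim2 : Tendsto (fun s : ℝ => s⁻¹ * (cumulant ν (t + s • v) - cumulant ν t)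
      + (1 - s) * (δ * ‖v‖ ^ 2)) (𝓝[>] 0) (𝓝 (a + (1 - 0) * (δ * ‖v‖ ^ 2))) := by
    refine hlim.add (Tendsto.mul_const _ ?_)
    exact (tendsto_const_nhds.sub tendsto_id).mono_left nhdsWithin_le_nhds
  have key : cumulant ν (t + v) - cumulant ν t ≤ a + (1 - 0) * (δ * ‖v‖ ^ 2) := by
    refine ge_of_tendsto hlim2 ?_
    filter_upwards [Ioo_mem_nhdsGT (zero_lt_one' ℝ)] with s hs
    have hc := hδ.2 (Set.mem_univ t) (Set.mem_univ (t + v)) (sub_nonneg.2 hs.2.le) hs.1.le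
      (by ring)
    have he : (1 - s) • t + s • (t + v) = t + s • v := by module
    rw [he] at hc
    simp only [smul_eq_mul] at hc
    have n1 : ‖t + s • v‖ ^ 2 = ‖t‖ ^ 2 + 2 * s * inner ℝ t v + s ^ 2 * ‖v‖ ^ 2 := by
      rw [norm_add_sq_real, inner_smul_right, norm_smul, Real.norm_eq_abs, mul_pow, sq_abs]; ring
    have n2 : ‖t + v‖ ^ 2 = ‖t‖ ^ 2 + 2 * inner ℝ t v + ‖v‖ ^ 2 := norm_add_sq_real t v
    rw [n1, n2] at hc
    have h5 : s * (cumulant ν (t + v) - cumulant ν t) ≤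
        (cumulant ν (t + s • v) - cumulant ν t) + s * ((1 - s) * (δ * ‖v‖ ^ 2)) := by
      nlinarith [hc]
    have h6 : s⁻¹ * (s * (cumulant ν (t + v) - cumulant ν t)) ≤
        s⁻¹ * ((cumulant ν (t + s • v) - cumulant ν t) + s * ((1 - s) * (δ * ‖v‖ ^ 2))) := by
      have := inv_nonneg.2 hs.1.le
      gcongr
    rw [mul_add, inv_mul_cancel_left₀ hs.1.ne', inv_mul_cancel_left₀ hs.1.ne'] at h6
    exact h6
  linarith

/-- The gradient of the cumulant generating function grows at most linearly. -/
lemma norm_gradient_cumulant_le [IsProbabilityMeasure ν] (hψ : ExpMoments ν) {δ : ℝ} (hδ0 : 0 < δ)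
    (hδ : ConcaveOn ℝ Set.univ (fun θ => cumulant ν θ - δ * ‖θ‖ ^ 2)) :
    ∃ B, 0 ≤ B ∧ ∀ t, ‖gradient (cumulant ν) t‖ ≤ B * (1 + ‖t‖) := by
  refine ⟨‖gradient (cumulant ν) 0‖ + 4 * δ, by positivity, fun t => ?_⟩
  set m := gradient (cumulant ν) t with hm
  set m0 := gradient (cumulant ν) 0
  rcases eq_or_ne m 0 with h0 | h0
  · rw [h0, norm_zero]; positivity
  have hmp : 0 < ‖m‖ := norm_pos_iff.2 h0
  -- A direction parallel to m and of length comparable to t. The tangent at t makes ‖m‖(1 + ‖t‖)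
  -- appear, while ψ(t + u) grows at most quadratically; the tangent at 0 removes ψ(t).
  set u : Vec d := ((1 + ‖t‖) / ‖m‖) • m with hu
  have hun : ‖u‖ = 1 + ‖t‖ := by
    rw [hu, norm_smul, Real.norm_of_nonneg (by positivity)]; field_simp
  have hin : inner ℝ m u = ‖m‖ * (1 + ‖t‖) := by
    rw [hu, inner_smul_right, real_inner_self_eq_norm_sq]; field_simp
  have h1 := tangent_le_cumulant hψ t u
  have h2 := cumulant_le_quadratic hψ hδ 0 (t + u)
  have h3 := tangent_le_cumulant hψ 0 t
  rw [← hm, hin] at h1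
  simp only [zero_add, cumulant_zero] at h2 h3
  rw [inner_add_right] at h2
  have h4 : inner ℝ m0 u ≤ ‖m0‖ * (1 + ‖t‖) := by
    rw [← hun]; exact real_inner_le_norm _ _
  have h5 : ‖t + u‖ ^ 2 ≤ (2 * (1 + ‖t‖)) ^ 2 := by
    have := norm_add_le t u
    gcongr
    linarith
  have h6 : ‖m‖ * (1 + ‖t‖) ≤ ((‖m0‖ + 4 * δ) * (1 + ‖t‖)) * (1 + ‖t‖) := by
    have := norm_nonneg t
    have := norm_nonneg m0
    have h7 : δ * ‖t + u‖ ^ 2 ≤ δ * (2 * (1 + ‖t‖)) ^ 2 := by gcongr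
    nlinarith [mul_nonneg (norm_nonneg m0) (norm_nonneg t), mul_nonneg
      (mul_nonneg (norm_nonneg m0) (norm_nonneg t)) (norm_nonneg t)]
  exact le_of_mul_le_mul_right h6 (by positivity)

/-- The tilted law is sub-Gaussian around its mean when `ψ - δ|·|²` is concave. -/
lemma integral_exp_inner_esscher_le [IsProbabilityMeasure ν] (hψ : ExpMoments ν) {δ : ℝ}
    (hδ : ConcaveOn ℝ Set.univ (fun θ => cumulant ν θ - δ * ‖θ‖ ^ 2)) (t v : Vec d) :
    ∫ x, Real.exp (inner ℝ v x) ∂(esscher ν t) ≤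
      Real.exp (inner ℝ (gradient (cumulant ν) t) v + δ * ‖v‖ ^ 2) := by
  rw [integral_exp_inner_esscher hψ]
  gcongr
  linarith [cumulant_le_quadratic hψ hδ t v]

/-- Bounding each squared coordinate by exponentials leaves a finite sum of exponentials of linear
forms, which the sub-Gaussian estimate can integrate; the shifts by m i keep them centred. -/
lemma exp_mul_norm_mul_norm_sq_le {d : ℕ} {a : ℝ} (ha : 0 ≤ a) (x m : Vec d) :
    Real.exp (a * ‖x‖) * ‖x - m‖ ^ 2 ≤ ∑ s : Fin d → Bool, ∑ i : Fin d,
      2 * (Real.exp (inner ℝ (a • signVec s + EuclideanSpace.single i 1) x - m i) +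
        Real.exp (inner ℝ (a • signVec s - EuclideanSpace.single i 1) x + m i)) := by
  have h1 : ‖x - m‖ ^ 2 ≤
      ∑ i : Fin d, 2 * (Real.exp (x i - m i) + Real.exp (-(x i - m i))) := by
    rw [EuclideanSpace.norm_sq_eq]
    refine Finset.sum_le_sum fun i _ => ?_
    rw [Real.norm_eq_abs, sq_abs]
    exact sq_le_two_mul_exp_add_exp_neg _
  refine (mul_le_mul (exp_mul_norm_le ha x) h1 (by positivity)
    (Finset.sum_nonneg fun _ _ => (Real.exp_pos _).le)).trans (le_of_eq ?_)
  rw [Finset.sum_mul_sum]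
  refine Finset.sum_congr rfl fun s _ => Finset.sum_congr rfl fun i _ => ?_
  have h2 : (inner ℝ (EuclideanSpace.single i (1 : ℝ)) x : ℝ) = x i := by
    simp [EuclideanSpace.inner_single_left]
  rw [inner_add_left, inner_sub_left, h2, mul_left_comm, mul_add, ← Real.exp_add, ← Real.exp_add]
  ring_nf

lemma integrable_exp_mul_norm_mul_norm_sq [IsProbabilityMeasure ν] (hψ : ExpMoments ν)
    (a : ℝ) (t m : Vec d) :
    Integrable (fun x => Real.exp (a * ‖x‖) * ‖x - m‖ ^ 2) (esscher ν t) := by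
  refine hψ.integrable_esscher_of_le t (B := 2 + 2 * ‖m‖ ^ 2) (a := a + 2)
    (by fun_prop) fun x => ?_
  rw [Real.norm_of_nonneg (by positivity), add_mul a 2, Real.exp_add]
  have h1 : ‖x‖ ^ 2 ≤ Real.exp (2 * ‖x‖) := by
    have := norm_le_exp_norm x
    calc ‖x‖ ^ 2 ≤ Real.exp (1 * ‖x‖) ^ 2 := by gcongr
      _ = _ := by rw [← Real.exp_nat_mul]; ring_nf
  have h2 : 1 ≤ Real.exp (2 * ‖x‖) := Real.one_le_exp (by positivity)
  have h3 : ‖x - m‖ ^ 2 ≤ (2 + 2 * ‖m‖ ^ 2) * Real.exp (2 * ‖x‖) := by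
    have h4 : ‖x - m‖ ^ 2 ≤ (‖x‖ + ‖m‖) ^ 2 := by gcongr; exact norm_sub_le x m
    nlinarith [sq_nonneg (‖x‖ - ‖m‖), sq_nonneg ‖m‖]
  calc _ ≤ Real.exp (a * ‖x‖) * ((2 + 2 * ‖m‖ ^ 2) * Real.exp (2 * ‖x‖)) := by gcongr
    _ = _ := by ring

/-- Exponentially weighted variance of the tilted laws. -/
lemma exists_integral_exp_mul_norm_sq_le [IsProbabilityMeasure ν] (hψ : ExpMoments ν) {δ : ℝ}
    (hδ0 : 0 < δ) (hδ : ConcaveOn ℝ Set.univ (fun θ => cumulant ν θ - δ * ‖θ‖ ^ 2))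
    {a : ℝ} (ha : 0 ≤ a) :
    ∃ B, 0 ≤ B ∧ ∀ t, ∫ x, Real.exp (a * ‖x‖) * ‖x - gradient (cumulant ν) t‖ ^ 2 ∂(esscher ν t) ≤
      B * Real.exp (a * √(d : ℝ) * ‖gradient (cumulant ν) t‖) := by
  -- Here a√d + 1 bounds the norm of every exponent vector a·(signs) ± e_i, so D is the largest
  -- sub-Gaussian factor.
  set D := Real.exp (δ * (a * √(d : ℝ) + 1) ^ 2) with hD
  refine ⟨∑ s : Fin d → Bool, ∑ i : Fin d, 2 * (D + D), by positivity, fun t => ?_⟩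
  set m := gradient (cumulant ν) t with hm
  have key : ∀ (s : Fin d → Bool) (w : Vec d), ‖w‖ = 1 →
      ∫ x, Real.exp (inner ℝ (a • signVec s + w) x - inner ℝ m w) ∂(esscher ν t) ≤
        D * Real.exp (a * √(d : ℝ) * ‖m‖) := by
    intro s w hw
    simp_rw [Real.exp_sub]
    rw [integral_div, div_le_iff₀ (Real.exp_pos _)]
    refine (integral_exp_inner_esscher_le hψ hδ t _).trans ?_
    rw [hD, ← Real.exp_add, ← Real.exp_add, ← hm]
    apply Real.exp_le_exp.2
    have h1 : ‖a • signVec s + w‖ ≤ a * √(d : ℝ) + 1 := by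
      refine (norm_add_le _ _).trans ?_
      rw [norm_smul, norm_signVec, hw, Real.norm_of_nonneg ha]
    have h2 : inner ℝ m (a • signVec s) ≤ a * √(d : ℝ) * ‖m‖ := by
      refine (real_inner_le_norm _ _).trans (le_of_eq ?_)
      rw [norm_smul, norm_signVec, Real.norm_of_nonneg ha]; ring
    have h3 : δ * ‖a • signVec s + w‖ ^ 2 ≤ δ * (a * √(d : ℝ) + 1) ^ 2 := by gcongr
    rw [inner_add_right]
    linarith
  have hint : ∀ (u : Vec d) (c : ℝ),
      Integrable (fun x => Real.exp (inner ℝ u x + c)) (esscher ν t) := by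
    intro u c
    simp_rw [Real.exp_add]
    exact (integrable_exp_inner_esscher hψ t u).mul_const _
  have hint' : ∀ (u : Vec d) (c : ℝ),
      Integrable (fun x => Real.exp (inner ℝ u x - c)) (esscher ν t) := by
    intro u c
    simpa [sub_eq_add_neg] using hint u (-c)
  have hI : ∀ (s : Fin d → Bool) (i : Fin d), Integrable (fun x =>
      2 * (Real.exp (inner ℝ (a • signVec s + EuclideanSpace.single i 1) x - m i) +
        Real.exp (inner ℝ (a • signVec s - EuclideanSpace.single i 1) x + m i))) (esscher ν t) :=
    fun s i => ((hint' _ _).add (hint _ _)).const_mul 2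
  refine (integral_mono (integrable_exp_mul_norm_mul_norm_sq hψ a t m)
    (integrable_finsetSum _ fun s _ => integrable_finsetSum _ fun i _ => hI s i)
    (fun x => exp_mul_norm_mul_norm_sq_le ha x m)).trans ?_
  rw [integral_finsetSum _ fun s _ => integrable_finsetSum _ fun i _ => hI s i, Finset.sum_mul]
  refine Finset.sum_le_sum fun s _ => ?_
  rw [integral_finsetSum _ fun i _ => hI s i, Finset.sum_mul]
  refine Finset.sum_le_sum fun i _ => ?_
  rw [integral_const_mul, integral_add (hint' _ _) (hint _ _)]
  have k1 := key s (EuclideanSpace.single i 1) (by simp)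
  have k2 := key s (-EuclideanSpace.single i 1) (by simp)
  have e1 : (inner ℝ m (EuclideanSpace.single i (1 : ℝ)) : ℝ) = m i := by
    simp [EuclideanSpace.inner_single_right]
  rw [e1] at k1
  rw [inner_neg_right, e1, ← sub_eq_add_neg] at k2
  simp only [sub_neg_eq_add] at k2
  linarith

/-- Strict midpoint convexity of the cumulant generating function. -/
lemma cumulant_midpoint_lt [IsProbabilityMeasure ν] (hψ : ExpMoments ν)
    (hlim : Tendsto (fun θ => cumulant ν θ - 2 * cumulant ν ((1 / 2 : ℝ) • θ))
      (Bornology.cobounded (Vec d)) atTop) {t t' : Vec d} (hne : t ≠ t') :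
    cumulant ν ((1 / 2 : ℝ) • (t + t')) < (cumulant ν t + cumulant ν t') / 2 := by
  by_contra hcon
  push Not at hcon
  -- The square roots of the two tilted densities. If strict convexity fails, their inner product in
  -- L²(ν) is at least 1 although both have norm 1, so they agree almost everywhere.
  set f : Vec d → Vec d → ℝ := fun t x => Real.exp ((inner ℝ t x - cumulant ν t) / 2) with hf
  have hsq : ∀ t x, f t x ^ 2 = Real.exp (inner ℝ t x) / Real.exp (cumulant ν t) := by
    intro t x
    rw [hf, ← Real.exp_sub, ← Real.exp_nat_mul]
    congr 1; push_cast; ring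
  have hI : ∀ t, Integrable (fun x => f t x ^ 2) ν := by
    intro t; simp_rw [hsq]; exact (hψ t).div_const _
  have h1 : ∀ t, ∫ x, f t x ^ 2 ∂ν = 1 := by
    intro t
    simp_rw [hsq]
    rw [integral_div, ← exp_cumulant hψ, div_self (Real.exp_pos _).ne']
  have hprod : ∀ x, f t x * f t' x = Real.exp (inner ℝ ((1 / 2 : ℝ) • (t + t')) x) *
      Real.exp (-(cumulant ν t + cumulant ν t') / 2) := by
    intro x
    rw [hf, ← Real.exp_add, ← Real.exp_add, inner_smul_left, inner_add_left]
    congr 1; simp; ring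
  have hIp : Integrable (fun x => f t x * f t' x) ν := by
    simp_rw [hprod]; exact (hψ _).mul_const _
  have hp : 1 ≤ ∫ x, f t x * f t' x ∂ν := by
    simp_rw [hprod]
    rw [integral_mul_const, ← exp_cumulant hψ, ← Real.exp_add]
    exact Real.one_le_exp (by linarith)
  have hexp : ∀ x, (f t x - f t' x) ^ 2 = f t x ^ 2 + f t' x ^ 2 - 2 * (f t x * f t' x) := by
    intro x; ring
  have hz : ∫ x, (f t x - f t' x) ^ 2 ∂ν ≤ 0 := by
    simp_rw [hexp]
    rw [integral_sub (f := fun x => f t x ^ 2 + f t' x ^ 2) ((hI t).add (hI t'))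
      (hIp.const_mul 2), integral_add (hI t) (hI t'),
      integral_const_mul, h1, h1]
    linarith
  have hId : Integrable (fun x => (f t x - f t' x) ^ 2) ν := by
    simp_rw [hexp]; exact ((hI t).add (hI t')).sub (hIp.const_mul 2)
  have hae : (fun x => (f t x - f t' x) ^ 2) =ᵐ[ν] 0 :=
    (integral_eq_zero_iff_of_nonneg (fun x => sq_nonneg _) hId).1
      (le_antisymm hz (integral_nonneg fun x => sq_nonneg _))
  set v := t - t' with hv
  have hvne : v ≠ 0 := sub_ne_zero.2 hne
  set c := cumulant ν t - cumulant ν t' with hc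
  have hconst : ∀ᵐ x ∂ν, (inner ℝ v x : ℝ) = c := by
    filter_upwards [hae] with x hx
    have hx' : f t x = f t' x := sub_eq_zero.1 (pow_eq_zero_iff two_ne_zero |>.1 hx)
    have := Real.exp_injective hx'
    rw [hv, inner_sub_left, hc]; linarith
  -- With ⟨v, x⟩ almost surely constant, ψ is linear along v, so ψ(sv) - 2ψ(sv/2) vanishes
  -- identically and cannot tend to infinity.
  have hlin : ∀ s : ℝ, cumulant ν (s • v) = s * c := by
    intro s
    have : ∫ x, Real.exp (inner ℝ (s • v) x) ∂ν = Real.exp (s * c) := by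
      rw [integral_congr_ae (g := fun _ => Real.exp (s * c))]
      · simp
      · filter_upwards [hconst] with x hx
        rw [real_inner_smul_left, hx]
    rw [cumulant, this, Real.log_exp]
  have hcob : Tendsto (fun s : ℝ => s • v) atTop (Bornology.cobounded (Vec d)) := by
    rw [← tendsto_norm_atTop_iff_cobounded]
    simp_rw [norm_smul]
    exact (tendsto_norm_atTop_atTop).atTop_mul_const (norm_pos_iff.2 hvne)
  have := hlim.comp hcob
  refine not_tendsto_const_atTop (0 : ℝ) (atTop : Filter ℝ) (this.congr fun s => ?_)
  simp only [Function.comp, smul_smul, hlin]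
  ring

end Tilting
end EsscherVaR

namespace EsscherVaR

/-! ### Recursive real sequences -/

/-- A nonnegative sequence with drift towards `0`, up to a convergent perturbation, tends to `0`. -/
lemma tendsto_zero_of_drift {u γ a e : ℕ → ℝ} {E B : ℝ} (hγ0 : ∀ n, 0 ≤ γ n)
    (hγ : Tendsto γ atTop (𝓝 0)) (hγs : Tendsto (fun n => ∑ k ∈ Finset.range n, γ k) atTop atTop)
    (he : Tendsto (fun n => ∑ k ∈ Finset.range n, e k) atTop (𝓝 E)) (hu : ∀ n, 0 ≤ u n)
    (hrec : ∀ᶠ n in atTop, u (n + 1) ≤ u n - γ n * a n + e n)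
    (hpos : ∀ ε > 0, ∃ c > 0, ∀ᶠ n in atTop, ε ≤ u n → c ≤ a n)
    (hB : ∀ᶠ n in atTop, -B ≤ a n) : Tendsto u atTop (𝓝 0) := by
  suffices h : ∀ ε > 0, ∀ᶠ n in atTop, u n ≤ 4 * ε by
    rw [Metric.tendsto_atTop']
    intro ε hε
    obtain ⟨N, hN⟩ := eventually_atTop.1 (h (ε / 5) (by positivity))
    refine ⟨N, fun n hn => ?_⟩
    rw [Real.dist_eq, sub_zero, abs_of_nonneg (hu n)]
    linarith [hN n hn.le]
  intro ε hε
  obtain ⟨c, hc, hpos⟩ := hpos ε hε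
  set S : ℕ → ℝ := fun n => ∑ k ∈ Finset.range n, e k with hS
  -- Removing the noise leaves a sequence moved by the drift alone and eventually within ε of u. If
  -- v ≥ 2ε then u ≥ ε and v decreases; as Σ γ diverges, v must fall below 2ε. Later it can
  -- overshoot by less than ε in one step, so v ≤ 3ε and u ≤ 4ε.
  set v : ℕ → ℝ := fun n => u n - S n + E with hv
  have hvrec : ∀ᶠ n in atTop, v (n + 1) ≤ v n - γ n * a n := by
    filter_upwards [hrec] with n hn
    simp only [hv, hS, Finset.sum_range_succ]
    linarith
  have hSE : ∀ᶠ n in atTop, |S n - E| < ε := by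
    have := Metric.tendsto_atTop.1 he ε hε
    simpa [Real.dist_eq, eventually_atTop] using this
  have hγB : ∀ᶠ n in atTop, γ n * B < ε := by
    have : Tendsto (fun n => γ n * B) atTop (𝓝 (0 * B)) := hγ.mul_const B
    rw [zero_mul] at this
    exact this.eventually_lt_const hε
  obtain ⟨N, hN⟩ := eventually_atTop.1 (hpos.and (hB.and (hSE.and (hγB.and hvrec))))
  have hdec : ∀ n ≥ N, 2 * ε ≤ v n → v (n + 1) ≤ v n - c * γ n := by
    intro n hn h
    obtain ⟨h1, -, h3, -, h5⟩ := hN n hn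
    have h4 := h1 (by simp only [hv] at h; linarith [(abs_lt.1 h3).1])
    nlinarith [hγ0 n, mul_le_mul_of_nonneg_left h4 (hγ0 n)]
  have hex : ∃ n ≥ N, v n < 2 * ε := by
    by_contra hcon
    push Not at hcon
    have hle : ∀ k, v (N + k) + c * ∑ j ∈ Finset.range (N + k), γ j ≤
        v N + c * ∑ j ∈ Finset.range N, γ j := by
      intro k
      induction k with
      | zero => simp
      | succ k ih =>
        have := hdec (N + k) (by lia) (hcon (N + k) (by lia))
        rw [← add_assoc, Finset.sum_range_succ, mul_add]
        linarith
    obtain ⟨M, hM⟩ := eventually_atTop.1 ((hγs.const_mul_atTop hc).eventually_gt_atTop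
      (v N + c * ∑ j ∈ Finset.range N, γ j))
    have h1 := hM (N + M) (by lia)
    have h2 := hle M
    have h3 := hcon (N + M) (by lia)
    linarith
  obtain ⟨n0, hn0, hlt⟩ := hex
  refine eventually_atTop.2 ⟨n0, fun n hn => ?_⟩
  have hv3 : v n ≤ 3 * ε := by
    induction n, hn using Nat.le_induction with
    | base => linarith
    | succ n hn ih =>
      by_cases h : 2 * ε ≤ v n
      · have := hdec n (hn0.trans hn) h
        nlinarith [hγ0 n]
      · obtain ⟨-, h2, -, h4, h5⟩ := hN n (hn0.trans hn)
        nlinarith [mul_le_mul_of_nonneg_left h2 (hγ0 n)]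
  obtain ⟨-, -, h3, -⟩ := hN n (hn0.trans hn)
  simp only [hv] at hv3
  linarith [(abs_lt.1 h3).2]

/-- A sequence whose drift is nonpositive at high levels is bounded above. -/
lemma exists_le_of_drift {L q e : ℕ → ℝ} {E B B' : ℝ}
    (he : Tendsto (fun n => ∑ k ∈ Finset.range n, e k) atTop (𝓝 E))
    (hrec : ∀ n, L (n + 1) ≤ L n + q n + e n) (hqB : ∀ᶠ n in atTop, q n ≤ B)
    (hq : ∀ᶠ n in atTop, B' ≤ L n → q n ≤ 0) : ∃ M, ∀ n, L n ≤ M := by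
  obtain ⟨A, hA⟩ := he.bddAbove_range
  obtain ⟨A', hA'⟩ := he.bddBelow_range
  set S : ℕ → ℝ := fun n => ∑ k ∈ Finset.range n, e k with hS
  have hAn : ∀ n, S n ≤ A := fun n => hA ⟨n, rfl⟩
  have hAn' : ∀ n, A' ≤ S n := fun n => hA' ⟨n, rfl⟩
  obtain ⟨N, hN⟩ := eventually_atTop.1 (hq.and hqB)
  set v : ℕ → ℝ := fun n => L n - S n with hv
  have hvrec : ∀ n, v (n + 1) ≤ v n + q n := by
    intro n
    simp only [hv, hS, Finset.sum_range_succ]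
    linarith [hrec n]
  -- v can increase only from a time with L < B', where v < B' - A', and then by at most B.
  have hvn : ∀ n ≥ N, v n ≤ max (v N) (B' - A' + B) := by
    intro n hn
    induction n, hn using Nat.le_induction with
    | base => exact le_max_left _ _
    | succ n hn ih =>
      by_cases h : B' ≤ L n
      · linarith [hvrec n, (hN n hn).1 h]
      · refine le_trans ?_ (le_max_right _ _)
        have h1 := hvrec n
        have h2 := (hN n hn).2
        have h3 := hAn' n
        have h4 : v n = L n - S n := rfl
        push Not at h
        linarith
  have hbdd : IsBoundedUnder (· ≤ ·) atTop L :=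
    ⟨max (v N) (B' - A' + B) + A, eventually_map.2 (eventually_atTop.2 ⟨N, fun n hn => by
      have h1 := hvn n hn
      have h2 := hAn n
      have h4 : v n = L n - S n := rfl
      linarith⟩)⟩
  obtain ⟨M, hM⟩ := hbdd.bddAbove_range
  exact ⟨M, fun n => hM ⟨n, rfl⟩⟩

/-- A recursion driven by the sign of `F - α` converges, whatever the nonnegative weights. -/
lemma exists_tendsto_of_sign_drift {F : ℝ → ℝ} {α : ℝ} (hF : Continuous F) (hmono : Monotone F)
    {lo hi : ℝ} (hlo : F lo < α) (hhi : α < F hi) {x y w : ℕ → ℝ} (hw : ∀ n, 0 ≤ w n)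
    (hrec : ∀ n, y (n + 1) = y n - w n * (F (x n) - α))
    (hyx : Tendsto (fun n => y n - x n) atTop (𝓝 0))
    (hstep : Tendsto (fun n => y (n + 1) - y n) atTop (𝓝 0)) :
    ∃ l, Tendsto x atTop (𝓝 l) ∧ (F l ≠ α → Summable w) := by
  have hdown : ∀ n, α ≤ F (x n) → y (n + 1) ≤ y n := fun n h => by
    rw [hrec]; nlinarith [mul_nonneg (hw n) (sub_nonneg.2 h)]
  have hup : ∀ n, F (x n) ≤ α → y n ≤ y (n + 1) := fun n h => by
    rw [hrec]; nlinarith [mul_nonneg (hw n) (sub_nonneg.2 h)]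
  -- When y crosses the level c, both the step of y and y - x are small, so x is near c and the sign
  -- of the drift there decides which crossings are possible.
  have hnear : ∀ c η : ℝ, 0 < η → ∀ᶠ n in atTop,
      (y n ≤ c ∧ c < y (n + 1)) ∨ (c ≤ y n ∧ y (n + 1) < c) → |x n - c| < η := by
    intro c η hη
    have h1 := Metric.tendsto_atTop.1 hyx (η / 2) (by positivity)
    have h2 := Metric.tendsto_atTop.1 hstep (η / 2) (by positivity)
    simp only [Real.dist_eq, sub_zero] at h1 h2
    filter_upwards [eventually_atTop.2 h1, eventually_atTop.2 h2] with n h1 h2 h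
    rw [abs_lt] at *
    rcases h with h | h <;> constructor <;> linarith
  have hnb : ∀ (c : ℝ) (p : ℝ → Prop), (∀ᶠ z in 𝓝 c, p z) → ∀ᶠ n in atTop,
      (y n ≤ c ∧ c < y (n + 1)) ∨ (c ≤ y n ∧ y (n + 1) < c) → p (x n) := by
    intro c p hp
    obtain ⟨η, hη, hp⟩ := Metric.eventually_nhds_iff.1 hp
    filter_upwards [hnear c η hη] with n hn h
    exact hp (by rw [Real.dist_eq]; exact hn h)
  have hle : ∀ c, (∀ᶠ z in 𝓝 c, α ≤ F z) → ∀ᶠ n in atTop, y n ≤ c → y (n + 1) ≤ c := by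
    intro c hc
    filter_upwards [hnb c _ hc] with n hn h
    by_contra hcon
    push Not at hcon
    linarith [hdown n (hn (Or.inl ⟨h, hcon⟩))]
  have hge : ∀ c, (∀ᶠ z in 𝓝 c, F z ≤ α) → ∀ᶠ n in atTop, c ≤ y n → c ≤ y (n + 1) := by
    intro c hc
    filter_upwards [hnb c _ hc] with n hn h
    by_contra hcon
    push Not at hcon
    linarith [hup n (hn (Or.inr ⟨h, hcon⟩))]
  have hstayle : ∀ c, (∀ᶠ z in 𝓝 c, α ≤ F z) → (∃ᶠ n in atTop, y n ≤ c) →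
      ∀ᶠ n in atTop, y n ≤ c := by
    intro c hc hf
    obtain ⟨N, hN⟩ := eventually_atTop.1 (hle c hc)
    obtain ⟨m, hm, hym⟩ := frequently_atTop.1 hf N
    refine eventually_atTop.2 ⟨m, fun n hn => ?_⟩
    induction n, hn using Nat.le_induction with
    | base => exact hym
    | succ n hn ih => exact hN n (hm.trans hn) ih
  have hstayge : ∀ c, (∀ᶠ z in 𝓝 c, F z ≤ α) → (∃ᶠ n in atTop, c ≤ y n) →
      ∀ᶠ n in atTop, c ≤ y n := by
    intro c hc hf
    obtain ⟨N, hN⟩ := eventually_atTop.1 (hge c hc)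
    obtain ⟨m, hm, hym⟩ := frequently_atTop.1 hf N
    refine eventually_atTop.2 ⟨m, fun n hn => ?_⟩
    induction n, hn using Nat.le_induction with
    | base => exact hym
    | succ n hn ih => exact hN n (hm.trans hn) ih
  have hyx1 : ∀ᶠ n in atTop, |y n - x n| < 1 := by
    have h1 := Metric.tendsto_atTop.1 hyx 1 one_pos
    simp only [Real.dist_eq, sub_zero] at h1
    exact eventually_atTop.2 h1
  -- Either y visits (-∞, hi + 1] infinitely often and is eventually trapped there, or it stays
  -- above, where x > hi makes it nonincreasing. The margin 1 absorbs y - x.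
  have hbdd1 : IsBoundedUnder (· ≤ ·) atTop y := by
    by_cases hf1 : ∃ᶠ n in atTop, y n ≤ hi + 1
    · exact ⟨hi + 1, eventually_map.2 (hstayle (hi + 1) ((hF.tendsto _).eventually_const_le
        (hhi.trans_le (hmono (by linarith)))) hf1)⟩
    · rw [not_frequently] at hf1
      obtain ⟨N, hN⟩ := eventually_atTop.1 (hf1.and hyx1)
      refine ⟨y N, eventually_map.2 (eventually_atTop.2 ⟨N, fun n hn => ?_⟩)⟩
      induction n, hn using Nat.le_induction with
      | base => exact le_rfl
      | succ n hn ih =>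
        refine (hdown n (hhi.le.trans (hmono ?_))).trans ih
        obtain ⟨h1, h2⟩ := hN n hn
        push Not at h1
        linarith [(abs_lt.1 h2).2]
  have hbdd2 : IsBoundedUnder (· ≥ ·) atTop y := by
    by_cases hf1 : ∃ᶠ n in atTop, lo - 1 ≤ y n
    · exact ⟨lo - 1, eventually_map.2 (hstayge (lo - 1) ((hF.tendsto _).eventually_le_const
        ((hmono (by linarith)).trans_lt hlo)) hf1)⟩
    · rw [not_frequently] at hf1
      obtain ⟨N, hN⟩ := eventually_atTop.1 (hf1.and hyx1)
      refine ⟨y N, eventually_map.2 (eventually_atTop.2 ⟨N, fun n hn => ?_⟩)⟩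
      change y N ≤ y n
      induction n, hn using Nat.le_induction with
      | base => exact le_rfl
      | succ n hn ih =>
        refine ih.trans (hup n ((hmono ?_).trans hlo.le))
        obtain ⟨h1, h2⟩ := hN n hn
        push Not at h1
        linarith [(abs_lt.1 h2).1]
  -- Off the frontier of {F = α}, F - α keeps a weak sign near the level, so y can eventually cross
  -- that level in one direction only. The frontier of a closed set has empty interior, so these
  -- levels are dense enough to exclude oscillation.
  have hdense : Dense (frontier {c | F c = α})ᶜ :=
    interior_eq_empty_iff_dense_compl.1 
    (interior_frontier (isClosed_eq hF continuous_const))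
  obtain ⟨l, hl⟩ := tendsto_of_no_upcrossings hdense (u := y) (f := atTop) (by
    rintro c hc b - hcb ⟨h1, h2⟩
    have hcase : (∀ᶠ z in 𝓝 c, α ≤ F z) ∨ (∀ᶠ z in 𝓝 c, F z ≤ α) := by
      by_cases hFc : F c = α
      · have hint : c ∈ interior {c | F c = α} := by
          by_contra hni
          exact hc ⟨subset_closure hFc, hni⟩
        left
        filter_upwards [mem_interior_iff_mem_nhds.1 hint] with z hz
        exact (show F z = α from hz).ge
      · rcases lt_or_gt_of_ne hFc with h | h
        · exact Or.inr ((hF.tendsto c).eventually_le_const h)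
        · exact Or.inl ((hF.tendsto c).eventually_const_le h)
    rcases hcase with h | h
    · obtain ⟨n, hn1, hn2⟩ := (h2.and_eventually (hstayle c h (h1.mono fun n hn => hn.le))).exists
      linarith
    · obtain ⟨n, hn1, hn2⟩ := (h1.and_eventually
        (hstayge c h (h2.mono fun n hn => (hcb.trans hn).le))).exists
      linarith) hbdd1 hbdd2
  have hxl : Tendsto x atTop (𝓝 l) := by
    have := hl.sub hyx
    simpa using this
  refine ⟨l, hxl, fun hne => ?_⟩
  have hFx : Tendsto (fun n => F (x n) - α) atTop (𝓝 (F l - α)) :=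
    ((hF.tendsto l).comp hxl).sub_const α
  -- The factor σ treats both signs of F l - α at once: σ(F(x n) - α) is eventually above η > 0, and
  -- telescoping bounds η Σ w by the range of σ y.
  obtain ⟨σ, hσ⟩ : ∃ σ : ℝ, 0 < σ * (F l - α) := ⟨F l - α, mul_self_pos.2 (sub_ne_zero.2 hne)⟩
  set η := σ * (F l - α) / 2 with hη
  have hη0 : 0 < η := by positivity
  obtain ⟨N, hN⟩ := eventually_atTop.1 ((hFx.const_mul σ).eventually_const_lt
    (show η < σ * (F l - α) by rw [hη]; linarith))
  obtain ⟨A, hA⟩ := (hl.const_mul σ).bddBelow_range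
  rw [← summable_nat_add_iff N]
  refine summable_of_sum_range_le (c := (σ * y N - A) / η) (fun n => hw _) fun n => ?_
  rw [le_div_iff₀ hη0]
  have hsum : ∀ n, (∑ k ∈ Finset.range n, w (k + N)) * η ≤ σ * y N - σ * y (n + N) := by
    intro n
    induction n with
    | zero => simp
    | succ n ih =>
      rw [Finset.sum_range_succ, add_mul, show n + 1 + N = n + N + 1 by ring, hrec (n + N)]
      nlinarith [mul_le_mul_of_nonneg_left (hN (n + N) (by lia)).le (hw (n + N))]
  have := hA ⟨n + N, rfl⟩
  simp only at this
  linarith [hsum n]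

end EsscherVaR

namespace EsscherVaR

open ProbabilityTheory

/-! ### Sums of conditionally centred square-integrable variables -/

section CondLaw

variable {Ω : Type*} {m : MeasurableSpace Ω} [mΩ : MeasurableSpace Ω] {P : Measure Ω}
  [IsProbabilityMeasure P] {d : ℕ}
  {E : Type*} [MeasurableSpace E] {κ : Kernel E (Vec d)} [IsMarkovKernel κ]
  {z : Ω → E} {Y : Ω → Vec d}

/-- Since z is known at time m, {z ∈ A} ∩ S is an event of m, so the conditional law determines the
joint law on rectangles and hence everywhere. Keeping S arbitrary is what later identifies
conditional expectations. -/
lemma map_restrict_prodMk_eq_compProd (hm : m ≤ mΩ) (hz : Measurable[m] z) (hY : Measurable Y)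
    (hlaw : HasCondLaw P m Y fun ω => κ (z ω)) {S : Set Ω} (hS : MeasurableSet[m] S) :
    (P.restrict S).map (fun ω => (z ω, Y ω)) = ((P.restrict S).map z).compProd κ := by
  have hz' : Measurable z := hz.mono hm le_rfl
  have : IsFiniteMeasure ((P.restrict S).map fun ω => (z ω, Y ω)) :=
    Measure.isFiniteMeasure_map _ _
  refine Measure.ext_prod fun {A B} hA hB => ?_
  rw [Measure.map_apply (hz'.prodMk hY) (hA.prod hB), Measure.compProd_apply_prod hA hB,
    setLIntegral_map hA (κ.measurable_coe hB) hz',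
    Measure.restrict_apply ((hz'.prodMk hY) (hA.prod hB)), Measure.restrict_restrict (hz' hA)]
  have h := hlaw (z ⁻¹' A ∩ S) ((hz hA).inter hS) B hB
  rw [← h]
  congr 1
  ext ω
  simp only [Set.mem_inter_iff, Set.mem_preimage, Set.mem_prod]
  tauto

lemma setLIntegral_prodMk_eq (hm : m ≤ mΩ) (hz : Measurable[m] z) (hY : Measurable Y)
    (hlaw : HasCondLaw P m Y fun ω => κ (z ω)) {g : E × Vec d → ENNReal} (hg : Measurable g) :
    ∫⁻ ω, g (z ω, Y ω) ∂P = ∫⁻ ω, ∫⁻ x, g (z ω, x) ∂(κ (z ω)) ∂P := by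
  have hz' : Measurable z := hz.mono hm le_rfl
  have h := map_restrict_prodMk_eq_compProd hm hz hY hlaw MeasurableSet.univ
  rw [Measure.restrict_univ] at h
  rw [← lintegral_map hg (hz'.prodMk hY), h, Measure.lintegral_compProd hg,
    lintegral_map hg.lintegral_kernel_prod_right' hz']

lemma setIntegral_prodMk_eq (hm : m ≤ mΩ) (hz : Measurable[m] z) (hY : Measurable Y)
    (hlaw : HasCondLaw P m Y fun ω => κ (z ω)) {f : E × Vec d → ℝ} (hf : Measurable f)
    (hint : Integrable (fun ω => f (z ω, Y ω)) P) {S : Set Ω} (hS : MeasurableSet[m] S) :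
    ∫ ω in S, f (z ω, Y ω) ∂P = ∫ ω in S, ∫ x, f (z ω, x) ∂(κ (z ω)) ∂P := by
  have hz' : Measurable z := hz.mono hm le_rfl
  have h := map_restrict_prodMk_eq_compProd hm hz hY hlaw hS
  have hi : Integrable f (((P.restrict S).map z).compProd κ) := by
    rw [← h, integrable_map_measure hf.aestronglyMeasurable (hz'.prodMk hY).aemeasurable]
    exact hint.integrableOn
  rw [← integral_map (f := f) (hz'.prodMk hY).aemeasurable hf.aestronglyMeasurable, h,
    Measure.integral_compProd hi, integral_map hz'.aemeasurable
      hf.stronglyMeasurable.integral_kernel_prod_right'.aestronglyMeasurable]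

lemma sq_integral_le_integral_sq {X : Type*} [MeasurableSpace X] {ρ : Measure X}
    [IsProbabilityMeasure ρ] {g : X → ℝ} (hg : AEStronglyMeasurable g ρ)
    (h : Integrable (fun x => g x ^ 2) ρ) : (∫ x, g x ∂ρ) ^ 2 ≤ ∫ x, g x ^ 2 ∂ρ := by
  have h2 : MemLp g 2 ρ := (memLp_two_iff_integrable_sq hg).2 h
  have := variance_nonneg g ρ
  rw [variance_eq_sub h2] at this
  simpa using this

variable {f : E × Vec d → ℝ} {c : ℝ}

/-- The bound c is uniform in the parameter, so no moment of z is required; this allows an arbitrary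
initial value. -/
lemma lintegral_sq_prodMk_le (hm : m ≤ mΩ) (hz : Measurable[m] z) (hY : Measurable Y)
    (hlaw : HasCondLaw P m Y fun ω => κ (z ω)) (hf : Measurable f)
    (hsq : ∀ e, Integrable (fun x => f (e, x) ^ 2) (κ e))
    (hc : ∀ e, ∫ x, f (e, x) ^ 2 ∂(κ e) ≤ c) :
    ∫⁻ ω, ENNReal.ofReal (f (z ω, Y ω) ^ 2) ∂P ≤ ENNReal.ofReal c := by
  rw [setLIntegral_prodMk_eq hm hz hY hlaw (g := fun q => ENNReal.ofReal (f q ^ 2))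
    (by fun_prop)]
  calc _ ≤ ∫⁻ ω, ENNReal.ofReal c ∂P := by
        refine lintegral_mono fun ω => ?_
        rw [← ofReal_integral_eq_lintegral_ofReal (hsq _) (ae_of_all _ fun x => sq_nonneg _)]
        exact ENNReal.ofReal_le_ofReal (hc _)
    _ = _ := by simp

lemma integrable_sq_prodMk (hm : m ≤ mΩ) (hz : Measurable[m] z) (hY : Measurable Y)
    (hlaw : HasCondLaw P m Y fun ω => κ (z ω)) (hf : Measurable f)
    (hsq : ∀ e, Integrable (fun x => f (e, x) ^ 2) (κ e))
    (hc : ∀ e, ∫ x, f (e, x) ^ 2 ∂(κ e) ≤ c) :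
    Integrable (fun ω => f (z ω, Y ω) ^ 2) P := by
  have hz' : Measurable z := hz.mono hm le_rfl
  have hmeas : Measurable fun ω => f (z ω, Y ω) ^ 2 := (hf.comp (hz'.prodMk hY)).pow_const 2
  refine (lintegral_ofReal_ne_top_iff_integrable hmeas.aestronglyMeasurable
    (ae_of_all _ fun ω => sq_nonneg _)).1 ?_
  exact ((lintegral_sq_prodMk_le hm hz hY hlaw hf hsq hc).trans_lt ENNReal.ofReal_lt_top).ne

lemma integral_sq_prodMk_le (hm : m ≤ mΩ) (hz : Measurable[m] z) (hY : Measurable Y)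
    (hlaw : HasCondLaw P m Y fun ω => κ (z ω)) (hf : Measurable f)
    (hsq : ∀ e, Integrable (fun x => f (e, x) ^ 2) (κ e)) (hc0 : 0 ≤ c)
    (hc : ∀ e, ∫ x, f (e, x) ^ 2 ∂(κ e) ≤ c) :
    ∫ ω, f (z ω, Y ω) ^ 2 ∂P ≤ c := by
  have h := lintegral_sq_prodMk_le hm hz hY hlaw hf hsq hc
  rw [← ofReal_integral_eq_lintegral_ofReal (integrable_sq_prodMk hm hz hY hlaw hf hsq hc)
    (ae_of_all _ fun ω => sq_nonneg _)] at h
  exact (ENNReal.ofReal_le_ofReal_iff hc0).1 h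

end CondLaw

/-! ### Almost sure convergence of the noise series -/

section Martingale

variable {Ω : Type*} [mΩ : MeasurableSpace Ω] {P : Measure Ω} [IsProbabilityMeasure P]
  {ℱ : Filtration ℕ mΩ}

/-- An `L²`-bounded sum of martingale increments converges almost surely. -/
lemma ae_tendsto_sum_of_condExp_eq_zero {D : ℕ → Ω → ℝ} {c : ℕ → ℝ} (hc : Summable c)
    (hD : ∀ n, StronglyMeasurable[ℱ (n + 1)] (D n)) (hL2 : ∀ n, MemLp (D n) 2 P)
    (hDc : ∀ n, ∫ ω, D n ω ^ 2 ∂P ≤ c n) (h0 : ∀ n, P[D n|ℱ n] =ᵐ[P] 0) :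
    ∀ᵐ ω ∂P, ∃ l, Tendsto (fun n => ∑ k ∈ Finset.range n, D k ω) atTop (𝓝 l) := by
  set M : ℕ → Ω → ℝ := fun n ω => ∑ k ∈ Finset.range n, D k ω with hM
  have hMsucc : ∀ n, M (n + 1) = M n + D n := fun n => by
    funext ω; simp [hM, Finset.sum_range_succ]
  have hMmeas : ∀ n, StronglyMeasurable[ℱ n] (M n) := by
    intro n
    refine Finset.stronglyMeasurable_fun_sum _ fun k hk => ?_
    exact (hD k).mono (ℱ.mono (Finset.mem_range.1 hk))
  have hML2 : ∀ n, MemLp (M n) 2 P := fun n => memLp_finsetSum _ fun k _ => hL2 k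
  have hmart : Martingale M ℱ P := by
    refine martingale_of_condExp_sub_eq_zero_nat hMmeas
      (fun n => (hML2 n).integrable (by norm_num)) fun n => ?_
    rw [hMsucc, add_sub_cancel_left]
    exact h0 n
  have hc0 : ∀ n, 0 ≤ c n := fun n => (integral_nonneg fun ω => sq_nonneg _).trans (hDc n)
  -- Martingale increments are orthogonal: the cross term vanishes after conditioning on ℱ n.
  have hbound : ∀ n, ∫ ω, M n ω ^ 2 ∂P ≤ ∑ k ∈ Finset.range n, c k := by
    intro n
    induction n with
    | zero => simp [hM]
    | succ n ih =>
      have hmul : Integrable (M n * D n) P := (hML2 n).integrable_mul (hL2 n)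
      have hzero : ∫ ω, (M n * D n) ω ∂P = 0 := by
        rw [← integral_condExp (ℱ.le n), integral_eq_zero_of_ae]
        filter_upwards [condExp_mul_of_stronglyMeasurable_left (hMmeas n) hmul
          ((hL2 n).integrable (by norm_num)), h0 n] with ω h1 h2
        rw [h1, Pi.mul_apply, h2]
        simp
      have hexp : ∀ ω, M (n + 1) ω ^ 2 = M n ω ^ 2 + 2 * (M n * D n) ω + D n ω ^ 2 := by
        intro ω
        rw [hMsucc]; simp only [Pi.add_apply, Pi.mul_apply]; ring
      have hi1 : Integrable (fun ω => M n ω ^ 2 + 2 * (M n * D n) ω) P :=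
        (hML2 n).integrable_sq.add (hmul.const_mul 2)
      simp_rw [hexp]
      rw [integral_add hi1 (hL2 n).integrable_sq,
        integral_add (hML2 n).integrable_sq (hmul.const_mul 2), integral_const_mul, hzero,
        Finset.sum_range_succ]
      linarith [hDc n]
  refine hmart.submartingale.exists_ae_tendsto_of_bdd (R := (1 + ∑' k, c k).toNNReal) fun n => ?_
  rw [eLpNorm_one_eq_lintegral_enorm,
    ← ofReal_integral_norm_eq_lintegral_enorm ((hML2 n).integrable (by norm_num))]
  refine ENNReal.ofReal_le_ofReal ?_
  calc ∫ ω, ‖M n ω‖ ∂P ≤ ∫ ω, 1 + M n ω ^ 2 ∂P := by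
        refine integral_mono ((hML2 n).integrable (by norm_num)).norm
          ((integrable_const _).add (hML2 n).integrable_sq) fun ω => ?_
        simp only [Real.norm_eq_abs]
        nlinarith [sq_abs (M n ω), sq_nonneg (|M n ω| - 1), abs_nonneg (M n ω)]
    _ = 1 + ∫ ω, M n ω ^ 2 ∂P := by
        rw [integral_add (integrable_const _) (hML2 n).integrable_sq]; simp
    _ ≤ 1 + ∑' k, c k := by
        gcongr
        exact (hbound n).trans (hc.sum_le_tsum _ fun k _ => hc0 k)

variable {d : ℕ} {E : Type*} [MeasurableSpace E] {κ : Kernel E (Vec d)} [IsMarkovKernel κ]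
  {z : ℕ → Ω → E} {Y : ℕ → Ω → Vec d} {f : ℕ → E × Vec d → ℝ} {c : ℕ → ℝ}

/-- Almost sure convergence of sums of functionals of conditional samples, centred at their
conditional means. -/
lemma ae_tendsto_sum_centred (hz : ∀ n, Measurable[ℱ n] (z n))
    (hY : ∀ n, Measurable[ℱ (n + 1)] (Y (n + 1)))
    (hlaw : ∀ n, HasCondLaw P (ℱ n) (Y (n + 1)) fun ω => κ (z n ω))
    (hf : ∀ n, Measurable (f n)) (hsq : ∀ n e, Integrable (fun x => f n (e, x) ^ 2) (κ e))
    (hc : ∀ n e, ∫ x, f n (e, x) ^ 2 ∂(κ e) ≤ c n) (hcs : Summable c) :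
    ∀ᵐ ω ∂P, ∃ l, Tendsto (fun n => ∑ k ∈ Finset.range n,
      (f k (z k ω, Y (k + 1) ω) - ∫ x, f k (z k ω, x) ∂(κ (z k ω)))) atTop (𝓝 l) := by
  have hY' : ∀ n, Measurable (Y (n + 1)) := fun n => (hY n).mono (ℱ.le _) le_rfl
  have hz' : ∀ n, Measurable (z n) := fun n => (hz n).mono (ℱ.le _) le_rfl
  have hsqY := fun n => integrable_sq_prodMk (ℱ.le n) (hz n) (hY' n) (hlaw n) (hf n) (hsq n) (hc n)
  have hmean : ∀ n, Measurable fun e => ∫ x, f n (e, x) ∂(κ e) := fun n =>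
    (hf n).stronglyMeasurable.integral_kernel_prod_right'.measurable
  have hmeanle : ∀ n e, (∫ x, f n (e, x) ∂(κ e)) ^ 2 ≤ c n := fun n e =>
    (sq_integral_le_integral_sq ((hf n).comp measurable_prodMk_left).aestronglyMeasurable
      (hsq n e)).trans (hc n e)
  -- A point of E is needed only to deduce 0 ≤ c n from the second-moment bound; if E is empty, so
  -- is Ω.
  by_cases hE : Nonempty E
  swap
  · have hΩ : IsEmpty Ω := ⟨fun ω => hE ⟨z 0 ω⟩⟩
    exact ae_of_all _ fun ω => (hΩ.false ω).elim
  have hc0 : ∀ n, 0 ≤ c n := fun n => (sq_nonneg _).trans (hmeanle n hE.some)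
  have hL2Y : ∀ n, MemLp (fun ω => f n (z n ω, Y (n + 1) ω)) 2 P := fun n =>
    (memLp_two_iff_integrable_sq
      ((hf n).comp ((hz' n).prodMk (hY' n))).aestronglyMeasurable).2 (hsqY n)
  have hL2m : ∀ n, MemLp (fun ω => ∫ x, f n (z n ω, x) ∂(κ (z n ω))) 2 P := fun n =>
    MemLp.of_bound ((hmean n).comp (hz' n)).aestronglyMeasurable (√(c n))
      (ae_of_all _ fun ω => Real.abs_le_sqrt (hmeanle n _))
  -- The factor 4 comes from (a - b)² ≤ 2a² + 2b², the sample and its conditional mean both having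
  -- second moment at most c n.
  refine ae_tendsto_sum_of_condExp_eq_zero (ℱ := ℱ) (c := fun n => 4 * c n) (hcs.mul_left 4)
    (fun n => ?_) (fun n => (hL2Y n).sub (hL2m n)) (fun n => ?_) (fun n => ?_)
  · refine Measurable.stronglyMeasurable (Measurable.sub ?_ ?_)
    · exact (hf n).comp (((hz n).mono (ℱ.mono n.le_succ) le_rfl).prodMk (hY n))
    · exact (hmean n).comp ((hz n).mono (ℱ.mono n.le_succ) le_rfl)
  · have h1 := integral_sq_prodMk_le (ℱ.le n) (hz n) (hY' n) (hlaw n) (hf n) (hsq n) (hc0 n) (hc n)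
    calc _ ≤ ∫ ω, 2 * f n (z n ω, Y (n + 1) ω) ^ 2 + 2 * c n ∂P := by
          refine integral_mono ((hL2Y n).sub (hL2m n)).integrable_sq
            (((hsqY n).const_mul 2).add (integrable_const _)) fun ω => ?_
          have h2 := hmeanle n (z n ω)
          have h3 := sq_nonneg (f n (z n ω, Y (n + 1) ω) + ∫ x, f n (z n ω, x) ∂(κ (z n ω)))
          simp only
          nlinarith
      _ = 2 * ∫ ω, f n (z n ω, Y (n + 1) ω) ^ 2 ∂P + 2 * c n := by
          rw [integral_add ((hsqY n).const_mul 2) (integrable_const _), integral_const_mul]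
          simp
      _ ≤ _ := by linarith
  · have hi1 := (hL2Y n).integrable (by norm_num)
    have hi2 := (hL2m n).integrable (by norm_num)
    refine (ae_eq_condExp_of_forall_setIntegral_eq (ℱ.le n) (hi1.sub hi2)
      (fun s _ _ => (integrable_zero _ _ _).integrableOn) (fun s hs _ => ?_)
      stronglyMeasurable_zero.aestronglyMeasurable).symm
    have := setIntegral_prodMk_eq (ℱ.le n) (hz n) (hY' n) (hlaw n) (hf n) hi1 hs
    rw [integral_sub' hi1.integrableOn hi2.integrableOn, this, sub_self]
    simp

/-- By Tonelli the sum has finite expectation, hence is finite almost surely. -/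
lemma ae_summable_sq (hz : ∀ n, Measurable[ℱ n] (z n))
    (hY : ∀ n, Measurable[ℱ (n + 1)] (Y (n + 1)))
    (hlaw : ∀ n, HasCondLaw P (ℱ n) (Y (n + 1)) fun ω => κ (z n ω))
    (hf : ∀ n, Measurable (f n)) (hsq : ∀ n e, Integrable (fun x => f n (e, x) ^ 2) (κ e))
    (hc : ∀ n e, ∫ x, f n (e, x) ^ 2 ∂(κ e) ≤ c n) (hcs : Summable c) :
    ∀ᵐ ω ∂P, Summable fun n => f n (z n ω, Y (n + 1) ω) ^ 2 := by
  have hY' : ∀ n, Measurable (Y (n + 1)) := fun n => (hY n).mono (ℱ.le _) le_rfl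
  have hz' : ∀ n, Measurable (z n) := fun n => (hz n).mono (ℱ.le _) le_rfl
  have hmeas : ∀ n, Measurable fun ω => ENNReal.ofReal (f n (z n ω, Y (n + 1) ω) ^ 2) := fun n =>
    (((hf n).comp ((hz' n).prodMk (hY' n))).pow_const 2).ennreal_ofReal
  have hle : ∫⁻ ω, ∑' n, ENNReal.ofReal (f n (z n ω, Y (n + 1) ω) ^ 2) ∂P ≠ ⊤ := by
    rw [lintegral_tsum fun n => (hmeas n).aemeasurable]
    refine ne_top_of_le_ne_top hcs.tsum_ofReal_ne_top (ENNReal.tsum_le_tsum fun n => ?_)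
    exact lintegral_sq_prodMk_le (ℱ.le n) (hz n) (hY' n) (hlaw n) (hf n) (hsq n) (hc n)
  filter_upwards [ae_lt_top (Measurable.tsum hmeas) hle] with ω hω
  have := ENNReal.summable_toReal hω.ne
  refine this.congr fun n => ?_
  rw [ENNReal.toReal_ofReal (sq_nonneg _)]

end Martingale
end EsscherVaR

namespace EsscherVaR

open ProbabilityTheory

/-! ### Weighted objectives of the Esscher parameter -/

section Kernel

variable {d : ℕ} {ν : Measure (Vec d)}

lemma measurable_esscher [IsProbabilityMeasure ν] (hψ : ExpMoments ν) :
    Measurable (esscher ν) := by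
  refine Measure.measurable_of_measurable_coe _ fun A hA => ?_
  have h : ∀ t, esscher ν t A =
      ∫⁻ x in A, ENNReal.ofReal (Real.exp (inner ℝ t x) / Real.exp (cumulant ν t)) ∂ν := by
    intro t
    rw [esscher, tilted_apply' _ _ hA, exp_cumulant hψ]
  simp_rw [h]
  have hc := (continuous_cumulant hψ).measurable
  exact Measurable.lintegral_prod_right'
    (f := fun q : Vec d × Vec d =>
      ENNReal.ofReal (Real.exp (inner ℝ q.1 q.2) / Real.exp (cumulant ν q.1)))
    (by fun_prop)

/-- The Esscher transforms with parameter `u e` as a Markov kernel. -/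
noncomputable def esscherKernel [IsProbabilityMeasure ν] (hψ : ExpMoments ν) {E : Type*}
    [MeasurableSpace E] (u : E → Vec d) (hu : Measurable u) : Kernel E (Vec d) where
  toFun e := esscher ν (u e)
  measurable' := (measurable_esscher hψ).comp hu

lemma isMarkovKernel_esscherKernel [IsProbabilityMeasure ν] (hψ : ExpMoments ν) {E : Type*}
    [MeasurableSpace E] (u : E → Vec d) (hu : Measurable u) :
    IsMarkovKernel (esscherKernel hψ u hu) :=
  ⟨fun e => isProbabilityMeasure_tilted (hψ (u e))⟩

end Kernel

/-- A nonnegative weight `G` of at most exponential growth, almost everywhere continuous in its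
scalar parameter, with a damping prefactor `p` making the increments square integrable. -/
structure IsDampedWeight {d : ℕ} (ν : Measure (Vec d)) (G p : ℝ → Vec d → ℝ) : Prop where
  meas : Measurable fun q : ℝ × Vec d => G q.1 q.2
  nonneg : ∀ ξ x, 0 ≤ G ξ x
  growth : ∃ B a, 0 ≤ B ∧ 0 ≤ a ∧ ∀ ξ x, G ξ x ≤ B * (1 + ξ ^ 2) * Real.exp (a * ‖x‖)
  cont : ∀ ξ, ∀ᵐ x ∂ν, ContinuousAt (fun η => G η x) ξ
  meas_p : Measurable fun q : ℝ × Vec d => p q.1 q.2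
  p_nonneg : ∀ ξ t, 0 ≤ p ξ t
  p_le_one : ∀ ξ t, p ξ t ≤ 1
  p_lower : ∀ R, ∃ c > 0, ∀ ξ t, |ξ| ≤ R → ‖t‖ ≤ R → c ≤ p ξ t
  mass : ∃ B, ∀ ξ t, p ξ t * ∫ x, G ξ x ∂ν ≤ B
  second : ∃ B, 0 ≤ B ∧ ∀ ξ t, ∫ x, (p ξ t * G ξ x) ^ 2 * ‖x - gradient (cumulant ν) t‖ ^ 2
    ∂(esscher ν (-t)) ≤ B * (1 + ‖t‖ ^ 2)

/-- The weighted objective `𝔼[G(ξ, X) exp(-⟨t, X⟩ + ψ(t))]`. -/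
noncomputable def weightedObj {d : ℕ} (ν : Measure (Vec d)) (G : ℝ → Vec d → ℝ) (t : Vec d)
    (ξ : ℝ) : ℝ :=
  ∫ x, G ξ x * Real.exp (-inner ℝ t x + cumulant ν t) ∂ν

/-- The increment of the stochastic gradient algorithm for the weighted objective. -/
noncomputable def weightedIncr {d : ℕ} (ν : Measure (Vec d)) (G p : ℝ → Vec d → ℝ) (ξ : ℝ)
    (t x : Vec d) : Vec d :=
  (p ξ t * G ξ x) • (gradient (cumulant ν) t - x)

namespace IsDampedWeight

variable {d : ℕ} {ν : Measure (Vec d)} {G p : ℝ → Vec d → ℝ}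

lemma measurable_weight (h : IsDampedWeight ν G p) (ξ : ℝ) : Measurable (G ξ) :=
  h.meas.comp measurable_prodMk_left

lemma integrable_weight_mul_exp (h : IsDampedWeight ν G p) (hψ : ExpMoments ν) (ξ : ℝ)
    (t : Vec d) (c : ℝ) : Integrable (fun x => G ξ x * Real.exp (-inner ℝ t x + c)) ν := by
  obtain ⟨B, a, hB, ha, hG⟩ := h.growth
  have hm := h.measurable_weight ξ
  refine hψ.integrable_of_le (B := B * (1 + ξ ^ 2) * Real.exp c) (a := a + ‖t‖)
    (Measurable.aestronglyMeasurable (by fun_prop)) fun x => ?_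
  rw [norm_mul, Real.norm_of_nonneg (h.nonneg ξ x), Real.norm_of_nonneg (Real.exp_pos _).le,
    Real.exp_add, add_mul, Real.exp_add, ← inner_neg_left]
  have h1 := exp_inner_le (norm_neg t).le x
  calc _ ≤ (B * (1 + ξ ^ 2) * Real.exp (a * ‖x‖)) * (Real.exp (‖t‖ * ‖x‖) * Real.exp c) := by
        gcongr
        · exact hG ξ x
    _ = _ := by ring

lemma weightedObj_zero [IsProbabilityMeasure ν] (ξ : ℝ) :
    weightedObj ν G 0 ξ = ∫ x, G ξ x ∂ν := by
  simp [weightedObj, cumulant_zero]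

lemma weightedObj_nonneg (h : IsDampedWeight ν G p) (t : Vec d) (ξ : ℝ) :
    0 ≤ weightedObj ν G t ξ :=
  integral_nonneg fun x => mul_nonneg (h.nonneg ξ x) (Real.exp_pos _).le

/-- Dominated convergence: the weight jumps in ξ only on a null set, and near (t, ξ) the integrand
is below a multiple of exp((a + ‖t‖ + 1)‖x‖). -/
lemma continuous_weightedObj [IsProbabilityMeasure ν] (h : IsDampedWeight ν G p)
    (hψ : ExpMoments ν) : Continuous fun q : Vec d × ℝ => weightedObj ν G q.1 q.2 := by
  obtain ⟨B, a, hB, ha, hG⟩ := h.growth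
  have hc := continuous_cumulant hψ
  rw [continuous_iff_continuousAt]
  rintro ⟨t, ξ⟩
  have e1 : ∀ᶠ q : Vec d × ℝ in 𝓝 (t, ξ), ‖q.1‖ < ‖t‖ + 1 :=
    (continuous_norm.comp continuous_fst).continuousAt.eventually_lt_const
      (show ‖t‖ < ‖t‖ + 1 by linarith)
  have e2 : ∀ᶠ q : Vec d × ℝ in 𝓝 (t, ξ), q.2 ^ 2 < ξ ^ 2 + 1 :=
    (continuous_snd.pow 2).continuousAt.eventually_lt_const
      (show ξ ^ 2 < ξ ^ 2 + 1 by linarith)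
  have e3 : ∀ᶠ q : Vec d × ℝ in 𝓝 (t, ξ), cumulant ν q.1 < cumulant ν t + 1 :=
    (hc.comp continuous_fst).continuousAt.eventually_lt_const
      (show cumulant ν t < cumulant ν t + 1 by linarith)
  refine continuousAt_of_dominated (F := fun (q : Vec d × ℝ) x =>
    G q.2 x * Real.exp (-inner ℝ q.1 x + cumulant ν q.1)) (bound := fun x =>
    (B * (1 + (ξ ^ 2 + 1)) * Real.exp (cumulant ν t + 1)) * Real.exp ((a + (‖t‖ + 1)) * ‖x‖))
    ?_ ?_ ((hψ.integrable_exp_mul_norm _).const_mul _) ?_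
  · exact Eventually.of_forall fun q => (h.integrable_weight_mul_exp hψ _ _ _).1
  · filter_upwards [e1, e2, e3] with q h1 h2 h3
    refine ae_of_all _ fun x => ?_
    rw [norm_mul, Real.norm_of_nonneg (h.nonneg _ x), Real.norm_of_nonneg (Real.exp_pos _).le,
      Real.exp_add, add_mul a, Real.exp_add (a * ‖x‖), ← inner_neg_left]
    have h4 := exp_inner_le (t := -q.1) (R := ‖t‖ + 1) (by rw [norm_neg]; exact h1.le) x
    calc _ ≤ (B * (1 + (ξ ^ 2 + 1)) * Real.exp (a * ‖x‖)) *
          (Real.exp ((‖t‖ + 1) * ‖x‖) * Real.exp (cumulant ν t + 1)) := by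
          have := (hG q.2 x).trans (show B * (1 + q.2 ^ 2) * Real.exp (a * ‖x‖) ≤
            B * (1 + (ξ ^ 2 + 1)) * Real.exp (a * ‖x‖) by gcongr)
          gcongr
      _ = _ := by ring
  · filter_upwards [h.cont ξ] with x hx
    have h1 : ContinuousAt (fun q : Vec d × ℝ => G q.2 x) (t, ξ) :=
      ContinuousAt.comp (g := fun η => G η x) (f := Prod.snd) hx continuousAt_snd
    refine h1.mul (Continuous.continuousAt ?_)
    fun_prop

/-- The mass of the weight truncated at level `1`. -/
lemma continuous_integral_min_one [IsProbabilityMeasure ν] (h : IsDampedWeight ν G p) :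
    Continuous fun ξ => ∫ x, min (G ξ x) 1 ∂ν := by
  rw [continuous_iff_continuousAt]
  intro ξ
  refine continuousAt_of_dominated (bound := fun _ => 1) ?_ ?_ (integrable_const _) ?_
  · exact Eventually.of_forall fun η =>
      ((h.measurable_weight η).min measurable_const).aestronglyMeasurable
  · refine Eventually.of_forall fun η => ae_of_all _ fun x => ?_
    rw [Real.norm_of_nonneg (le_min (h.nonneg _ _) zero_le_one)]
    exact min_le_right _ _
  · filter_upwards [h.cont ξ] with x hx
    exact hx.min continuousAt_const

lemma integrable_min_one [IsProbabilityMeasure ν] (h : IsDampedWeight ν G p) (ξ : ℝ) :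
    Integrable (fun x => min (G ξ x) 1) ν := by
  refine (integrable_const (1 : ℝ)).mono'
    ((h.measurable_weight ξ).min measurable_const).aestronglyMeasurable (ae_of_all _ fun x => ?_)
  rw [Real.norm_of_nonneg (le_min (h.nonneg _ _) zero_le_one)]
  exact min_le_right _ _

lemma integral_min_one_pos [IsProbabilityMeasure ν] (h : IsDampedWeight ν G p) {ξ : ℝ}
    (hpos : 0 < ν {x | 0 < G ξ x}) : 0 < ∫ x, min (G ξ x) 1 ∂ν := by
  rw [integral_pos_iff_support_of_nonneg (fun x => le_min (h.nonneg _ _) zero_le_one)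
    (h.integrable_min_one ξ)]
  refine hpos.trans_le (measure_mono fun x hx => ?_)
  exact (lt_min hx one_pos).ne'

/-- Coercivity bound: the objective dominates `exp(ψ(t) - 2 ψ(t/2))`. -/
lemma le_weightedObj [IsProbabilityMeasure ν] (h : IsDampedWeight ν G p) (hψ : ExpMoments ν)
    {ξ : ℝ} (hpos : 0 < ∫ x, min (G ξ x) 1 ∂ν) (t : Vec d) :
    27 / 32 * (∫ x, min (G ξ x) 1 ∂ν) ^ 3 *
      Real.exp (cumulant ν t - 2 * cumulant ν ((1 / 2 : ℝ) • t)) ≤ weightedObj ν G t ξ := by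
  set m := ∫ x, min (G ξ x) 1 ∂ν with hm
  set M := Real.exp (cumulant ν ((1 / 2 : ℝ) • t)) with hM
  have hMp : 0 < M := Real.exp_pos _
  -- The aim is the reverse Hölder bound m³ ≤ const · J M², reached through a pointwise Young
  -- inequality with weights 1/3 and 2/3 and scale s. This s makes the term in M equal to m/2,
  -- leaving m/2 ≤ (s²/3) J, which is where 27/32 comes from.
  set s := 4 / (3 * m) * M with hs
  have hsp : 0 < s := by positivity
  have hI1 := h.integrable_weight_mul_exp hψ ξ t 0
  simp only [add_zero] at hI1
  set J := ∫ x, G ξ x * Real.exp (-inner ℝ t x) ∂ν with hJ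
  have hpt : ∀ x, min (G ξ x) 1 ≤ s ^ 2 / 3 * (G ξ x * Real.exp (-inner ℝ t x)) +
      2 / (3 * s) * Real.exp (inner ℝ ((1 / 2 : ℝ) • t) x) := by
    intro x
    set w := Real.exp (inner ℝ ((1 / 2 : ℝ) • t) x) with hw
    have hwp : 0 < w := Real.exp_pos _
    have he : Real.exp (-inner ℝ t x) = (w ^ 2)⁻¹ := by
      rw [hw, ← Real.exp_nat_mul, ← Real.exp_neg, real_inner_smul_left]
      congr 1; push_cast; ring
    have hyoung : 1 ≤ s ^ 2 / 3 * (w ^ 2)⁻¹ + 2 / (3 * s) * w := by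
      have : s ^ 2 / 3 * (w ^ 2)⁻¹ + 2 / (3 * s) * w = (s ^ 3 + 2 * w ^ 3) / (3 * s * w ^ 2) := by
        field_simp
      rw [this, one_le_div (by positivity)]
      nlinarith [mul_nonneg (sq_nonneg (w - s)) (add_pos (mul_pos two_pos hwp) hsp).le]
    have h0 : 0 ≤ min (G ξ x) 1 := le_min (h.nonneg _ _) zero_le_one
    rw [he]
    calc min (G ξ x) 1 ≤ min (G ξ x) 1 * (s ^ 2 / 3 * (w ^ 2)⁻¹ + 2 / (3 * s) * w) :=
          le_mul_of_one_le_right h0 hyoung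
      _ = s ^ 2 / 3 * (min (G ξ x) 1 * (w ^ 2)⁻¹) + 2 / (3 * s) * (min (G ξ x) 1 * w) := by ring
      _ ≤ s ^ 2 / 3 * (G ξ x * (w ^ 2)⁻¹) + 2 / (3 * s) * (1 * w) := by
          gcongr
          · exact min_le_left _ _
          · exact min_le_right _ _
      _ = _ := by ring
  have hint := integral_mono (h.integrable_min_one ξ)
    ((hI1.const_mul (s ^ 2 / 3)).add ((hψ ((1 / 2 : ℝ) • t)).const_mul (2 / (3 * s)))) hpt
  simp only [Pi.add_apply] at hint
  rw [integral_add (hI1.const_mul _) ((hψ _).const_mul _), integral_const_mul, integral_const_mul,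
    ← exp_cumulant hψ, ← hM, ← hm, ← hJ] at hint
  have h1 : 2 / (3 * s) * M = m / 2 := by rw [hs]; field_simp; norm_num
  rw [h1] at hint
  have h2 : s ^ 2 = 16 / 9 * M ^ 2 / m ^ 2 := by rw [hs]; field_simp; norm_num
  have hQ : weightedObj ν G t ξ = Real.exp (cumulant ν t) * J := by
    rw [weightedObj, hJ, ← integral_const_mul]
    refine integral_congr_ae (ae_of_all _ fun x => ?_)
    simp only [Real.exp_add]; ring
  have hE : Real.exp (cumulant ν t - 2 * cumulant ν ((1 / 2 : ℝ) • t)) =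
      Real.exp (cumulant ν t) / M ^ 2 := by
    rw [Real.exp_sub, hM, ← Real.exp_nat_mul]; norm_num
  rw [hQ, hE]
  have h3 : 27 / 32 * m ^ 3 / M ^ 2 ≤ J := by
    rw [h2] at hint
    rw [div_le_iff₀ (by positivity)]
    have h4 : m / 2 ≤ 16 / 9 * M ^ 2 / m ^ 2 / 3 * J := by linarith
    have h5 : 16 / 9 * M ^ 2 / m ^ 2 / 3 * J = 16 / 27 * (J * M ^ 2) / m ^ 2 := by
      field_simp; ring
    rw [h5, le_div_iff₀ (by positivity)] at h4
    nlinarith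
  calc _ = Real.exp (cumulant ν t) * (27 / 32 * m ^ 3 / M ^ 2) := by ring
    _ ≤ _ := by gcongr

/-- Coercivity, locally uniform in the scalar parameter. -/
lemma eventually_weightedObj_zero_lt [IsProbabilityMeasure ν] (h : IsDampedWeight ν G p)
    (hψ : ExpMoments ν)
    (hlim : Tendsto (fun θ => cumulant ν θ - 2 * cumulant ν ((1 / 2 : ℝ) • θ))
      (Bornology.cobounded (Vec d)) atTop) {ξ₀ : ℝ} (hpos : 0 < ν {x | 0 < G ξ₀ x}) :
    ∃ R, ∀ᶠ ξ in 𝓝 ξ₀, ∀ t, R ≤ ‖t‖ → weightedObj ν G 0 ξ < weightedObj ν G t ξ := by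
  set m : ℝ → ℝ := fun ξ => ∫ x, min (G ξ x) 1 ∂ν with hm
  have hm0 : 0 < m ξ₀ := h.integral_min_one_pos hpos
  have hcm : Continuous m := h.continuous_integral_min_one
  have hcQ : Continuous fun ξ => weightedObj ν G 0 ξ :=
    (h.continuous_weightedObj hψ).comp (Continuous.prodMk_right 0)
  set A := weightedObj ν G 0 ξ₀ + 1
  have hcoef : 0 < 27 / 32 * (m ξ₀ / 2) ^ 3 := by positivity
  -- Near ξ₀ the truncated mass stays above m ξ₀ / 2 and the objective at the origin below A, so one
  -- radius serves a whole neighbourhood.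
  have hexp : ∀ᶠ t in Bornology.cobounded (Vec d), A < 27 / 32 * (m ξ₀ / 2) ^ 3 *
      Real.exp (cumulant ν t - 2 * cumulant ν ((1 / 2 : ℝ) • t)) :=
    ((Real.tendsto_exp_atTop.comp hlim).const_mul_atTop hcoef).eventually_gt_atTop A
  rw [← comap_norm_atTop, eventually_comap] at hexp
  obtain ⟨R, hR⟩ := eventually_atTop.1 hexp
  refine ⟨R, ?_⟩
  filter_upwards [hcm.continuousAt.eventually_const_lt (show m ξ₀ / 2 < m ξ₀ by linarith),
    hcQ.continuousAt.eventually_lt_const (show weightedObj ν G 0 ξ₀ < A by simp [A])]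
    with ξ h1 h2 t ht
  have hmp : 0 < m ξ := by linarith
  refine (h2.trans (hR _ ht t rfl)).trans_le (le_trans ?_ (h.le_weightedObj hψ hmp t))
  have : (m ξ₀ / 2) ^ 3 ≤ m ξ ^ 3 := by gcongr
  gcongr

/-- Continuity together with coercivity: outside a ball the objective exceeds its value at the
origin. -/
lemma nonempty_argmin [IsProbabilityMeasure ν] (h : IsDampedWeight ν G p) (hψ : ExpMoments ν)
    (hlim : Tendsto (fun θ => cumulant ν θ - 2 * cumulant ν ((1 / 2 : ℝ) • θ))
      (Bornology.cobounded (Vec d)) atTop) {ξ : ℝ} (hpos : 0 < ν {x | 0 < G ξ x}) :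
    (argmin fun t => weightedObj ν G t ξ).Nonempty := by
  obtain ⟨R, hR⟩ := h.eventually_weightedObj_zero_lt hψ hlim hpos
  have hR := hR.self_of_nhds
  have hc : Continuous fun t => weightedObj ν G t ξ :=
    (h.continuous_weightedObj hψ).comp (Continuous.prodMk_left ξ)
  refine hc.exists_forall_le' 0 ?_
  rw [← Metric.cobounded_eq_cocompact, ← comap_norm_atTop, eventually_comap]
  filter_upwards [eventually_ge_atTop R] with r hr t ht
  exact (hR t (by rw [ht]; exact hr)).le

/-- Strict convexity: a minimiser is strictly better than any other point. -/
lemma weightedObj_lt_of_mem_argmin [IsProbabilityMeasure ν] (h : IsDampedWeight ν G p)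
    (hψ : ExpMoments ν)
    (hlim : Tendsto (fun θ => cumulant ν θ - 2 * cumulant ν ((1 / 2 : ℝ) • θ))
      (Bornology.cobounded (Vec d)) atTop) {ξ : ℝ} (hpos : 0 < ν {x | 0 < G ξ x})
    {t₀ t : Vec d} (ht₀ : t₀ ∈ argmin fun t => weightedObj ν G t ξ) (hne : t ≠ t₀) :
    weightedObj ν G t₀ ξ < weightedObj ν G t ξ := by
  refine lt_of_le_of_ne (ht₀ t) fun heq => ?_
  have hmid := cumulant_midpoint_lt hψ hlim hne
  set r := (1 / 2 : ℝ) • (t + t₀) with hr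
  set k := Real.exp (cumulant ν r - (cumulant ν t + cumulant ν t₀) / 2) with hk
  have hk1 : k < 1 := Real.exp_lt_one_iff.2 (by linarith)
  have hQpos : 0 < weightedObj ν G t₀ ξ :=
    (mul_pos (mul_pos (by norm_num) (pow_pos (h.integral_min_one_pos hpos) 3))
      (Real.exp_pos _)).trans_le (h.le_weightedObj hψ (h.integral_min_one_pos hpos) t₀)
  have hI := fun t => h.integrable_weight_mul_exp hψ ξ t (cumulant ν t)
  have hle : weightedObj ν G r ξ ≤
      k * ((weightedObj ν G t ξ + weightedObj ν G t₀ ξ) / 2) := by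
    have e : k * ((weightedObj ν G t ξ + weightedObj ν G t₀ ξ) / 2) =
        ∫ x, k / 2 * (G ξ x * Real.exp (-inner ℝ t x + cumulant ν t) +
          G ξ x * Real.exp (-inner ℝ t₀ x + cumulant ν t₀)) ∂ν := by
      rw [integral_const_mul, integral_add (hI t) (hI t₀), weightedObj, weightedObj]; ring
    rw [e]
    refine integral_mono (hI r) (((hI t).add (hI t₀)).const_mul _) fun x => ?_
    simp only
    set u := -inner ℝ t x + cumulant ν t
    set u₀ := -inner ℝ t₀ x + cumulant ν t₀
    have h1 : Real.exp (-inner ℝ r x + cumulant ν r) =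
        k * (Real.exp (u / 2) * Real.exp (u₀ / 2)) := by
      rw [hk, ← Real.exp_add, ← Real.exp_add, hr, real_inner_smul_left, inner_add_left]
      congr 1
      simp only [u, u₀]
      ring
    have h2 : Real.exp (u / 2) * Real.exp (u₀ / 2) ≤ (Real.exp u + Real.exp u₀) / 2 := by
      have e1 : Real.exp u = Real.exp (u / 2) ^ 2 := by rw [← Real.exp_nat_mul]; congr 1; push_cast; ring
      have e2 : Real.exp u₀ = Real.exp (u₀ / 2) ^ 2 := by
        rw [← Real.exp_nat_mul]; congr 1; push_cast; ring
      rw [e1, e2]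
      nlinarith [sq_nonneg (Real.exp (u / 2) - Real.exp (u₀ / 2))]
    rw [h1]
    have := h.nonneg ξ x
    calc _ ≤ G ξ x * (k * ((Real.exp u + Real.exp u₀) / 2)) := by
          have : 0 ≤ k := (Real.exp_pos _).le
          gcongr
      _ = _ := by ring
  have := ht₀ r
  simp only at this heq
  rw [← heq] at hle
  nlinarith

/-- Uniform separation from the minimum on bounded sets, for nearby scalar parameters. -/
lemma eventually_le_weightedObj_sub [IsProbabilityMeasure ν] (h : IsDampedWeight ν G p)
    (hψ : ExpMoments ν)
    (hlim : Tendsto (fun θ => cumulant ν θ - 2 * cumulant ν ((1 / 2 : ℝ) • θ))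
      (Bornology.cobounded (Vec d)) atTop) {ξ₀ : ℝ} (hpos : 0 < ν {x | 0 < G ξ₀ x})
    {t₀ : Vec d} (ht₀ : t₀ ∈ argmin fun t => weightedObj ν G t ξ₀) {ε : ℝ} (hε : 0 < ε) (R : ℝ) :
    ∃ c > 0, ∀ᶠ ξ in 𝓝 ξ₀, ∀ t, ε ≤ ‖t - t₀‖ → ‖t‖ ≤ R →
      c ≤ weightedObj ν G t ξ - weightedObj ν G t₀ ξ := by
  set K : Set (Vec d) := Metric.closedBall 0 R ∩ {t | ε ≤ ‖t - t₀‖} with hK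
  have hKc : IsCompact K := (isCompact_closedBall _ _).inter_right
    (isClosed_le continuous_const (by fun_prop))
  have hcQ := h.continuous_weightedObj hψ
  have hcdiff : Continuous fun q : ℝ × Vec d =>
      weightedObj ν G q.2 q.1 - weightedObj ν G t₀ q.1 :=
    (hcQ.comp (continuous_snd.prodMk continuous_fst)).sub
      (hcQ.comp (continuous_const.prodMk continuous_fst))
  have hposK : ∀ t ∈ K, 0 < weightedObj ν G t ξ₀ - weightedObj ν G t₀ ξ₀ := by
    rintro t ⟨-, ht⟩
    refine sub_pos.2 (h.weightedObj_lt_of_mem_argmin hψ hlim hpos ht₀ ?_)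
    rintro rfl
    simp only [Set.mem_ofPred_eq, sub_self, norm_zero] at ht
    linarith
  obtain ⟨c, hc, hcK⟩ := hKc.exists_forall_le' (f := fun t =>
    weightedObj ν G t ξ₀ - weightedObj ν G t₀ ξ₀)
    (hcdiff.comp (Continuous.prodMk_right ξ₀)).continuousOn hposK
  refine ⟨c / 2, by positivity, ?_⟩
  -- The tube lemma: compactness of K makes the neighbourhood of ξ₀ uniform in t, at the price of
  -- halving the gap.
  have := hKc.eventually_forall_of_forall_eventually (x₀ := ξ₀)
    (P := fun ξ t => c / 2 ≤ weightedObj ν G t ξ - weightedObj ν G t₀ ξ) fun t ht =>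
      hcdiff.continuousAt.eventually_const_le
        (show c / 2 < weightedObj ν G t ξ₀ - weightedObj ν G t₀ ξ₀ by linarith [hcK t ht])
  filter_upwards [this] with ξ hξ t h1 h2
  exact hξ t ⟨by simpa using h2, h1⟩

lemma measurable_weightedIncr (h : IsDampedWeight ν G p) :
    Measurable fun q : (ℝ × Vec d) × Vec d => weightedIncr ν G p q.1.1 q.1.2 q.2 := by
  have h1 := h.meas.comp (show Measurable fun q : (ℝ × Vec d) × Vec d => (q.1.1, q.2) by fun_prop)
  have h2 := h.meas_p.comp (show Measurable fun q : (ℝ × Vec d) × Vec d => q.1 by fun_prop)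
  have h3 := (measurable_gradient_cumulant (ν := ν)).comp
    (show Measurable fun q : (ℝ × Vec d) × Vec d => q.1.2 by fun_prop)
  exact (h2.mul h1).smul (h3.sub measurable_snd)

lemma norm_weightedIncr_sq (ξ : ℝ) (t x : Vec d) : ‖weightedIncr ν G p ξ t x‖ ^ 2 =
    (p ξ t * G ξ x) ^ 2 * ‖x - gradient (cumulant ν) t‖ ^ 2 := by
  rw [weightedIncr, norm_smul, mul_pow, Real.norm_eq_abs, sq_abs, norm_sub_rev]

lemma integrable_norm_weightedIncr_sq [IsProbabilityMeasure ν] (h : IsDampedWeight ν G p)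
    (hψ : ExpMoments ν) (ξ : ℝ) (t s : Vec d) :
    Integrable (fun x => ‖weightedIncr ν G p ξ t x‖ ^ 2) (esscher ν s) := by
  obtain ⟨B, a, hB, ha, hG⟩ := h.growth
  have hm : Measurable fun x => ‖weightedIncr ν G p ξ t x‖ ^ 2 :=
    ((h.measurable_weightedIncr.comp (measurable_prodMk_left (x := (ξ, t)))).norm.pow_const 2)
  refine ((integrable_exp_mul_norm_mul_norm_sq hψ (2 * a) s (gradient (cumulant ν) t)).const_mul
    ((B * (1 + ξ ^ 2)) ^ 2)).mono' hm.aestronglyMeasurable (ae_of_all _ fun x => ?_)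
  rw [Real.norm_of_nonneg (by positivity), norm_weightedIncr_sq, ← mul_assoc]
  gcongr
  have h1 : Real.exp (2 * a * ‖x‖) = Real.exp (a * ‖x‖) ^ 2 := by
    rw [← Real.exp_nat_mul]; congr 1; push_cast; ring
  rw [h1, ← mul_pow]
  have h2 := h.p_nonneg ξ t
  have h3 := h.nonneg ξ x
  have h4 : p ξ t * G ξ x ≤ B * (1 + ξ ^ 2) * Real.exp (a * ‖x‖) :=
    (mul_le_of_le_one_left h3 (h.p_le_one ξ t)).trans (hG ξ x)
  exact pow_le_pow_left₀ (mul_nonneg h2 h3) h4 2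

lemma exists_integral_norm_weightedIncr_sq_le (h : IsDampedWeight ν G p) :
    ∃ B, 0 ≤ B ∧ ∀ ξ t, ∫ x, ‖weightedIncr ν G p ξ t x‖ ^ 2 ∂(esscher ν (-t)) ≤
      B * (1 + ‖t‖ ^ 2) := by
  simp_rw [norm_weightedIncr_sq]
  exact h.second

lemma integrable_inner_weightedIncr [IsProbabilityMeasure ν] (h : IsDampedWeight ν G p)
    (hψ : ExpMoments ν) (ξ : ℝ) (t s v : Vec d) :
    Integrable (fun x => (inner ℝ (weightedIncr ν G p ξ t x) v : ℝ)) (esscher ν s) := by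
  have : IsProbabilityMeasure (esscher ν s) := isProbabilityMeasure_tilted (hψ s)
  have hm : Measurable fun x => weightedIncr ν G p ξ t x :=
    h.measurable_weightedIncr.comp (measurable_prodMk_left (x := (ξ, t)))
  refine (((h.integrable_norm_weightedIncr_sq hψ ξ t s).add (integrable_const 1)).mul_const
    ‖v‖).mono' (by fun_prop) (ae_of_all _ fun x => ?_)
  refine (abs_real_inner_le_norm _ _).trans ?_
  simp only [Pi.add_apply]
  gcongr
  nlinarith [sq_nonneg (‖weightedIncr ν G p ξ t x‖ - 1), norm_nonneg (weightedIncr ν G p ξ t x)]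

/-- The mean increment dominates the excess of the objective. -/
lemma le_integral_inner_weightedIncr [IsProbabilityMeasure ν] (h : IsDampedWeight ν G p)
    (hψ : ExpMoments ν) (ξ : ℝ) (t t' : Vec d) :
    p ξ t * Real.exp (-(cumulant ν t + cumulant ν (-t))) *
        (weightedObj ν G t ξ - weightedObj ν G t' ξ) ≤
      ∫ x, inner ℝ (weightedIncr ν G p ξ t x) (t - t') ∂(esscher ν (-t)) := by
  have hI := fun t => h.integrable_weight_mul_exp hψ ξ t (cumulant ν t)
  have hint := (integrable_esscher_iff hψ (-t) _).1
    (h.integrable_inner_weightedIncr hψ ξ t (-t) (t - t'))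
  have hint' := hint.const_mul (Real.exp (-cumulant ν (-t)))
  rw [integral_esscher hψ, weightedObj, weightedObj, ← integral_sub (hI t) (hI t'),
    ← integral_const_mul]
  refine integral_mono (((hI t).sub (hI t')).const_mul _) ?_ fun x => ?_
  · refine hint'.congr (ae_of_all _ fun x => ?_)
    simp only [smul_eq_mul]
    rw [← mul_assoc, ← Real.exp_add]
    ring_nf
  simp only [smul_eq_mul]
  set u := -inner ℝ t x + cumulant ν t with hu
  set u' := -inner ℝ t' x + cumulant ν t' with hu'
  set a := (inner ℝ (gradient (cumulant ν) t - x) (t - t') : ℝ) with ha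
  -- For fixed x the exponent -⟨t, x⟩ + ψ(t) is convex in t with gradient ∇ψ(t) - x. The inequality
  -- is proved pointwise, so nothing is differentiated under the integral.
  have h1 : u - a ≤ u' := by
    have := tangent_le_cumulant hψ t (t' - t)
    rw [add_sub_cancel, ← neg_sub t t', inner_neg_right] at this
    rw [ha, hu, hu', inner_sub_left, inner_sub_right x, real_inner_comm t x, real_inner_comm t' x]
    linarith
  have h2 : Real.exp u - Real.exp u' ≤ Real.exp u * a := by
    have h3 : Real.exp u * (1 - a) ≤ Real.exp u' := by
      calc _ ≤ Real.exp u * Real.exp (-a) := by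
            gcongr
            linarith [Real.add_one_le_exp (-a)]
        _ = Real.exp (u - a) := by rw [← Real.exp_add]; ring_nf
        _ ≤ _ := Real.exp_le_exp.2 h1
    linarith
  rw [weightedIncr, real_inner_smul_left, ← ha]
  -- Why sampling uses -t: the density of that law is exp u, the factor in the objective, up to a
  -- constant in x.
  have h4 : Real.exp (inner ℝ (-t) x - cumulant ν (-t)) =
      Real.exp (-(cumulant ν t + cumulant ν (-t))) * Real.exp u := by
    rw [← Real.exp_add, hu, inner_neg_left]; ring_nf
  rw [h4]
  have h5 := h.nonneg ξ x
  have h6 := h.p_nonneg ξ t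
  calc _ = p ξ t * Real.exp (-(cumulant ν t + cumulant ν (-t))) * G ξ x *
        (Real.exp u - Real.exp u') := by ring
    _ ≤ p ξ t * Real.exp (-(cumulant ν t + cumulant ν (-t))) * G ξ x * (Real.exp u * a) := by
        gcongr
    _ = _ := by ring

end IsDampedWeight
end EsscherVaR

namespace EsscherVaR

open ProbabilityTheory

/-! ### The stochastic gradient recursion of the Esscher parameter -/

/-- The conditional mean of the increment. -/
noncomputable def meanIncr {d : ℕ} (ν : Measure (Vec d)) (G p : ℝ → Vec d → ℝ) (ξ : ℝ)
    (t : Vec d) : Vec d :=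
  ∫ x, weightedIncr ν G p ξ t x ∂(esscher ν (-t))

namespace IsDampedWeight

variable {d : ℕ} {ν : Measure (Vec d)} {G p : ℝ → Vec d → ℝ}

lemma integrable_weightedIncr [IsProbabilityMeasure ν] (h : IsDampedWeight ν G p)
    (hψ : ExpMoments ν) (ξ : ℝ) (t s : Vec d) :
    Integrable (weightedIncr ν G p ξ t) (esscher ν s) := by
  have : IsProbabilityMeasure (esscher ν s) := isProbabilityMeasure_tilted (hψ s)
  have hm : Measurable fun x => weightedIncr ν G p ξ t x :=
    h.measurable_weightedIncr.comp (measurable_prodMk_left (x := (ξ, t)))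
  refine ((h.integrable_norm_weightedIncr_sq hψ ξ t s).add (integrable_const 1)).mono'
    hm.aestronglyMeasurable (ae_of_all _ fun x => ?_)
  simp only [Pi.add_apply]
  nlinarith [sq_nonneg (‖weightedIncr ν G p ξ t x‖ - 1), norm_nonneg (weightedIncr ν G p ξ t x)]

lemma inner_meanIncr [IsProbabilityMeasure ν] (h : IsDampedWeight ν G p)
    (hψ : ExpMoments ν) (ξ : ℝ) (t v : Vec d) :
    inner ℝ (meanIncr ν G p ξ t) v =
      ∫ x, inner ℝ (weightedIncr ν G p ξ t x) v ∂(esscher ν (-t)) := by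
  rw [meanIncr, real_inner_comm, ← integral_inner (h.integrable_weightedIncr hψ ξ t (-t))]
  simp_rw [real_inner_comm]

lemma le_inner_meanIncr [IsProbabilityMeasure ν] (h : IsDampedWeight ν G p)
    (hψ : ExpMoments ν) (ξ : ℝ) (t t' : Vec d) :
    p ξ t * Real.exp (-(cumulant ν t + cumulant ν (-t))) *
        (weightedObj ν G t ξ - weightedObj ν G t' ξ) ≤
      inner ℝ (meanIncr ν G p ξ t) (t - t') := by
  rw [h.inner_meanIncr hψ]
  exact h.le_integral_inner_weightedIncr hψ ξ t t'

end IsDampedWeight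

/-- A path of the recursion along which all the centred noise series converge. -/
structure IsRegularPath {d : ℕ} (g : ℕ → ℝ) (t inc h : ℕ → Vec d) : Prop where
  log_noise : ∃ l, Tendsto (fun n => ∑ k ∈ Finset.range n,
    g k * inner ℝ (inc k - h k) ((1 + ‖t k‖ ^ 2)⁻¹ • t k)) atTop (𝓝 l)
  square : Summable fun n => g n ^ 2 * (‖inc n‖ ^ 2 / (1 + ‖t n‖ ^ 2))
  radial : ∀ R : ℕ, ∃ l, Tendsto (fun n => ∑ k ∈ Finset.range n,
    g k * inner ℝ (inc k - h k) (Set.indicator (Metric.closedBall 0 R) id (t k))) atTop (𝓝 l)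
  coord : ∀ (R : ℕ) (i : Fin d), ∃ l, Tendsto (fun n => ∑ k ∈ Finset.range n,
    g k * inner ℝ (inc k - h k) (Set.indicator (Metric.closedBall 0 R)
      (fun _ => EuclideanSpace.single i (1 : ℝ)) (t k))) atTop (𝓝 l)

section Noise

variable {Ω : Type*} [mΩ : MeasurableSpace Ω] {P : Measure Ω} [IsProbabilityMeasure P]
  {ℱ : Filtration ℕ mΩ} {d : ℕ} {ν : Measure (Vec d)} [IsProbabilityMeasure ν]
  {G p : ℝ → Vec d → ℝ} {g : ℕ → ℝ} {ξ : ℕ → Ω → ℝ} {t Y : ℕ → Ω → Vec d}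

/-- The condition on c offsets the growth 1 + ‖t‖² of the second moment of the increment, so the
tested noise has variance of order g n². -/
lemma ae_tendsto_sum_inner_noise (h : IsDampedWeight ν G p) (hψ : ExpMoments ν)
    (hg : Summable fun n => g n ^ 2) (hξ : ∀ n, Measurable[ℱ n] (ξ n))
    (ht : ∀ n, Measurable[ℱ n] (t n)) (hY : ∀ n, Measurable[ℱ (n + 1)] (Y (n + 1)))
    (hlaw : ∀ n, HasCondLaw P (ℱ n) (Y (n + 1)) fun ω => esscher ν (-t n ω))
    {c : Vec d → Vec d} (hc : Measurable c) {A : ℝ}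
    (hA : ∀ s, ‖c s‖ ^ 2 * (1 + ‖s‖ ^ 2) ≤ A) :
    ∀ᵐ ω ∂P, ∃ l, Tendsto (fun n => ∑ k ∈ Finset.range n,
      g k * inner ℝ (weightedIncr ν G p (ξ k ω) (t k ω) (Y (k + 1) ω) -
        meanIncr ν G p (ξ k ω) (t k ω)) (c (t k ω))) atTop (𝓝 l) := by
  obtain ⟨B, hB0, hB⟩ := h.exists_integral_norm_weightedIncr_sq_le
  have hu : Measurable fun e : ℝ × Vec d => -e.2 := by fun_prop
  have := isMarkovKernel_esscherKernel hψ (fun e : ℝ × Vec d => -e.2) hu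
  set f : ℕ → (ℝ × Vec d) × Vec d → ℝ := fun n q =>
    g n * inner ℝ (weightedIncr ν G p q.1.1 q.1.2 q.2) (c q.1.2) with hf
  have hfm : ∀ n, Measurable (f n) := fun n =>
    (h.measurable_weightedIncr.inner (hc.comp (by fun_prop))).const_mul _
  have hle : ∀ n (e : ℝ × Vec d) x, f n (e, x) ^ 2 ≤
      g n ^ 2 * ‖c e.2‖ ^ 2 * ‖weightedIncr ν G p e.1 e.2 x‖ ^ 2 := by
    intro n e x
    have h1 := abs_real_inner_le_norm (weightedIncr ν G p e.1 e.2 x) (c e.2)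
    calc f n (e, x) ^ 2 = g n ^ 2 * |inner ℝ (weightedIncr ν G p e.1 e.2 x) (c e.2)| ^ 2 := by
          simp only [hf, mul_pow, sq_abs]
      _ ≤ g n ^ 2 * (‖weightedIncr ν G p e.1 e.2 x‖ * ‖c e.2‖) ^ 2 := by gcongr
      _ = _ := by ring
  have hdom := fun n (e : ℝ × Vec d) =>
    (h.integrable_norm_weightedIncr_sq hψ e.1 e.2 (-e.2)).const_mul (g n ^ 2 * ‖c e.2‖ ^ 2)
  have hsq : ∀ n e, Integrable (fun x => f n (e, x) ^ 2)
      (esscherKernel hψ (fun e : ℝ × Vec d => -e.2) hu e) := by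
    intro n e
    refine (hdom n e).mono' (((hfm n).comp measurable_prodMk_left).pow_const 2).aestronglyMeasurable
      (ae_of_all _ fun x => ?_)
    rw [Real.norm_of_nonneg (sq_nonneg _)]
    exact hle n e x
  have hmain := ae_tendsto_sum_centred (P := P) (ℱ := ℱ)
    (κ := esscherKernel hψ (fun e : ℝ × Vec d => -e.2) hu)
    (z := fun n ω => (ξ n ω, t n ω)) (Y := Y) (f := f) (c := fun n => A * B * g n ^ 2)
    (fun n => (hξ n).prodMk (ht n)) hY hlaw hfm hsq (fun n e => ?_) (hg.mul_left _)
  · filter_upwards [hmain] with ω hω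
    refine hω.imp fun l hl => hl.congr fun n => Finset.sum_congr rfl fun k _ => ?_
    simp only [hf]
    rw [integral_const_mul, inner_sub_left, mul_sub, h.inner_meanIncr hψ]
    rfl
  · refine (integral_mono (hsq n e) (hdom n e) (hle n e)).trans ?_
    rw [integral_const_mul]
    have h1 := hB e.1 e.2
    have h2 := hA e.2
    calc _ ≤ g n ^ 2 * ‖c e.2‖ ^ 2 * (B * (1 + ‖e.2‖ ^ 2)) := by gcongr; exact h1
      _ = g n ^ 2 * B * (‖c e.2‖ ^ 2 * (1 + ‖e.2‖ ^ 2)) := by ring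
      _ ≤ g n ^ 2 * B * A := by gcongr
      _ = _ := by ring

/-- This controls the second-order term in the expansion of log(1 + ‖t‖²); the division compensates
the growth of the second moment. -/
lemma ae_summable_sq_incr (h : IsDampedWeight ν G p) (hψ : ExpMoments ν)
    (hg : Summable fun n => g n ^ 2) (hξ : ∀ n, Measurable[ℱ n] (ξ n))
    (ht : ∀ n, Measurable[ℱ n] (t n)) (hY : ∀ n, Measurable[ℱ (n + 1)] (Y (n + 1)))
    (hlaw : ∀ n, HasCondLaw P (ℱ n) (Y (n + 1)) fun ω => esscher ν (-t n ω)) :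
    ∀ᵐ ω ∂P, Summable fun n => g n ^ 2 *
      (‖weightedIncr ν G p (ξ n ω) (t n ω) (Y (n + 1) ω)‖ ^ 2 / (1 + ‖t n ω‖ ^ 2)) := by
  obtain ⟨B, hB0, hB⟩ := h.exists_integral_norm_weightedIncr_sq_le
  have hu : Measurable fun e : ℝ × Vec d => -e.2 := by fun_prop
  have := isMarkovKernel_esscherKernel hψ (fun e : ℝ × Vec d => -e.2) hu
  set f : ℕ → (ℝ × Vec d) × Vec d → ℝ := fun n q =>
    g n * (‖weightedIncr ν G p q.1.1 q.1.2 q.2‖ / √(1 + ‖q.1.2‖ ^ 2)) with hf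
  have hfm : ∀ n, Measurable (f n) := fun n =>
    (h.measurable_weightedIncr.norm.div (by fun_prop)).const_mul _
  have hfsq : ∀ n (e : ℝ × Vec d) x, f n (e, x) ^ 2 =
      g n ^ 2 / (1 + ‖e.2‖ ^ 2) * ‖weightedIncr ν G p e.1 e.2 x‖ ^ 2 := by
    intro n e x
    simp only [hf, mul_pow, div_pow, Real.sq_sqrt (show 0 ≤ 1 + ‖e.2‖ ^ 2 by positivity)]
    ring
  have hmain := ae_summable_sq (P := P) (ℱ := ℱ)
    (κ := esscherKernel hψ (fun e : ℝ × Vec d => -e.2) hu)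
    (z := fun n ω => (ξ n ω, t n ω)) (Y := Y) (f := f) (c := fun n => B * g n ^ 2)
    (fun n => (hξ n).prodMk (ht n)) hY hlaw hfm (fun n e => ?_) (fun n e => ?_) (hg.mul_left _)
  · filter_upwards [hmain] with ω hω
    refine hω.congr fun n => ?_
    rw [hfsq]; ring
  · simp_rw [hfsq]
    exact (h.integrable_norm_weightedIncr_sq hψ e.1 e.2 (-e.2)).const_mul _
  · simp_rw [hfsq]
    rw [integral_const_mul]
    calc _ ≤ g n ^ 2 / (1 + ‖e.2‖ ^ 2) * (B * (1 + ‖e.2‖ ^ 2)) := by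
          gcongr
          exact hB e.1 e.2
      _ = _ := by field_simp

/-- Natural radii and basis directions cost only countably many null sets. The radius of a path and
the point it is compared with may then be chosen after the path is known. -/
lemma ae_isRegularPath (h : IsDampedWeight ν G p) (hψ : ExpMoments ν)
    (hg : Summable fun n => g n ^ 2) (hξ : ∀ n, Measurable[ℱ n] (ξ n))
    (ht : ∀ n, Measurable[ℱ n] (t n)) (hY : ∀ n, Measurable[ℱ (n + 1)] (Y (n + 1)))
    (hlaw : ∀ n, HasCondLaw P (ℱ n) (Y (n + 1)) fun ω => esscher ν (-t n ω)) :
    ∀ᵐ ω ∂P, IsRegularPath g (fun n => t n ω)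
      (fun n => weightedIncr ν G p (ξ n ω) (t n ω) (Y (n + 1) ω))
      (fun n => meanIncr ν G p (ξ n ω) (t n ω)) := by
  have hball : ∀ R : ℕ, MeasurableSet (Metric.closedBall (0 : Vec d) R) :=
    fun R => Metric.isClosed_closedBall.measurableSet
  have e1 := ae_tendsto_sum_inner_noise h hψ hg hξ ht hY hlaw
    (c := fun s => (1 + ‖s‖ ^ 2)⁻¹ • s) (by fun_prop) (A := 1) fun s => by
      rw [norm_smul, norm_inv, Real.norm_of_nonneg (by positivity), mul_pow]
      have : 0 < 1 + ‖s‖ ^ 2 := by positivity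
      rw [inv_pow, mul_assoc, inv_mul_le_iff₀ (by positivity)]
      nlinarith [sq_nonneg ‖s‖]
  have e3 : ∀ R : ℕ, _ := fun R => ae_tendsto_sum_inner_noise h hψ hg hξ ht hY hlaw
    (c := Set.indicator (Metric.closedBall 0 R) id) (measurable_id.indicator (hball R))
    (A := (R : ℝ) ^ 2 * (1 + (R : ℝ) ^ 2)) fun s => by
      by_cases hs : s ∈ Metric.closedBall (0 : Vec d) R
      · rw [Set.indicator_of_mem hs, id]
        have : ‖s‖ ≤ R := by simpa using hs
        gcongr
      · rw [Set.indicator_of_notMem hs]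
        simp; positivity
  have e4 : ∀ (R : ℕ) (i : Fin d), _ := fun R i =>
    ae_tendsto_sum_inner_noise h hψ hg hξ ht hY hlaw
    (c := Set.indicator (Metric.closedBall 0 R) fun _ => EuclideanSpace.single i (1 : ℝ))
    (measurable_const.indicator (hball R))
    (A := 1 + (R : ℝ) ^ 2) fun s => by
      by_cases hs : s ∈ Metric.closedBall (0 : Vec d) R
      · rw [Set.indicator_of_mem hs]
        have : ‖s‖ ≤ R := by simpa using hs
        simp only [PiLp.norm_single, norm_one, one_pow, one_mul]
        gcongr
      · rw [Set.indicator_of_notMem hs]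
        simp; positivity
  filter_upwards [e1, ae_summable_sq_incr h hψ hg hξ ht hY hlaw, ae_all_iff.2 e3,
    ae_all_iff.2 fun R => ae_all_iff.2 (e4 R)] with ω h1 h2 h3 h4
  exact ⟨h1, h2, h3, h4⟩

end Noise

/-! ### Deterministic analysis along a regular path -/

section Path

variable {d : ℕ} {ν : Measure (Vec d)} [IsProbabilityMeasure ν] {G p : ℝ → Vec d → ℝ}
  {g : ℕ → ℝ} {ξ : ℕ → ℝ} {t inc : ℕ → Vec d}

lemma one_add_norm_sq_step {d : ℕ} (s v : Vec d) (a : ℝ) :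
    ‖s - a • v‖ ^ 2 = ‖s‖ ^ 2 - 2 * a * inner ℝ v s + a ^ 2 * ‖v‖ ^ 2 := by
  rw [norm_sub_sq_real, inner_smul_right, norm_smul, mul_pow, Real.norm_eq_abs, sq_abs,
    real_inner_comm]
  ring

/-- Apply log y ≤ y - 1 to the ratio of successive values. The logarithm is chosen because it
divides by 1 + ‖s‖², exactly the growth of the second moment of the increments. -/
lemma log_one_add_norm_sq_step {d : ℕ} (s v m : Vec d) (a : ℝ) :
    Real.log (1 + ‖s - a • v‖ ^ 2) ≤ Real.log (1 + ‖s‖ ^ 2) +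
      -2 * a * (inner ℝ m s / (1 + ‖s‖ ^ 2)) +
      (-2 * (a * inner ℝ (v - m) ((1 + ‖s‖ ^ 2)⁻¹ • s)) +
        a ^ 2 * (‖v‖ ^ 2 / (1 + ‖s‖ ^ 2))) := by
  have hW : 0 < 1 + ‖s‖ ^ 2 := by positivity
  have hW' : 0 < 1 + ‖s - a • v‖ ^ 2 := by positivity
  have h1 := Real.log_le_sub_one_of_pos (div_pos hW' hW)
  rw [Real.log_div hW'.ne' hW.ne'] at h1
  have h2 : (1 + ‖s - a • v‖ ^ 2) / (1 + ‖s‖ ^ 2) - 1 =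
      -2 * a * (inner ℝ m s / (1 + ‖s‖ ^ 2)) +
      (-2 * (a * inner ℝ (v - m) ((1 + ‖s‖ ^ 2)⁻¹ • s)) +
        a ^ 2 * (‖v‖ ^ 2 / (1 + ‖s‖ ^ 2))) := by
    rw [one_add_norm_sq_step, inner_smul_right, inner_sub_left]
    field_simp
    ring
  linarith

lemma IsRegularPath.exists_tendsto_log_noise {h : ℕ → Vec d} (hr : IsRegularPath g t inc h) :
    ∃ E, Tendsto (fun n => ∑ k ∈ Finset.range n,
      (-2 * (g k * inner ℝ (inc k - h k) ((1 + ‖t k‖ ^ 2)⁻¹ • t k)) +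
        g k ^ 2 * (‖inc k‖ ^ 2 / (1 + ‖t k‖ ^ 2)))) atTop (𝓝 E) := by
  obtain ⟨l, hl⟩ := hr.log_noise
  refine ⟨_, ((hl.const_mul (-2)).add hr.square.hasSum.tendsto_sum_nat).congr fun n => ?_⟩
  rw [Finset.sum_add_distrib, Finset.mul_sum]

lemma exists_norm_le_of_log_le {L : ℕ → Vec d} {M : ℝ}
    (hM : ∀ n, Real.log (1 + ‖L n‖ ^ 2) ≤ M) : ∃ R : ℕ, ∀ n, ‖L n‖ ≤ R := by
  obtain ⟨R, hR⟩ := exists_nat_ge (Real.exp M)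
  refine ⟨R, fun n => le_trans ?_ hR⟩
  have h1 := (Real.log_le_iff_le_exp (by positivity)).1 (hM n)
  nlinarith [sq_nonneg (‖L n‖ - 1), norm_nonneg (L n)]

lemma exp_neg_cumulant_add_le_one (hψ : ExpMoments ν) (s : Vec d) :
    Real.exp (-(cumulant ν s + cumulant ν (-s))) ≤ 1 :=
  Real.exp_le_one_iff.2 (neg_nonpos.2 (cumulant_add_cumulant_neg_nonneg hψ s))

/-- The inward drift is controlled by `exp(-(ψ(t) + ψ(-t)))`. -/
lemma IsDampedWeight.neg_inner_meanIncr_le (h : IsDampedWeight ν G p) (hψ : ExpMoments ν) {B : ℝ}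
    (hB : ∀ ξ t, p ξ t * ∫ x, G ξ x ∂ν ≤ B) (ξ : ℝ) (s : Vec d) :
    -inner ℝ (meanIncr ν G p ξ s) s ≤
      B * Real.exp (-(cumulant ν s + cumulant ν (-s))) := by
  have h1 := h.le_inner_meanIncr hψ ξ s 0
  rw [sub_zero, weightedObj_zero] at h1
  have h2 := hB ξ s
  have h3 : 0 ≤ p ξ s * Real.exp (-(cumulant ν s + cumulant ν (-s))) * weightedObj ν G s ξ :=
    mul_nonneg (mul_nonneg (h.p_nonneg _ _) (Real.exp_pos _).le) (h.weightedObj_nonneg _ _)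
  have h4 := mul_le_mul_of_nonneg_right h2
    (Real.exp_pos (-(cumulant ν s + cumulant ν (-s)))).le
  nlinarith

/-- Nothing is assumed on ξ here: even the worst outward push is summable, so it is counted with the
noise and the remaining drift is zero. -/
lemma exists_norm_le_of_summable (h : IsDampedWeight ν G p) (hψ : ExpMoments ν)
    (hg0 : ∀ n, 0 ≤ g n) (hstep : ∀ n, t (n + 1) = t n - g n • inc n)
    (hr : IsRegularPath g t inc fun n => meanIncr ν G p (ξ n) (t n))
    (hsum : Summable fun n => g n * Real.exp (-(cumulant ν (t n) + cumulant ν (-t n)))) :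
    ∃ R : ℕ, ∀ n, ‖t n‖ ≤ R := by
  obtain ⟨B, hB⟩ := h.mass
  have hB0 : 0 ≤ B :=
    (mul_nonneg (h.p_nonneg 0 0) (integral_nonneg (h.nonneg 0))).trans (hB 0 0)
  obtain ⟨E, hE⟩ := hr.exists_tendsto_log_noise
  have hE' := hE.add (hsum.mul_left (2 * B)).hasSum.tendsto_sum_nat
  simp_rw [← Finset.sum_add_distrib] at hE'
  refine (exists_le_of_drift (L := fun n => Real.log (1 + ‖t n‖ ^ 2)) (q := fun _ => 0)
    (B := 0) (B' := 0) hE' (fun n => ?_) (by simp) (by simp)).elim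
    fun M hM => exists_norm_le_of_log_le hM
  · have h1 := log_one_add_norm_sq_step (t n) (inc n) (meanIncr ν G p (ξ n) (t n)) (g n)
    rw [← hstep] at h1
    have h2 := h.neg_inner_meanIncr_le hψ hB (ξ n) (t n)
    have hW : 1 ≤ 1 + ‖t n‖ ^ 2 := by nlinarith [sq_nonneg ‖t n‖]
    have h3 : -(inner ℝ (meanIncr ν G p (ξ n) (t n)) (t n) / (1 + ‖t n‖ ^ 2)) ≤
        B * Real.exp (-(cumulant ν (t n) + cumulant ν (-t n))) := by
      rw [← neg_div, div_le_iff₀ (by positivity)]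
      exact h2.trans (le_mul_of_one_le_right (mul_nonneg hB0 (Real.exp_pos _).le) hW)
    have h4 := mul_le_mul_of_nonneg_left h3 (hg0 n)
    linarith

/-- For ξ near ξ₀ and t far out, the objective at t exceeds its value at 0, so the mean step points
inward. Elsewhere the outward drift of the logarithm is at most 2B once g n ≤ 1. -/
lemma exists_norm_le_of_tendsto (h : IsDampedWeight ν G p) (hψ : ExpMoments ν)
    (hlim : Tendsto (fun θ => cumulant ν θ - 2 * cumulant ν ((1 / 2 : ℝ) • θ))
      (Bornology.cobounded (Vec d)) atTop)
    (hg0 : ∀ n, 0 ≤ g n) (hg : Tendsto g atTop (𝓝 0))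
    (hstep : ∀ n, t (n + 1) = t n - g n • inc n)
    (hr : IsRegularPath g t inc fun n => meanIncr ν G p (ξ n) (t n)) {ξ₀ : ℝ}
    (hξ : Tendsto ξ atTop (𝓝 ξ₀)) (hpos : 0 < ν {x | 0 < G ξ₀ x}) :
    ∃ R : ℕ, ∀ n, ‖t n‖ ≤ R := by
  obtain ⟨B, hB⟩ := h.mass
  have hB0 : 0 ≤ B :=
    (mul_nonneg (h.p_nonneg 0 0) (integral_nonneg (h.nonneg 0))).trans (hB 0 0)
  obtain ⟨E, hE⟩ := hr.exists_tendsto_log_noise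
  obtain ⟨R, hR⟩ := h.eventually_weightedObj_zero_lt hψ hlim hpos
  refine (exists_le_of_drift (L := fun n => Real.log (1 + ‖t n‖ ^ 2))
    (q := fun n => -2 * g n *
      (inner ℝ (meanIncr ν G p (ξ n) (t n)) (t n) / (1 + ‖t n‖ ^ 2)))
    (B := 2 * B) (B' := Real.log (1 + R ^ 2)) hE (fun n => ?_) ?_ ?_).elim
    fun M hM => exists_norm_le_of_log_le hM
  · have h1 := log_one_add_norm_sq_step (t n) (inc n) (meanIncr ν G p (ξ n) (t n)) (g n)
    rw [← hstep] at h1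
    exact h1
  · filter_upwards [hg.eventually_le_const one_pos] with n hn
    have h2 := h.neg_inner_meanIncr_le hψ hB (ξ n) (t n)
    have hW : 1 ≤ 1 + ‖t n‖ ^ 2 := by nlinarith [sq_nonneg ‖t n‖]
    have h3 : -(inner ℝ (meanIncr ν G p (ξ n) (t n)) (t n) / (1 + ‖t n‖ ^ 2)) ≤ B := by
      rw [← neg_div, div_le_iff₀ (by positivity)]
      refine h2.trans ?_
      exact mul_le_mul le_rfl ((exp_neg_cumulant_add_le_one hψ _).trans hW) (Real.exp_pos _).le hB0
    have h4 := mul_le_mul_of_nonneg_left h3 (hg0 n)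
    nlinarith
  · filter_upwards [hξ.eventually hR] with n hn hL
    have h1 : R ≤ ‖t n‖ := by
      have := (Real.log_le_log_iff (by positivity) (by positivity)).1 hL
      exact (le_abs_self R).trans (abs_le_of_sq_le_sq (by linarith) (norm_nonneg _))
    have h2 := h.le_inner_meanIncr hψ (ξ n) (t n) 0
    rw [sub_zero] at h2
    have h3 : 0 ≤ inner ℝ (meanIncr ν G p (ξ n) (t n)) (t n) :=
      le_trans (mul_nonneg (mul_nonneg (h.p_nonneg _ _) (Real.exp_pos _).le)
        (sub_nonneg.2 (hn _ h1).le)) h2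
    have h4 : 0 ≤ g n * (inner ℝ (meanIncr ν G p (ξ n) (t n)) (t n) / (1 + ‖t n‖ ^ 2)) :=
      mul_nonneg (hg0 n) (div_nonneg h3 (by positivity))
    linarith

/-- Along a regular path the Esscher parameter converges to the minimiser. -/
lemma exists_tendsto_argmin (h : IsDampedWeight ν G p) (hψ : ExpMoments ν)
    (hlim : Tendsto (fun θ => cumulant ν θ - 2 * cumulant ν ((1 / 2 : ℝ) • θ))
      (Bornology.cobounded (Vec d)) atTop)
    (hg0 : ∀ n, 0 ≤ g n) (hg : Tendsto g atTop (𝓝 0))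
    (hgs : Tendsto (fun n => ∑ k ∈ Finset.range n, g k) atTop atTop)
    (hstep : ∀ n, t (n + 1) = t n - g n • inc n)
    (hr : IsRegularPath g t inc fun n => meanIncr ν G p (ξ n) (t n)) {ξ₀ : ℝ}
    (hξ : Tendsto ξ atTop (𝓝 ξ₀)) (hpos : 0 < ν {x | 0 < G ξ₀ x}) :
    ∃ t₀ ∈ argmin fun s => weightedObj ν G s ξ₀, Tendsto t atTop (𝓝 t₀) := by
  obtain ⟨R, hR⟩ := exists_norm_le_of_tendsto h hψ hlim hg0 hg hstep hr hξ hpos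
  obtain ⟨t₀, ht₀⟩ := h.nonempty_argmin hψ hlim hpos
  refine ⟨t₀, ht₀, ?_⟩
  set m : ℕ → Vec d := fun n => meanIncr ν G p (ξ n) (t n) with hm
  have hball : ∀ n, t n ∈ Metric.closedBall (0 : Vec d) R := fun n => by simpa using hR n
  -- The target t₀ depends on the path, so the noise tested against t - t₀ is split into the radial
  -- series and the coordinate series with weights t₀ i. Truncation is inactive since the path stays
  -- in the ball of radius R.
  have hnoise : ∃ E, Tendsto (fun n => ∑ k ∈ Finset.range n,
      (-2 * (g k * inner ℝ (inc k - m k) (t k - t₀)) + g k ^ 2 * ‖inc k‖ ^ 2)) atTop (𝓝 E) := by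
    obtain ⟨l, hl⟩ := hr.radial R
    choose b hb using hr.coord R
    have hsq : Summable fun n => g n ^ 2 * ‖inc n‖ ^ 2 := by
      refine Summable.of_nonneg_of_le (fun n => by positivity) (fun n => ?_)
        (hr.square.mul_left (1 + (R : ℝ) ^ 2))
      have hW : 0 < 1 + ‖t n‖ ^ 2 := by positivity
      have h1 := hR n
      have h2 : (1 : ℝ) ≤ (1 + (R : ℝ) ^ 2) / (1 + ‖t n‖ ^ 2) := by
        rw [one_le_div hW]; gcongr
      calc _ ≤ (g n ^ 2 * ‖inc n‖ ^ 2) * ((1 + (R : ℝ) ^ 2) / (1 + ‖t n‖ ^ 2)) :=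
            le_mul_of_one_le_right (by positivity) h2
        _ = _ := by ring
    have h3 := ((hl.sub (tendsto_finsetSum Finset.univ fun i _ => (hb i).const_mul (t₀ i))).const_mul
      (-2)).add hsq.hasSum.tendsto_sum_nat
    refine ⟨_, h3.congr fun n => ?_⟩
    rw [Finset.sum_add_distrib, ← Finset.mul_sum]
    congr 2
    simp_rw [Finset.mul_sum]
    rw [Finset.sum_comm, ← Finset.sum_sub_distrib]
    refine Finset.sum_congr rfl fun k _ => ?_
    simp only [Set.indicator_of_mem (hball k), id]
    rw [inner_sub_right, mul_sub]
    congr 1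
    rw [PiLp.inner_apply (inc k - _) t₀, Finset.mul_sum]
    refine Finset.sum_congr rfl fun i _ => ?_
    rw [EuclideanSpace.inner_single_right]
    simp
    ring
  obtain ⟨E, hE⟩ := hnoise
  have hcQ : Continuous fun η => weightedObj ν G t₀ η :=
    (h.continuous_weightedObj hψ).comp (Continuous.prodMk_right t₀)
  have hQt := (hcQ.tendsto ξ₀).comp hξ
  have hle := fun n => h.le_inner_meanIncr hψ (ξ n) (t n) t₀
  have hu := tendsto_zero_of_drift (u := fun n => ‖t n - t₀‖ ^ 2) (γ := g)
    (a := fun n => 2 * inner ℝ (m n) (t n - t₀)) (B := 2 * (weightedObj ν G t₀ ξ₀ + 1))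
    hg0 hg hgs hE (fun n => sq_nonneg _) (Eventually.of_forall fun n => ?_) (fun ε hε => ?_) ?_
  · rw [tendsto_iff_norm_sub_tendsto_zero]
    have := hu.sqrt
    simpa [Real.sqrt_sq (norm_nonneg _)] using this
  · have h1 := one_add_norm_sq_step (t n - t₀) (inc n) (g n)
    have h2 : t (n + 1) - t₀ = t n - t₀ - g n • inc n := by rw [hstep]; abel
    rw [h2, h1, inner_sub_left]
    linarith
  -- Each of the three factors of the drift, namely the prefactor, the exponential and the excess of
  -- the objective, is bounded below on the ball at distance at least √ε from t₀.
  · obtain ⟨c, hc, hQc⟩ := h.eventually_le_weightedObj_sub hψ hlim hpos ht₀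
      (Real.sqrt_pos.2 hε) R
    obtain ⟨cp, hcp, hp⟩ := h.p_lower (max (|ξ₀| + 1) R)
    have hcψ := continuous_cumulant hψ
    have hcomp : ContinuousOn (fun s => Real.exp (-(cumulant ν s + cumulant ν (-s))))
        (Metric.closedBall (0 : Vec d) R) := by fun_prop
    obtain ⟨ce, hce, he⟩ := (isCompact_closedBall (0 : Vec d) (R : ℝ)).exists_forall_le'
      hcomp (a := 0) fun s _ => Real.exp_pos _
    refine ⟨2 * (cp * ce * c), by positivity, ?_⟩
    filter_upwards [hξ.eventually hQc, hξ.abs.eventually_le_const (show |ξ₀| < |ξ₀| + 1 by simp)]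
      with n h1 h2 h3
    have h4 := h1 (t n) ((Real.sqrt_le_left (norm_nonneg _)).2 h3) (hR n)
    have h5 := hp (ξ n) (t n) (h2.trans (le_max_left _ _)) ((hR n).trans (le_max_right _ _))
    have h6 := he (t n) (hball n)
    have h7 : cp * ce * c ≤ p (ξ n) (t n) * Real.exp (-(cumulant ν (t n) + cumulant ν (-t n))) *
        (weightedObj ν G (t n) (ξ n) - weightedObj ν G t₀ (ξ n)) := by
      have := h.p_nonneg (ξ n) (t n)
      gcongr
    linarith [hle n]
  · filter_upwards [hQt.eventually_le_const
      (show weightedObj ν G t₀ ξ₀ < weightedObj ν G t₀ ξ₀ + 1 by simp)] with n hn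
    simp only [Function.comp] at hn
    have h1 := exp_neg_cumulant_add_le_one hψ (t n)
    have h2 := h.p_nonneg (ξ n) (t n)
    have h3 := h.weightedObj_nonneg t₀ (ξ n)
    have h4 := h.weightedObj_nonneg (t n) (ξ n)
    have h5 : p (ξ n) (t n) * Real.exp (-(cumulant ν (t n) + cumulant ν (-t n))) ≤ 1 :=
      mul_le_one₀ (h.p_le_one _ _) (Real.exp_pos _).le h1
    have h6 : 0 ≤ p (ξ n) (t n) * Real.exp (-(cumulant ν (t n) + cumulant ν (-t n))) :=
      mul_nonneg h2 (Real.exp_pos _).le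
    nlinarith [hle n, mul_nonneg h6 h4, mul_le_mul_of_nonneg_right h5 h3]

end Path
end EsscherVaR

namespace EsscherVaR

open ProbabilityTheory

/-! ### The distribution of the loss -/

section Loss

variable {d : ℕ} {ν : Measure (Vec d)} [IsProbabilityMeasure ν] {φ : Vec d → ℝ}

lemma lossCDF_eq_cdf (hφ : Measurable φ) (ξ : ℝ) : lossCDF ν φ ξ = cdf (ν.map φ) ξ := by
  have := Measure.isProbabilityMeasure_map (μ := ν) hφ.aemeasurable
  rw [cdf_eq_real, map_measureReal_apply hφ measurableSet_Iic]
  rfl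

lemma monotone_lossCDF : Monotone (lossCDF ν φ) := fun a b hab =>
  measureReal_mono fun _ hx => le_trans hx hab

lemma exists_lossCDF_lt_and_lt (hφ : Measurable φ) {α : ℝ} (hα : α ∈ Set.Ioo (0 : ℝ) 1) :
    (∃ lo, lossCDF ν φ lo < α) ∧ ∃ hi, α < lossCDF ν φ hi := by
  simp_rw [lossCDF_eq_cdf hφ]
  exact ⟨((tendsto_cdf_atBot (ν.map φ)).eventually_lt_const hα.1).exists,
    ((tendsto_cdf_atTop (ν.map φ)).eventually_const_lt hα.2).exists⟩

/-- An atom would be a jump: its mass is at most F(ξ) - F(η) for every η < ξ. -/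
lemma measure_loss_eq_zero (hφ : Measurable φ) (hF : Continuous (lossCDF ν φ)) (ξ : ℝ) :
    ν {x | φ x = ξ} = 0 := by
  rw [← measureReal_eq_zero_iff]
  refine le_antisymm ?_ measureReal_nonneg
  have hlim : Tendsto (fun η => lossCDF ν φ ξ - lossCDF ν φ η) (𝓝[<] ξ) (𝓝 0) := by
    have : Tendsto (fun η => lossCDF ν φ ξ - lossCDF ν φ η) (𝓝 ξ)
        (𝓝 (lossCDF ν φ ξ - lossCDF ν φ ξ)) := tendsto_const_nhds.sub (hF.tendsto ξ)
    rw [sub_self] at this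
    exact this.mono_left nhdsWithin_le_nhds
  refine ge_of_tendsto hlim ?_
  filter_upwards [self_mem_nhdsWithin] with η hη
  have hη' : η < ξ := hη
  rw [le_sub_iff_add_le, lossCDF, lossCDF, ← measureReal_union]
  · refine measureReal_mono ?_
    rintro x (hx | hx)
    · exact (show φ x = ξ from hx).le
    · exact le_trans hx hη'.le
  · refine Set.disjoint_left.2 fun x hx hx' => ?_
    have h1 : φ x = ξ := hx
    have h2 : φ x ≤ η := hx'
    linarith
  · exact hφ measurableSet_Iic

lemma ind_nonneg (ξ : ℝ) (x : Vec d) : 0 ≤ ind φ ξ x :=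
  Set.indicator_nonneg (fun _ _ => zero_le_one) x

lemma ind_le_one (ξ : ℝ) (x : Vec d) : ind φ ξ x ≤ 1 :=
  Set.indicator_le_self' (f := fun _ => (1 : ℝ)) (fun _ _ => zero_le_one) x

lemma measurable_ind (hφ : Measurable φ) : Measurable fun q : ℝ × Vec d => ind φ q.1 q.2 := by
  have hs : MeasurableSet {q : ℝ × Vec d | q.1 < φ q.2} :=
    measurableSet_lt measurable_fst (hφ.comp measurable_snd)
  exact (measurable_const (a := (1 : ℝ))).indicator hs

lemma ind_pos_iff {ξ : ℝ} {x : Vec d} : 0 < ind φ ξ x ↔ ξ < φ x := by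
  by_cases h : ξ < φ x <;> simp [ind, Set.indicator, h]

lemma continuousAt_ind {ξ : ℝ} {x : Vec d} (h : φ x ≠ ξ) :
    ContinuousAt (fun η => ind φ η x) ξ := by
  rcases lt_or_gt_of_ne h with h | h
  · refine (continuousAt_const (y := (0 : ℝ))).congr ?_
    filter_upwards [lt_mem_nhds h] with η hη
    simp [ind, Set.indicator, hη.not_gt]
  · refine (continuousAt_const (y := (1 : ℝ))).congr ?_
    filter_upwards [gt_mem_nhds h] with η hη
    simp [ind, Set.indicator, hη]

lemma ae_continuousAt_ind (hφ : Measurable φ) (hF : Continuous (lossCDF ν φ)) (ξ : ℝ) :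
    ∀ᵐ x ∂ν, ContinuousAt (fun η => ind φ η x) ξ := by
  have : ∀ᵐ x ∂ν, φ x ≠ ξ := by
    rw [ae_iff]; simpa using measure_loss_eq_zero hφ hF ξ
  filter_upwards [this] with x hx using continuousAt_ind hx

lemma measureReal_lt_loss (hφ : Measurable φ) (ξ : ℝ) :
    ν.real {x | ξ < φ x} = 1 - lossCDF ν φ ξ := by
  have hs : MeasurableSet {x | φ x ≤ ξ} := hφ measurableSet_Iic
  rw [lossCDF, ← probReal_compl_eq_one_sub hs]
  congr 1; ext x; simp

lemma integral_ind (hφ : Measurable φ) (ξ : ℝ) : ∫ x, ind φ ξ x ∂ν = 1 - lossCDF ν φ ξ := by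
  rw [← measureReal_lt_loss hφ]
  have hs : MeasurableSet {x | ξ < φ x} := hφ measurableSet_Ioi
  simp only [ind]
  rw [integral_indicator hs]
  simp

/-- Closed since F is continuous, bounded since F takes values on both sides of α. -/
lemma isCompact_VaRSet (hφ : Measurable φ) (hF : Continuous (lossCDF ν φ)) {α : ℝ}
    (hα : α ∈ Set.Ioo (0 : ℝ) 1) : IsCompact (VaRSet ν φ α) := by
  obtain ⟨⟨lo, hlo⟩, hi, hhi⟩ := exists_lossCDF_lt_and_lt (ν := ν) hφ hα
  refine isCompact_Icc.of_isClosed_subset (isClosed_eq hF continuous_const)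
    (fun ξ (hξ : lossCDF ν φ ξ = α) => (⟨?_, ?_⟩ : ξ ∈ Set.Icc lo hi))
  · by_contra hcon
    have := monotone_lossCDF (ν := ν) (φ := φ) (not_le.1 hcon).le
    linarith
  · by_contra hcon
    have := monotone_lossCDF (ν := ν) (φ := φ) (not_le.1 hcon).le
    linarith

end Loss

/-! ### The two weights of the procedure -/

section Weights

variable {d : ℕ} {ν : Measure (Vec d)} [IsProbabilityMeasure ν] {φ : Vec d → ℝ}

/-- Needed to recentre the weighted second moment, where a squared distance between means multiplies
this exponential moment. -/
lemma exists_integral_exp_mul_norm_le (hψ : ExpMoments ν) {δ : ℝ}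
    (hδ : ConcaveOn ℝ Set.univ (fun θ => cumulant ν θ - δ * ‖θ‖ ^ 2))
    {a : ℝ} (ha : 0 ≤ a) :
    ∃ B, 0 ≤ B ∧ ∀ t, ∫ x, Real.exp (a * ‖x‖) ∂(esscher ν t) ≤
      B * Real.exp (a * √(d : ℝ) * ‖gradient (cumulant ν) t‖) := by
  refine ⟨∑ s : Fin d → Bool, Real.exp (δ * (a * √(d : ℝ)) ^ 2), by positivity, fun t => ?_⟩
  refine (integral_mono (hψ.integrable_esscher_of_le t (B := 1) (a := a) (by fun_prop)
    fun x => ?_) (integrable_finsetSum _ fun s _ => integrable_exp_inner_esscher hψ t _)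
    (exp_mul_norm_le ha)).trans ?_
  · rw [Real.norm_of_nonneg (Real.exp_pos _).le, one_mul]
  rw [integral_finsetSum _ fun s _ => integrable_exp_inner_esscher hψ t _, Finset.sum_mul]
  refine Finset.sum_le_sum fun s _ => (integral_exp_inner_esscher_le hψ hδ t _).trans ?_
  have h1 : ‖a • signVec s‖ = a * √(d : ℝ) := by
    rw [norm_smul, norm_signVec, Real.norm_of_nonneg ha]
  rw [← Real.exp_add, h1, add_comm]
  refine Real.exp_le_exp.2 (add_le_add le_rfl ((real_inner_le_norm _ _).trans (le_of_eq ?_)))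
  rw [h1]; ring

/-- Second moments of the sampling law of parameter `-t`, around the mean of parameter `t`. -/
lemma exists_integral_exp_mul_norm_sq_neg_le (hψ : ExpMoments ν) {δ : ℝ} (hδ0 : 0 < δ)
    (hδ : ConcaveOn ℝ Set.univ (fun θ => cumulant ν θ - δ * ‖θ‖ ^ 2))
    {a : ℝ} (ha : 0 ≤ a) :
    ∃ B, 0 ≤ B ∧ ∀ t, ∫ x, Real.exp (a * ‖x‖) * ‖x - gradient (cumulant ν) t‖ ^ 2
      ∂(esscher ν (-t)) ≤
      B * (1 + ‖t‖ ^ 2) * Real.exp (a * √(d : ℝ) * ‖gradient (cumulant ν) (-t)‖) := by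
  obtain ⟨B₁, hB₁, h₁⟩ := exists_integral_exp_mul_norm_sq_le hψ hδ0 hδ ha
  obtain ⟨B₂, hB₂, h₂⟩ := exists_integral_exp_mul_norm_le hψ hδ ha
  obtain ⟨D, hD, hgrad⟩ := norm_gradient_cumulant_le hψ hδ0 hδ
  refine ⟨2 * B₁ + 16 * D ^ 2 * B₂, by positivity, fun t => ?_⟩
  set m := gradient (cumulant ν) t
  set m' := gradient (cumulant ν) (-t)
  have hI₁ := integrable_exp_mul_norm_mul_norm_sq hψ a (-t) m'
  have hI₂ : Integrable (fun x => Real.exp (a * ‖x‖)) (esscher ν (-t)) :=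
    hψ.integrable_esscher_of_le (-t) (B := 1) (a := a) (by fun_prop) fun x => by
      rw [Real.norm_of_nonneg (Real.exp_pos _).le, one_mul]
  -- Samples have mean ∇ψ(-t) but the increment is centred at ∇ψ(t). Both grow linearly, and their
  -- squared distance produces the factor 1 + ‖t‖².
  have hmm : ‖m' - m‖ ^ 2 ≤ 8 * D ^ 2 * (1 + ‖t‖ ^ 2) := by
    have e1 := hgrad t
    have e2 := hgrad (-t)
    rw [norm_neg] at e2
    have e3 : ‖m' - m‖ ≤ 2 * D * (1 + ‖t‖) := by linarith [norm_sub_le m' m]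
    calc ‖m' - m‖ ^ 2 ≤ (2 * D * (1 + ‖t‖)) ^ 2 := by gcongr
      _ = 4 * D ^ 2 * (1 + ‖t‖) ^ 2 := by ring
      _ ≤ 4 * D ^ 2 * (2 * (1 + ‖t‖ ^ 2)) := by
          gcongr
          nlinarith [sq_nonneg (1 - ‖t‖)]
      _ = _ := by ring
  have hpt : ∀ x, Real.exp (a * ‖x‖) * ‖x - m‖ ^ 2 ≤
      2 * (Real.exp (a * ‖x‖) * ‖x - m'‖ ^ 2) +
        2 * ‖m' - m‖ ^ 2 * Real.exp (a * ‖x‖) := by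
    intro x
    have e1 : ‖x - m‖ ≤ ‖x - m'‖ + ‖m' - m‖ := by
      simpa using norm_add_le (x - m') (m' - m)
    have e2 : ‖x - m‖ ^ 2 ≤ 2 * ‖x - m'‖ ^ 2 + 2 * ‖m' - m‖ ^ 2 := by
      calc ‖x - m‖ ^ 2 ≤ (‖x - m'‖ + ‖m' - m‖) ^ 2 := by gcongr
        _ ≤ _ := by nlinarith [sq_nonneg (‖x - m'‖ - ‖m' - m‖)]
    calc _ ≤ Real.exp (a * ‖x‖) * (2 * ‖x - m'‖ ^ 2 + 2 * ‖m' - m‖ ^ 2) := by gcongr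
      _ = _ := by ring
  refine (integral_mono (integrable_exp_mul_norm_mul_norm_sq hψ a (-t) m)
    ((hI₁.const_mul 2).add (hI₂.const_mul (2 * ‖m' - m‖ ^ 2))) hpt).trans ?_
  simp only [Pi.add_apply]
  rw [integral_add (hI₁.const_mul 2) (hI₂.const_mul _), integral_const_mul, integral_const_mul]
  set e := Real.exp (a * √(d : ℝ) * ‖m'‖)
  calc _ ≤ 2 * (B₁ * e) + 2 * (8 * D ^ 2 * (1 + ‖t‖ ^ 2)) * (B₂ * e) := by
        gcongr
        · exact h₁ (-t)
        · exact h₂ (-t)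
    _ ≤ 2 * (B₁ * e) * (1 + ‖t‖ ^ 2) + 2 * (8 * D ^ 2 * (1 + ‖t‖ ^ 2)) * (B₂ * e) :=
        add_le_add (le_mul_of_one_le_right (by positivity)
          (le_add_of_nonneg_right (sq_nonneg ‖t‖))) le_rfl
    _ = _ := by ring

/-- The indicator is bounded, so no prefactor is needed and the moment bound is used with exponent a
= 0. -/
lemma isDampedWeight_ind (hψ : ExpMoments ν) {δ : ℝ} (hδ0 : 0 < δ)
    (hδ : ConcaveOn ℝ Set.univ (fun θ => cumulant ν θ - δ * ‖θ‖ ^ 2))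
    (hφ : Measurable φ) (hF : Continuous (lossCDF ν φ)) :
    IsDampedWeight ν (ind φ) (fun _ _ => 1) where
  meas := measurable_ind hφ
  nonneg := ind_nonneg
  growth := by
    refine ⟨1, 0, zero_le_one, le_rfl, fun ξ x => (ind_le_one ξ x).trans ?_⟩
    rw [zero_mul, Real.exp_zero]
    nlinarith [sq_nonneg ξ]
  cont := ae_continuousAt_ind hφ hF
  meas_p := measurable_const
  p_nonneg _ _ := zero_le_one
  p_le_one _ _ := le_rfl
  p_lower _ := ⟨1, one_pos, fun _ _ _ _ => le_rfl⟩
  mass := by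
    refine ⟨1, fun ξ t => ?_⟩
    rw [one_mul, integral_ind hφ]
    have : 0 ≤ lossCDF ν φ ξ := measureReal_nonneg
    linarith
  second := by
    obtain ⟨B, hB0, hB⟩ := exists_integral_exp_mul_norm_sq_neg_le hψ hδ0 hδ le_rfl
    refine ⟨B, hB0, fun ξ t => ?_⟩
    have h1 := hB t
    have hI := integrable_exp_mul_norm_mul_norm_sq hψ 0 (-t) (gradient (cumulant ν) t)
    simp only [zero_mul, Real.exp_zero, one_mul, mul_one] at h1 hI ⊢
    have hle : ∀ x, ind φ ξ x ^ 2 * ‖x - gradient (cumulant ν) t‖ ^ 2 ≤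
        ‖x - gradient (cumulant ν) t‖ ^ 2 := fun x =>
      mul_le_of_le_one_left (sq_nonneg _) (pow_le_one₀ (ind_nonneg ξ x) (ind_le_one ξ x))
    refine (integral_mono_of_nonneg (ae_of_all _ fun x => ?_) hI (ae_of_all _ hle)).trans h1
    exact mul_nonneg (sq_nonneg _) (sq_nonneg _)

/-- The weight of the variance reducer of the CVaR component. -/
noncomputable def sqWeight {d : ℕ} (φ : Vec d → ℝ) (Ψ : ℝ → ℝ) (ξ : ℝ) (x : Vec d) : ℝ :=
  (Ψ (φ x) - ξ) ^ 2 * ind φ ξ x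

/-- The damping prefactor of the variance reducer of the CVaR component. -/
noncomputable def dampFactor {d : ℕ} (ν : Measure (Vec d)) (lam ξ : ℝ) (t : Vec d) : ℝ :=
  Real.exp (-(lam / 2 * √(d : ℝ) * ‖gradient (cumulant ν) (-t)‖)) / (1 + ξ ^ 2)

/-- Squaring the weight doubles its exponent λ/2, so its second moment costs exp(λ√d‖∇ψ(-t)‖)(1 +
ξ²)². The squared prefactor is precisely the inverse of this. -/
lemma isDampedWeight_sqWeight (hψ : ExpMoments ν) {δ : ℝ} (hδ0 : 0 < δ)
    (hδ : ConcaveOn ℝ Set.univ (fun θ => cumulant ν θ - δ * ‖θ‖ ^ 2))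
    (hφ : Measurable φ) (hF : Continuous (lossCDF ν φ)) {Ψ : ℝ → ℝ} (hΨ : Continuous Ψ)
    {K lam : ℝ} (hlam : 0 ≤ lam) (hgrowth : ∀ x, |Ψ (φ x)| ≤ K * Real.exp (lam / 4 * ‖x‖)) :
    IsDampedWeight ν (sqWeight φ Ψ) (dampFactor ν lam) := by
  have hΨφ : Measurable fun x => Ψ (φ x) := hΨ.measurable.comp hφ
  have hsq0 : ∀ ξ : ℝ, 0 < 1 + ξ ^ 2 := fun ξ => by positivity
  have hgr : ∀ ξ x, sqWeight φ Ψ ξ x ≤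
      (2 * K ^ 2 + 2) * (1 + ξ ^ 2) * Real.exp (lam / 2 * ‖x‖) := by
    intro ξ x
    have h1 : Ψ (φ x) ^ 2 ≤ K ^ 2 * Real.exp (lam / 2 * ‖x‖) := by
      have e : Real.exp (lam / 2 * ‖x‖) = Real.exp (lam / 4 * ‖x‖) ^ 2 := by
        rw [← Real.exp_nat_mul]; congr 1; push_cast; ring
      rw [e, ← mul_pow, ← sq_abs (Ψ (φ x))]
      exact pow_le_pow_left₀ (abs_nonneg _) (hgrowth x) 2
    have h2 : 1 ≤ Real.exp (lam / 2 * ‖x‖) := Real.one_le_exp (by positivity)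
    calc sqWeight φ Ψ ξ x ≤ (Ψ (φ x) - ξ) ^ 2 :=
          mul_le_of_le_one_right (sq_nonneg _) (ind_le_one ξ x)
      _ ≤ 2 * Ψ (φ x) ^ 2 + 2 * ξ ^ 2 := by nlinarith [sq_nonneg (Ψ (φ x) + ξ)]
      _ ≤ 2 * (K ^ 2 * Real.exp (lam / 2 * ‖x‖)) + 2 * ξ ^ 2 * Real.exp (lam / 2 * ‖x‖) :=
          add_le_add (by gcongr) (le_mul_of_one_le_right (by positivity) h2)
      _ ≤ _ := by
          have e0 : 0 ≤ Real.exp (lam / 2 * ‖x‖) := (Real.exp_pos _).le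
          have e1 : 0 ≤ K ^ 2 * ξ ^ 2 * Real.exp (lam / 2 * ‖x‖) := by positivity
          nlinarith
  have hle1 : ∀ t : Vec d,
      Real.exp (-(lam / 2 * √(d : ℝ) * ‖gradient (cumulant ν) (-t)‖)) ≤ 1 := fun t =>
    Real.exp_le_one_iff.2 (neg_nonpos.2 (by positivity))
  have hnn : ∀ ξ x, 0 ≤ sqWeight φ Ψ ξ x := fun ξ x => mul_nonneg (sq_nonneg _) (ind_nonneg ξ x)
  have hIexp : Integrable (fun x => (2 * K ^ 2 + 2) * Real.exp (lam / 2 * ‖x‖)) ν :=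
    (hψ.integrable_exp_mul_norm _).const_mul _
  refine ⟨?_, hnn, ⟨2 * K ^ 2 + 2, lam / 2, by positivity, by positivity, hgr⟩, fun ξ => ?_, ?_,
    fun ξ t => by unfold dampFactor; positivity, fun ξ t => ?_, fun R => ?_, ?_, ?_⟩
  · exact (((hΨφ.comp measurable_snd).sub measurable_fst).pow_const 2).mul (measurable_ind hφ)
  · filter_upwards [ae_continuousAt_ind hφ hF ξ] with x hx
    exact ((continuous_const.sub continuous_id).pow 2).continuousAt.mul hx
  · have hm := measurable_gradient_cumulant (ν := ν)
    unfold dampFactor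
    fun_prop
  · rw [dampFactor, div_le_one (hsq0 ξ)]
    nlinarith [hle1 t, sq_nonneg ξ]
  · obtain ⟨D, hD, hgrad⟩ := norm_gradient_cumulant_le hψ hδ0 hδ
    refine ⟨Real.exp (-(lam / 2 * √(d : ℝ) * (D * (1 + R)))) / (1 + R ^ 2), by positivity,
      fun ξ t hξ ht => ?_⟩
    have h1 := hgrad (-t)
    rw [norm_neg] at h1
    have h2 : ‖gradient (cumulant ν) (-t)‖ ≤ D * (1 + R) := h1.trans (by gcongr)
    have h3 : ξ ^ 2 ≤ R ^ 2 := sq_le_sq' (by linarith [(abs_le.1 hξ).1]) (abs_le.1 hξ).2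
    unfold dampFactor
    gcongr
  · refine ⟨∫ x, (2 * K ^ 2 + 2) * Real.exp (lam / 2 * ‖x‖) ∂ν, fun ξ t => ?_⟩
    have h1 : ∫ x, sqWeight φ Ψ ξ x ∂ν ≤
        (1 + ξ ^ 2) * ∫ x, (2 * K ^ 2 + 2) * Real.exp (lam / 2 * ‖x‖) ∂ν := by
      rw [← integral_const_mul]
      refine integral_mono_of_nonneg (ae_of_all _ (hnn ξ)) (hIexp.const_mul _)
        (ae_of_all _ fun x => (hgr ξ x).trans (le_of_eq (by ring)))
    have h0 : 0 ≤ ∫ x, sqWeight φ Ψ ξ x ∂ν := integral_nonneg (hnn ξ)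
    rw [dampFactor, div_mul_eq_mul_div, div_le_iff₀ (hsq0 ξ)]
    refine (mul_le_of_le_one_left h0 (hle1 t)).trans (h1.trans (le_of_eq (mul_comm _ _)))
  · obtain ⟨B, hB0, hB⟩ := exists_integral_exp_mul_norm_sq_neg_le hψ hδ0 hδ hlam
    refine ⟨(2 * K ^ 2 + 2) ^ 2 * B, by positivity, fun ξ t => ?_⟩
    set m := gradient (cumulant ν) t
    set E := Real.exp (lam * √(d : ℝ) * ‖gradient (cumulant ν) (-t)‖) with hE
    have hI := (integrable_exp_mul_norm_mul_norm_sq hψ lam (-t) m).const_mul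
      ((2 * K ^ 2 + 2) ^ 2 / E)
    have hle : ∀ x, (dampFactor ν lam ξ t * sqWeight φ Ψ ξ x) ^ 2 * ‖x - m‖ ^ 2 ≤
        (2 * K ^ 2 + 2) ^ 2 / E * (Real.exp (lam * ‖x‖) * ‖x - m‖ ^ 2) := by
      intro x
      rw [← mul_assoc]
      gcongr
      have e1 : dampFactor ν lam ξ t ^ 2 = 1 / E / (1 + ξ ^ 2) ^ 2 := by
        rw [dampFactor, div_pow, ← Real.exp_nat_mul, hE, one_div, ← Real.exp_neg]
        congr 2; push_cast; ring
      have e2 : Real.exp (lam / 2 * ‖x‖) ^ 2 = Real.exp (lam * ‖x‖) := by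
        rw [← Real.exp_nat_mul]; congr 1; push_cast; ring
      have e3 := pow_le_pow_left₀ (hnn ξ x) (hgr ξ x) 2
      have hEp : 0 < E := Real.exp_pos _
      calc (dampFactor ν lam ξ t * sqWeight φ Ψ ξ x) ^ 2
          ≤ 1 / E / (1 + ξ ^ 2) ^ 2 *
            ((2 * K ^ 2 + 2) * (1 + ξ ^ 2) * Real.exp (lam / 2 * ‖x‖)) ^ 2 := by
            rw [mul_pow, e1]
            gcongr
        _ = _ := by
            rw [mul_pow, e2]
            have := (hsq0 ξ).ne'
            field_simp
    refine (integral_mono_of_nonneg (ae_of_all _ fun x => by positivity) hI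
      (ae_of_all _ hle)).trans ?_
    rw [integral_const_mul]
    have hEp : 0 < E := Real.exp_pos _
    calc _ ≤ (2 * K ^ 2 + 2) ^ 2 / E * (B * (1 + ‖t‖ ^ 2) * E) := by
          gcongr
          exact hB t
      _ = _ := by field_simp

end Weights

lemma L3_eq_weightedIncr {d : ℕ} (ν : Measure (Vec d)) (φ : Vec d → ℝ) (ξ : ℝ) (t x : Vec d) :
    L3 ν φ ξ t x = weightedIncr ν (ind φ) (fun _ _ => 1) ξ t x := by
  simp [L3, weightedIncr]

lemma L4_eq_weightedIncr {d : ℕ} (ν : Measure (Vec d)) (φ : Vec d → ℝ) (Ψ : ℝ → ℝ)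
    (lam ξ : ℝ) (t x : Vec d) :
    L4 ν φ Ψ lam ξ t x = weightedIncr ν (sqWeight φ Ψ) (dampFactor ν lam) ξ t x := by
  simp [L4, weightedIncr, sqWeight, dampFactor, mul_assoc]

end EsscherVaR

namespace EsscherVaR

open ProbabilityTheory

/-! ### The value-at-risk component -/

section VaRComponent

variable {d : ℕ} {ν : Measure (Vec d)} [IsProbabilityMeasure ν] {φ : Vec d → ℝ} {α : ℝ}

lemma measurable_L1 (hψ : ExpMoments ν) (hφ : Measurable φ) :
    Measurable fun q : (ℝ × Vec d) × Vec d => L1 ν φ α q.1.1 q.1.2 q.2 := by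
  have hc := (continuous_cumulant hψ).measurable
  have hi : Measurable fun q : (ℝ × Vec d) × Vec d => ind φ q.1.1 q.2 :=
    (measurable_ind hφ).comp (show Measurable fun q : (ℝ × Vec d) × Vec d => (q.1.1, q.2) by
      fun_prop)
  unfold L1
  fun_prop

/-- The likelihood ratio cancels the tilt pointwise: importance sampling is unbiased. -/
lemma integral_ind_mul_exp_esscher (hψ : ExpMoments ν) (f : Vec d → ℝ) (t : Vec d) :
    ∫ x, f x * Real.exp (cumulant ν t - inner ℝ t x) ∂(esscher ν t) = ∫ x, f x ∂ν := by
  rw [integral_esscher hψ]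
  refine integral_congr_ae (ae_of_all _ fun x => ?_)
  simp only [smul_eq_mul]
  rw [mul_left_comm, ← Real.exp_add]
  simp

lemma integrable_mul_exp_esscher_iff (hψ : ExpMoments ν) (f : Vec d → ℝ) (t : Vec d) :
    Integrable (fun x => f x * Real.exp (cumulant ν t - inner ℝ t x)) (esscher ν t) ↔
      Integrable f ν := by
  rw [integrable_esscher_iff hψ]
  have : (fun x => Real.exp (inner ℝ t x) • (f x * Real.exp (cumulant ν t - inner ℝ t x))) =
      fun x => Real.exp (cumulant ν t) * f x := by
    funext x
    simp only [smul_eq_mul]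
    rw [mul_left_comm, ← Real.exp_add, mul_comm]
    ring_nf
  rw [this]
  exact integrable_const_mul_iff (Real.exp_pos _).ne'.isUnit f

lemma integrable_ind (hφ : Measurable φ) (ξ : ℝ) : Integrable (ind φ ξ) ν := by
  refine (integrable_const (1 : ℝ)).mono'
    ((measurable_ind hφ).comp measurable_prodMk_left).aestronglyMeasurable
    (ae_of_all _ fun x => ?_)
  rw [Real.norm_of_nonneg (ind_nonneg ξ x)]
  exact ind_le_one ξ x

/-- By unbiasedness the drift is a positive damping times F(ξ) - α, so its sign does not depend on
t. -/
lemma integral_L1 (hψ : ExpMoments ν) (hφ : Measurable φ) (hα : α ∈ Set.Ioo (0 : ℝ) 1) (ξ : ℝ)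
    (t : Vec d) : ∫ x, L1 ν φ α ξ t x ∂(esscher ν t) =
      Real.exp (-(cumulant ν t + cumulant ν (-t)) / 2) * ((lossCDF ν φ ξ - α) / (1 - α)) := by
  have : IsProbabilityMeasure (esscher ν t) := isProbabilityMeasure_tilted (hψ t)
  have h1 : (1 : ℝ) - α ≠ 0 := (sub_pos.2 hα.2).ne'
  have hI := ((integrable_mul_exp_esscher_iff hψ (ind φ ξ) t).2
    (integrable_ind hφ ξ)).const_mul (1 / (1 - α))
  simp only [L1, mul_assoc, real_inner_comm t]
  rw [integral_const_mul, integral_sub (integrable_const _) hI, integral_const_mul,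
    integral_ind_mul_exp_esscher hψ, integral_ind hφ]
  congr 1
  simp
  field_simp
  ring

/-- The squared likelihood ratio is an exponential with parameter -2t, and t - 2t = -t; this is the
source of ψ(t) + ψ(-t) in the damping. -/
lemma integral_exp_sq_esscher (hψ : ExpMoments ν) (t : Vec d) :
    Integrable (fun x => Real.exp (cumulant ν t - inner ℝ t x) ^ 2) (esscher ν t) ∧
    ∫ x, Real.exp (cumulant ν t - inner ℝ t x) ^ 2 ∂(esscher ν t) =
      Real.exp (cumulant ν t + cumulant ν (-t)) := by
  have h : ∀ x, Real.exp (cumulant ν t - inner ℝ t x) ^ 2 =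
      Real.exp (2 * cumulant ν t) * Real.exp (inner ℝ ((-2 : ℝ) • t) x) := by
    intro x
    rw [← Real.exp_nat_mul, ← Real.exp_add, real_inner_smul_left]
    congr 1; push_cast; ring
  simp_rw [h]
  refine ⟨(integrable_exp_inner_esscher hψ t _).const_mul _, ?_⟩
  rw [integral_const_mul, integral_exp_inner_esscher hψ, ← Real.exp_add]
  have e : t + (-2 : ℝ) • t = -t := by module
  rw [e]
  ring_nf

lemma L1_sq_le (ξ : ℝ) (t x : Vec d) : L1 ν φ α ξ t x ^ 2 ≤
    Real.exp (-(cumulant ν t + cumulant ν (-t))) *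
      (2 + 2 * (1 / (1 - α)) ^ 2 * Real.exp (cumulant ν t - inner ℝ t x) ^ 2) := by
  have hexp : Real.exp (-(cumulant ν t + cumulant ν (-t)) / 2) ^ 2 =
      Real.exp (-(cumulant ν t + cumulant ν (-t))) := by
    rw [← Real.exp_nat_mul]; congr 1; push_cast; ring
  rw [L1, mul_pow, hexp, real_inner_comm t x]
  gcongr
  set e := Real.exp (cumulant ν t - inner ℝ t x)
  have h1 : ind φ ξ x ^ 2 ≤ 1 := pow_le_one₀ (ind_nonneg ξ x) (ind_le_one ξ x)
  have h2 : (1 / (1 - α)) ^ 2 * ind φ ξ x ^ 2 * e ^ 2 ≤ (1 / (1 - α)) ^ 2 * 1 * e ^ 2 := by gcongr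
  nlinarith [sq_nonneg (1 + 1 / (1 - α) * ind φ ξ x * e)]

/-- The squared damping cancels the second moment of the likelihood ratio. The bound is uniform in ξ
and t, so ξ can be handled before any stability of θ is known. -/
lemma integrable_L1_sq (hψ : ExpMoments ν) (hφ : Measurable φ) (ξ : ℝ) (t : Vec d) :
    Integrable (fun x => L1 ν φ α ξ t x ^ 2) (esscher ν t) ∧
    ∫ x, L1 ν φ α ξ t x ^ 2 ∂(esscher ν t) ≤ 2 + 2 * (1 / (1 - α)) ^ 2 := by
  have : IsProbabilityMeasure (esscher ν t) := isProbabilityMeasure_tilted (hψ t)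
  obtain ⟨hI, hint⟩ := integral_exp_sq_esscher hψ t
  have hdom := ((integrable_const (2 : ℝ)).add (hI.const_mul (2 * (1 / (1 - α)) ^ 2))).const_mul
    (Real.exp (-(cumulant ν t + cumulant ν (-t))))
  have hm : Measurable fun x => L1 ν φ α ξ t x ^ 2 :=
    ((measurable_L1 hψ hφ).comp (measurable_prodMk_left (x := (ξ, t)))).pow_const 2
  have hi : Integrable (fun x => L1 ν φ α ξ t x ^ 2) (esscher ν t) := by
    refine hdom.mono' hm.aestronglyMeasurable (ae_of_all _ fun x => ?_)
    rw [Real.norm_of_nonneg (sq_nonneg _)]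
    exact L1_sq_le ξ t x
  refine ⟨hi, (integral_mono hi hdom (L1_sq_le ξ t)).trans ?_⟩
  simp only [Pi.add_apply]
  rw [integral_const_mul, integral_add (integrable_const _) (hI.const_mul _), integral_const_mul,
    hint]
  have h1 := exp_neg_cumulant_add_le_one hψ t
  have h2 : Real.exp (-(cumulant ν t + cumulant ν (-t))) *
      Real.exp (cumulant ν t + cumulant ν (-t)) = 1 := by rw [← Real.exp_add]; simp
  simp only [integral_const, probReal_univ, smul_eq_mul, one_mul]
  rw [mul_add, mul_left_comm, h2]
  linarith

variable {Ω : Type*} [mΩ : MeasurableSpace Ω] {P : Measure Ω} [IsProbabilityMeasure P]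
  {ℱ : Filtration ℕ mΩ} {g : ℕ → ℝ} {ξ : ℕ → Ω → ℝ} {t Y : ℕ → Ω → Vec d}

/-- The value-at-risk component converges almost surely, whatever the Esscher parameters do. -/
lemma ae_exists_tendsto_xi (hψ : ExpMoments ν) (hφ : Measurable φ)
    (hF : Continuous (lossCDF ν φ)) (hα : α ∈ Set.Ioo (0 : ℝ) 1) (hg0 : ∀ n, 0 ≤ g n)
    (hg : Summable fun n => g n ^ 2) (hgl : Tendsto g atTop (𝓝 0))
    (hξ : ∀ n, Measurable[ℱ n] (ξ n)) (ht : ∀ n, Measurable[ℱ n] (t n))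
    (hY : ∀ n, Measurable[ℱ (n + 1)] (Y (n + 1)))
    (hlaw : ∀ n, HasCondLaw P (ℱ n) (Y (n + 1)) fun ω => esscher ν (t n ω))
    (hstep : ∀ n ω, ξ (n + 1) ω = ξ n ω - g n * L1 ν φ α (ξ n ω) (t n ω) (Y (n + 1) ω)) :
    ∀ᵐ ω ∂P, ∃ l, Tendsto (fun n => ξ n ω) atTop (𝓝 l) ∧ (lossCDF ν φ l ≠ α →
      Summable fun n =>
        g n * Real.exp (-(cumulant ν (t n ω) + cumulant ν (-t n ω)) / 2)) := by
  have h1α : 0 < 1 - α := sub_pos.2 hα.2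
  have hu : Measurable fun e : ℝ × Vec d => e.2 := by fun_prop
  have := isMarkovKernel_esscherKernel hψ (fun e : ℝ × Vec d => e.2) hu
  have hmain := ae_tendsto_sum_centred (P := P) (ℱ := ℱ)
    (κ := esscherKernel hψ (fun e : ℝ × Vec d => e.2) hu)
    (z := fun n ω => (ξ n ω, t n ω)) (Y := Y)
    (f := fun n q => g n * L1 ν φ α q.1.1 q.1.2 q.2)
    (c := fun n => (2 + 2 * (1 / (1 - α)) ^ 2) * g n ^ 2)
    (fun n => (hξ n).prodMk (ht n)) hY hlaw (fun n => (measurable_L1 hψ hφ).const_mul _)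
    (fun n e => ?_) (fun n e => ?_) (hg.mul_left _)
  · filter_upwards [hmain] with ω hω
    obtain ⟨l, hl⟩ := hω
    obtain ⟨⟨lo, hlo⟩, hi, hhi⟩ := exists_lossCDF_lt_and_lt (ν := ν) hφ hα
    set D : ℕ → ℝ := fun n => Real.exp (-(cumulant ν (t n ω) + cumulant ν (-t n ω)) / 2) with hD
    have hDle : ∀ n, D n ≤ 1 := fun n => by
      refine Real.exp_le_one_iff.2 ?_
      have := cumulant_add_cumulant_neg_nonneg hψ (t n ω)
      linarith
    have hD0 : ∀ n, 0 ≤ D n := fun n => (Real.exp_pos _).le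
    have hl' : Tendsto (fun n => ∑ k ∈ Finset.range n, (g k *
        L1 ν φ α (ξ k ω) (t k ω) (Y (k + 1) ω) -
        g k * D k * (1 / (1 - α)) * (lossCDF ν φ (ξ k ω) - α))) atTop (𝓝 l) := by
      refine hl.congr fun n => Finset.sum_congr rfl fun k _ => ?_
      have : ∫ x, L1 ν φ α (ξ k ω) (t k ω) x ∂(esscher ν (t k ω)) = _ :=
        integral_L1 hψ hφ hα (ξ k ω) (t k ω)
      rw [integral_const_mul]
      refine congrArg₂ _ rfl ((congrArg (g k * ·) this).trans ?_)
      simp only [hD]; ring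
    -- Adding the accumulated noise to ξ leaves a sequence moved by the mean drift alone;
    -- subtracting l, the limit of S, keeps it asymptotic to ξ.
    set S : ℕ → ℝ := fun n => ∑ k ∈ Finset.range n, (g k *
        L1 ν φ α (ξ k ω) (t k ω) (Y (k + 1) ω) -
        g k * D k * (1 / (1 - α)) * (lossCDF ν φ (ξ k ω) - α)) with hS
    have hrec : ∀ n, (ξ (n + 1) ω + S (n + 1) - l) = (ξ n ω + S n - l) -
        g n * D n * (1 / (1 - α)) * (lossCDF ν φ (ξ n ω) - α) := by
      intro n
      simp only [hS, Finset.sum_range_succ]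
      rw [hstep]; ring
    obtain ⟨z, hz, hsum⟩ := exists_tendsto_of_sign_drift hF monotone_lossCDF hlo hhi
      (x := fun n => ξ n ω) (y := fun n => ξ n ω + S n - l)
      (w := fun n => g n * D n * (1 / (1 - α)))
      (fun n => mul_nonneg (mul_nonneg (hg0 n) (hD0 n)) (by positivity)) hrec
      (by
        have := hl'.sub_const l
        rw [sub_self] at this
        exact this.congr fun n => by ring)
      (by
        have hlim : Tendsto (fun n => g n * (1 / (1 - α))) atTop (𝓝 0) := by
          simpa using hgl.mul_const (1 / (1 - α))
        refine squeeze_zero_norm (fun n => ?_) hlim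
        have hFb : |lossCDF ν φ (ξ n ω) - α| ≤ 1 := by
          have h0 : 0 ≤ lossCDF ν φ (ξ n ω) := measureReal_nonneg
          have h1 : lossCDF ν φ (ξ n ω) ≤ 1 := measureReal_le_one
          rw [abs_le]; constructor <;> linarith [hα.1, hα.2]
        rw [hrec, sub_sub_cancel_left, norm_neg, norm_mul, Real.norm_eq_abs (_ - α),
          Real.norm_of_nonneg (mul_nonneg (mul_nonneg (hg0 n) (hD0 n)) (by positivity))]
        calc _ ≤ g n * 1 * (1 / (1 - α)) * 1 := by
              have := hg0 n
              gcongr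
              exact hDle n
          _ = _ := by ring)
    refine ⟨z, hz, fun hne => ?_⟩
    refine ((hsum hne).mul_right (1 - α)).congr fun n => ?_
    rw [mul_assoc (g n * D n), one_div, inv_mul_cancel₀ h1α.ne', mul_one]
  · simp only [mul_pow]
    exact (integrable_L1_sq hψ hφ e.1 e.2).1.const_mul _
  · simp only [mul_pow]
    rw [integral_const_mul, mul_comm]
    gcongr
    exact (integrable_L1_sq hψ hφ e.1 e.2).2

end VaRComponent

/-! ### The CVaR component -/

section CVaRComponent

variable {d : ℕ} {ν : Measure (Vec d)} [IsProbabilityMeasure ν] {φ : Vec d → ℝ} {Ψ : ℝ → ℝ}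
  {α : ℝ}

lemma measurable_wBar (hψ : ExpMoments ν) (hφ : Measurable φ) (hΨ : Continuous Ψ) :
    Measurable fun q : (ℝ × Vec d) × Vec d => wBar ν φ Ψ α q.1.1 q.1.2 q.2 := by
  have hc := (continuous_cumulant hψ).measurable
  have hm := hΨ.measurable
  have hi : Measurable fun q : (ℝ × Vec d) × Vec d => ind φ q.1.1 q.2 :=
    (measurable_ind hφ).comp (show Measurable fun q : (ℝ × Vec d) × Vec d => (q.1.1, q.2) by
      fun_prop)
  unfold wBar
  fun_prop

/-- The conditional mean of the weighted functional `w̄`. -/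
noncomputable def meanWBar {d : ℕ} (ν : Measure (Vec d)) (φ : Vec d → ℝ) (Ψ : ℝ → ℝ) (α ξ : ℝ) :
    ℝ :=
  Ψ ξ + 1 / (1 - α) * ∫ x, (Ψ (φ x) - Ψ ξ) * ind φ ξ x ∂ν

lemma integrable_loss (hψ : ExpMoments ν) (hφ : Measurable φ) (hΨ : Continuous Ψ) {K lam : ℝ}
    (hgrowth : ∀ x, |Ψ (φ x)| ≤ K * Real.exp (lam / 4 * ‖x‖)) :
    Integrable (fun x => Ψ (φ x)) ν :=
  hψ.integrable_of_le (hΨ.measurable.comp hφ).aestronglyMeasurable hgrowth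

lemma integrable_mul_ind (hφ : Measurable φ) (ξ : ℝ) {f : Vec d → ℝ} (hf : Integrable f ν) :
    Integrable (fun x => f x * ind φ ξ x) ν := by
  refine hf.norm.mono' (hf.1.mul
    ((measurable_ind hφ).comp measurable_prodMk_left).aestronglyMeasurable)
    (ae_of_all _ fun x => ?_)
  rw [norm_mul, Real.norm_of_nonneg (ind_nonneg ξ x)]
  exact mul_le_of_le_one_right (norm_nonneg _) (ind_le_one ξ x)

/-- The likelihood ratio cancels again, so the mean does not depend on the sampling parameter; the
limit of C is therefore decided by ξ alone. -/
lemma integral_wBar (hψ : ExpMoments ν) (hφ : Measurable φ)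
    (hint : Integrable (fun x => Ψ (φ x)) ν) (ξ : ℝ) (t : Vec d) :
    ∫ x, wBar ν φ Ψ α ξ t x ∂(esscher ν t) = meanWBar ν φ Ψ α ξ := by
  have : IsProbabilityMeasure (esscher ν t) := isProbabilityMeasure_tilted (hψ t)
  have hI := integrable_mul_ind hφ ξ (hint.sub (integrable_const (Ψ ξ)))
  have hI' := ((integrable_mul_exp_esscher_iff hψ _ t).2 hI).const_mul (1 / (1 - α))
  simp only [Pi.sub_apply] at hI'
  have he : ∀ x, wBar ν φ Ψ α ξ t x = Ψ ξ + 1 / (1 - α) *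
      ((Ψ (φ x) - Ψ ξ) * ind φ ξ x * Real.exp (cumulant ν t - inner ℝ t x)) := by
    intro x; rw [wBar]; ring
  simp_rw [he]
  rw [integral_add (integrable_const _) hI', integral_const_mul,
    integral_ind_mul_exp_esscher hψ (fun x => (Ψ (φ x) - Ψ ξ) * ind φ ξ x), meanWBar]
  simp

lemma meanWBar_eq (hφ : Measurable φ) (hint : Integrable (fun x => Ψ (φ x)) ν) (ξ : ℝ) :
    meanWBar ν φ Ψ α ξ = Ψ ξ + 1 / (1 - α) *
      (∫ x, Ψ (φ x) * ind φ ξ x ∂ν - Ψ ξ * (1 - lossCDF ν φ ξ)) := by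
  simp_rw [meanWBar, sub_mul]
  rw [integral_sub (integrable_mul_ind hφ ξ hint) ((integrable_ind hφ ξ).const_mul _),
    integral_const_mul, integral_ind hφ]

/-- The loss has no atoms, so the indicator is almost everywhere continuous in the level, and
|Ψ(φ(X))| dominates. -/
lemma continuous_meanWBar (hφ : Measurable φ) (hF : Continuous (lossCDF ν φ)) (hΨ : Continuous Ψ)
    (hint : Integrable (fun x => Ψ (φ x)) ν) : Continuous (meanWBar ν φ Ψ α) := by
  have hH : Continuous fun ξ => ∫ x, Ψ (φ x) * ind φ ξ x ∂ν := by
    rw [continuous_iff_continuousAt]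
    intro ξ
    refine continuousAt_of_dominated (bound := fun x => ‖Ψ (φ x)‖)
      (Eventually.of_forall fun η => (integrable_mul_ind hφ η hint).1)
      (Eventually.of_forall fun η => ae_of_all _ fun x => ?_) hint.norm ?_
    · rw [norm_mul, Real.norm_of_nonneg (ind_nonneg η x)]
      exact mul_le_of_le_one_right (norm_nonneg _) (ind_le_one η x)
    · filter_upwards [ae_continuousAt_ind hφ hF ξ] with x hx
      exact continuousAt_const.mul hx
  have : meanWBar ν φ Ψ α = fun ξ => Ψ ξ + 1 / (1 - α) *
      (∫ x, Ψ (φ x) * ind φ ξ x ∂ν - Ψ ξ * (1 - lossCDF ν φ ξ)) :=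
    funext (meanWBar_eq hφ hint)
  rw [this]
  fun_prop

/-- At a value-at-risk, the mean of `w̄` is the `Ψ`-CVaR. -/
lemma meanWBar_eq_PsiCVaR (hφ : Measurable φ) (hF : Continuous (lossCDF ν φ))
    (hα : α ∈ Set.Ioo (0 : ℝ) 1) (hint : Integrable (fun x => Ψ (φ x)) ν) {ξ : ℝ}
    (hξ : ξ ∈ VaRSet ν φ α) : meanWBar ν φ Ψ α ξ = PsiCVaR ν φ Ψ α := by
  have hξ' : lossCDF ν φ ξ = α := hξ
  have h1α : (1 : ℝ) - α ≠ 0 := (sub_pos.2 hα.2).ne'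
  set v := VaR ν φ α with hv
  obtain ⟨⟨lo, hlo⟩, -⟩ := exists_lossCDF_lt_and_lt (ν := ν) hφ hα
  have hbdd : BddBelow {η | α ≤ lossCDF ν φ η} := ⟨lo, fun η hη => by
    by_contra hcon
    have := monotone_lossCDF (ν := ν) (φ := φ) (not_le.1 hcon).le
    have hη' : α ≤ lossCDF ν φ η := hη
    linarith⟩
  have hvle : v ≤ ξ := csInf_le hbdd hξ'.ge
  have hvmem : α ≤ lossCDF ν φ v :=
    (isClosed_le continuous_const hF).csInf_mem ⟨ξ, hξ'.ge⟩ hbdd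
  have hvα : lossCDF ν φ v = α :=
    le_antisymm ((monotone_lossCDF hvle).trans hξ'.le) hvmem
  have hmeas : ν.real {x | v ≤ φ x} = 1 - α := by
    rw [← hvα, ← measureReal_lt_loss hφ]
    refine measureReal_congr ?_
    have : ∀ᵐ x ∂ν, φ x ≠ v := by
      rw [ae_iff]; simpa using measure_loss_eq_zero hφ hF v
    filter_upwards [this] with x hx
    exact propext ⟨fun h => lt_of_le_of_ne h (Ne.symm hx), fun h => le_of_lt (b := φ x) h⟩
  have hsub' : {x | ξ < φ x} ⊆ {x | v ≤ φ x} := fun x hx => (hvle.trans_lt hx).le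
  have hmξ : ν.real {x | ξ < φ x} = 1 - α := by rw [measureReal_lt_loss hφ, hξ']
  -- Values-at-risk may fill an interval, but the two nested events both have mass 1 - α and so
  -- differ by a null set. Since 1 - F(ξ) = 1 - α, the terms in Ψ ξ cancel at the end.
  have hae : {x | ξ < φ x} =ᵐ[ν] {x | v ≤ φ x} := by
    refine ae_eq_of_subset_of_measure_ge hsub' ?_ (hφ measurableSet_Ioi).nullMeasurableSet
      (measure_ne_top _ _)
    rw [← ENNReal.toReal_le_toReal (measure_ne_top _ _) (measure_ne_top _ _)]
    exact (hmeas.trans hmξ.symm).le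
  have hset : ∫ x, Ψ (φ x) * ind φ ξ x ∂ν = ∫ x in {x | v ≤ φ x}, Ψ (φ x) ∂ν := by
    rw [← setIntegral_congr_set hae, ← integral_indicator (show MeasurableSet {x | ξ < φ x} from hφ measurableSet_Ioi)]
    refine integral_congr_ae (ae_of_all _ fun x => ?_)
    by_cases hx : ξ < φ x <;> simp [ind, Set.indicator, hx]
  rw [meanWBar_eq hφ hint, hξ', hset, PsiCVaR, ProbabilityTheory.cond, integral_smul_measure,
    ← hv, ENNReal.toReal_inv, ← measureReal_def, hmeas]
  simp only [smul_eq_mul]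
  field_simp
  ring

/-- On bounded sets of parameters the weighted functional has bounded second moments. -/
lemma exists_integral_wBar_sq_le (hψ : ExpMoments ν) (hφ : Measurable φ) (hΨ : Continuous Ψ)
    (hα : α ∈ Set.Ioo (0 : ℝ) 1) {K lam : ℝ}
    (hgrowth : ∀ x, |Ψ (φ x)| ≤ K * Real.exp (lam / 4 * ‖x‖)) (hlam : 0 ≤ lam) (R : ℕ) :
    ∃ B, ∀ (ξ : ℝ) (t : Vec d), |ξ| ≤ R → ‖t‖ ≤ R →
      Integrable (fun x => wBar ν φ Ψ α ξ t x ^ 2) (esscher ν t) ∧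
      ∫ x, wBar ν φ Ψ α ξ t x ^ 2 ∂(esscher ν t) ≤ B := by
  have hc := continuous_cumulant hψ
  obtain ⟨A₁, hA₁⟩ := (isCompact_closedBall (0 : ℝ) (R : ℝ)).exists_bound_of_continuousOn
    hΨ.continuousOn
  obtain ⟨A₂, hA₂⟩ := (isCompact_closedBall (0 : Vec d) (R : ℝ)).exists_bound_of_continuousOn
    hc.continuousOn
  have h1α : 0 < 1 - α := sub_pos.2 hα.2
  have hA₁0 : 0 ≤ A₁ := (norm_nonneg _).trans (hA₁ 0 (by simp))
  set D := A₁ + 1 / (1 - α) * (|K| + A₁) * Real.exp A₂ with hD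
  have hD0 : 0 ≤ D := by positivity
  set b := 2 * (lam / 4 + R) with hb
  refine ⟨D ^ 2 * (Real.exp A₂ * ∫ x, Real.exp ((b + R) * ‖x‖) ∂ν), fun ξ t hξ ht => ?_⟩
  have hξ1 : |Ψ ξ| ≤ A₁ := hA₁ ξ (by simpa using hξ)
  have ht1 : |cumulant ν t| ≤ A₂ := hA₂ t (by simpa using ht)
  have hle : ∀ x, wBar ν φ Ψ α ξ t x ^ 2 ≤ D ^ 2 * Real.exp (b * ‖x‖) := by
    intro x
    have e1 : Real.exp (b * ‖x‖) = Real.exp ((lam / 4 + R) * ‖x‖) ^ 2 := by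
      rw [← Real.exp_nat_mul, hb]; congr 1; push_cast; ring
    have hE4 : 1 ≤ Real.exp (lam / 4 * ‖x‖) := Real.one_le_exp (by positivity)
    have hE : 1 ≤ Real.exp ((lam / 4 + R) * ‖x‖) := Real.one_le_exp (by positivity)
    rw [e1, ← mul_pow, ← sq_abs]
    refine pow_le_pow_left₀ (abs_nonneg _) ?_ 2
    have h2 : |Ψ (φ x) - Ψ ξ| ≤ (|K| + A₁) * Real.exp (lam / 4 * ‖x‖) := by
      calc _ ≤ |Ψ (φ x)| + |Ψ ξ| := abs_sub _ _
        _ ≤ |K| * Real.exp (lam / 4 * ‖x‖) + A₁ * Real.exp (lam / 4 * ‖x‖) := by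
            refine add_le_add ((hgrowth x).trans ?_)
              (hξ1.trans (le_mul_of_one_le_right hA₁0 hE4))
            gcongr
            exact le_abs_self K
        _ = _ := by ring
    have h3 : Real.exp (cumulant ν t - inner ℝ t x) ≤ Real.exp A₂ * Real.exp (R * ‖x‖) := by
      rw [← Real.exp_add]
      have := abs_inner_le_of_norm_le ht x
      exact Real.exp_le_exp.2 (by linarith [le_abs_self (cumulant ν t), neg_abs_le (inner ℝ t x)])
    rw [wBar]
    calc _ ≤ |Ψ ξ| + |1 / (1 - α) * (Ψ (φ x) - Ψ ξ) * ind φ ξ x *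
          Real.exp (cumulant ν t - inner ℝ t x)| := abs_add_le _ _
      _ = |Ψ ξ| + 1 / (1 - α) * |Ψ (φ x) - Ψ ξ| * ind φ ξ x *
          Real.exp (cumulant ν t - inner ℝ t x) := by
          rw [abs_mul, abs_mul, abs_mul, abs_of_nonneg (ind_nonneg ξ x), Real.abs_exp,
            abs_of_pos (show 0 < 1 / (1 - α) by positivity)]
      _ ≤ A₁ * Real.exp ((lam / 4 + R) * ‖x‖) + 1 / (1 - α) *
          ((|K| + A₁) * Real.exp (lam / 4 * ‖x‖)) * 1 *
          (Real.exp A₂ * Real.exp (R * ‖x‖)) := by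
          refine add_le_add (hξ1.trans (le_mul_of_one_le_right hA₁0 hE)) ?_
          have := ind_nonneg (φ := φ) ξ x
          gcongr
          exact ind_le_one ξ x
      _ = _ := by
          rw [hD, add_mul (lam / 4), Real.exp_add]; ring
  have hm : Measurable fun x => wBar ν φ Ψ α ξ t x ^ 2 :=
    ((measurable_wBar hψ hφ hΨ).comp (measurable_prodMk_left (x := (ξ, t)))).pow_const 2
  have hdom : Integrable (fun x => D ^ 2 * Real.exp (b * ‖x‖)) (esscher ν t) := by
    refine (hψ.integrable_esscher_of_le t (B := 1) (a := b) (by fun_prop) fun x => ?_).const_mul _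
    rw [Real.norm_of_nonneg (Real.exp_pos _).le, one_mul]
  have hi : Integrable (fun x => wBar ν φ Ψ α ξ t x ^ 2) (esscher ν t) := by
    refine hdom.mono' hm.aestronglyMeasurable (ae_of_all _ fun x => ?_)
    rw [Real.norm_of_nonneg (sq_nonneg _)]
    exact hle x
  refine ⟨hi, (integral_mono hi hdom hle).trans ?_⟩
  rw [integral_const_mul]
  gcongr
  rw [integral_esscher hψ, ← integral_const_mul]
  refine integral_mono_of_nonneg (ae_of_all _ fun x => by
    simp only [smul_eq_mul, Pi.zero_apply]; positivity)
    ((hψ.integrable_exp_mul_norm _).const_mul _) (ae_of_all _ fun x => ?_)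
  simp only [smul_eq_mul]
  rw [← Real.exp_add, ← Real.exp_add]
  have := abs_inner_le_of_norm_le ht x
  exact Real.exp_le_exp.2 (by
    linarith [neg_abs_le (cumulant ν t), le_abs_self (inner ℝ t x)])

variable {Ω : Type*} [mΩ : MeasurableSpace Ω] {P : Measure Ω} [IsProbabilityMeasure P]
  {ℱ : Filtration ℕ mΩ} {g : ℕ → ℝ} {ξ : ℕ → Ω → ℝ} {t Y : ℕ → Ω → Vec d}

/-- Along bounded trajectories the centred noise of the CVaR component is summable. -/
lemma ae_tendsto_sum_wBar_noise (hψ : ExpMoments ν) (hφ : Measurable φ) (hΨ : Continuous Ψ)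
    (hα : α ∈ Set.Ioo (0 : ℝ) 1) {K lam : ℝ}
    (hgrowth : ∀ x, |Ψ (φ x)| ≤ K * Real.exp (lam / 4 * ‖x‖)) (hlam : 0 ≤ lam)
    (hg : Summable fun n => g n ^ 2)
    (hξ : ∀ n, Measurable[ℱ n] (ξ n)) (ht : ∀ n, Measurable[ℱ n] (t n))
    (hY : ∀ n, Measurable[ℱ (n + 1)] (Y (n + 1)))
    (hlaw : ∀ n, HasCondLaw P (ℱ n) (Y (n + 1)) fun ω => esscher ν (t n ω)) :
    ∀ᵐ ω ∂P, ∀ R : ℕ, (∀ n, |ξ n ω| ≤ R) → (∀ n, ‖t n ω‖ ≤ R) →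
      ∃ l, Tendsto (fun n => ∑ k ∈ Finset.range n, g k *
        (wBar ν φ Ψ α (ξ k ω) (t k ω) (Y (k + 1) ω) - meanWBar ν φ Ψ α (ξ k ω))) atTop (𝓝 l) := by
  rw [ae_all_iff]
  intro R
  obtain ⟨B, hB⟩ := exists_integral_wBar_sq_le hψ hφ hΨ hα hgrowth hlam R
  have hB0 : 0 ≤ B := (integral_nonneg fun x => sq_nonneg _).trans (hB 0 0 (by simp) (by simp)).2
  have hu : Measurable fun e : ℝ × Vec d => e.2 := by fun_prop
  have := isMarkovKernel_esscherKernel hψ (fun e : ℝ × Vec d => e.2) hu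
  -- Second moments are bounded only locally, so the functional is truncated according to the
  -- current parameters, which are known before sampling. On paths that stay in the box the
  -- truncation has no effect.
  set box : Set ((ℝ × Vec d) × Vec d) := {q | |q.1.1| ≤ R ∧ ‖q.1.2‖ ≤ R} with hbox
  have hboxm : MeasurableSet box :=
    (measurableSet_le (f := fun q : (ℝ × Vec d) × Vec d => |q.1.1|)
      (measurable_fst.fst.norm) measurable_const).inter
      (measurableSet_le (f := fun q : (ℝ × Vec d) × Vec d => ‖q.1.2‖)
        (measurable_fst.snd.norm) measurable_const)
  set f : ℕ → (ℝ × Vec d) × Vec d → ℝ := fun n q =>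
    g n * box.indicator (fun q => wBar ν φ Ψ α q.1.1 q.1.2 q.2) q with hf
  have hin : ∀ n (e : ℝ × Vec d) x, (|e.1| ≤ R ∧ ‖e.2‖ ≤ R) →
      f n (e, x) = g n * wBar ν φ Ψ α e.1 e.2 x := by
    intro n e x he
    simp only [hf]
    rw [Set.indicator_of_mem]
    exact he
  have hout : ∀ n (e : ℝ × Vec d) x, ¬ (|e.1| ≤ R ∧ ‖e.2‖ ≤ R) → f n (e, x) = 0 := by
    intro n e x he
    simp only [hf]
    rw [Set.indicator_of_notMem, mul_zero]
    exact he
  have hmain := ae_tendsto_sum_centred (P := P) (ℱ := ℱ)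
    (κ := esscherKernel hψ (fun e : ℝ × Vec d => e.2) hu)
    (z := fun n ω => (ξ n ω, t n ω)) (Y := Y) (f := f) (c := fun n => B * g n ^ 2)
    (fun n => (hξ n).prodMk (ht n)) hY hlaw
    (fun n => ((measurable_wBar hψ hφ hΨ).indicator hboxm).const_mul _)
    (fun n e => ?_) (fun n e => ?_) (hg.mul_left _)
  · filter_upwards [hmain] with ω hω hξR htR
    refine hω.imp fun l hl => hl.congr fun n => Finset.sum_congr rfl fun k _ => ?_
    simp_rw [hin k (ξ k ω, t k ω) _ ⟨hξR k, htR k⟩]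
    rw [integral_const_mul, ← mul_sub]
    congr 2
    exact integral_wBar hψ hφ (integrable_loss hψ hφ hΨ hgrowth) _ _
  · by_cases he : |e.1| ≤ R ∧ ‖e.2‖ ≤ R
    · simp_rw [hin n e _ he, mul_pow]
      exact (hB e.1 e.2 he.1 he.2).1.const_mul _
    · simp_rw [hout n e _ he]
      simp
  · by_cases he : |e.1| ≤ R ∧ ‖e.2‖ ≤ R
    · simp_rw [hin n e _ he, mul_pow]
      rw [integral_const_mul, mul_comm]
      gcongr
      exact (hB e.1 e.2 he.1 he.2).2
    · simp_rw [hout n e _ he]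
      simp only [ne_eq, OfNat.ofNat_ne_zero, not_false_eq_true, zero_pow, integral_zero]
      positivity

end CVaRComponent

/-- A linear averaging recursion with convergent input and convergent noise converges. -/
lemma tendsto_of_averaging {g c w m : ℕ → ℝ} {l L : ℝ} (hg0 : ∀ n, 0 ≤ g n)
    (hg : Tendsto g atTop (𝓝 0))
    (hgs : Tendsto (fun n => ∑ k ∈ Finset.range n, g k) atTop atTop)
    (hstep : ∀ n, c (n + 1) = c n - g n * (c n - w n))
    (hnoise : Tendsto (fun n => ∑ k ∈ Finset.range n, g k * (w k - m k)) atTop (𝓝 l))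
    (hm : Tendsto m atTop (𝓝 L)) : Tendsto c atTop (𝓝 L) := by
  -- The tail of the noise series. Since r vanishes at infinity, c + r has the same limit as c and
  -- obeys a noiseless averaging recursion with input m + r.
  set r : ℕ → ℝ := fun n => l - ∑ k ∈ Finset.range n, g k * (w k - m k) with hr
  have hr0 : Tendsto r atTop (𝓝 0) := by simpa using hnoise.const_sub l
  set y : ℕ → ℝ := fun n => c n + r n with hy
  set ε : ℕ → ℝ := fun n => |m n + r n - L| with hε
  have hε0 : Tendsto ε atTop (𝓝 0) := by
    have := ((hm.add hr0).sub_const L).abs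
    simpa using this
  have hrec : ∀ n, y (n + 1) - L = (1 - g n) * (y n - L) + g n * (m n + r n - L) := by
    intro n
    simp only [hy, hr, Finset.sum_range_succ]
    rw [hstep]; ring
  have hyL : Tendsto (fun n => |y n - L|) atTop (𝓝 0) := by
    refine tendsto_zero_of_drift (γ := g) (a := fun n => |y n - L| - ε n) (e := fun _ => 0)
      (E := 0) (B := 1) hg0 hg hgs (by simp) (fun n => abs_nonneg _) ?_ (fun η hη => ?_) ?_
    · filter_upwards [hg.eventually_le_const one_pos] with n hn
      rw [hrec]
      calc _ ≤ |(1 - g n) * (y n - L)| + |g n * (m n + r n - L)| := abs_add_le _ _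
        _ = (1 - g n) * |y n - L| + g n * ε n := by
            rw [abs_mul, abs_mul, abs_of_nonneg (sub_nonneg.2 hn), abs_of_nonneg (hg0 n)]
        _ = _ := by ring
    · refine ⟨η / 2, by positivity, ?_⟩
      filter_upwards [hε0.eventually_le_const (show 0 < η / 2 by positivity)] with n h1 h2
      linarith
    · filter_upwards [hε0.eventually_le_const one_pos] with n h1
      linarith [abs_nonneg (y n - L)]
  have hy' : Tendsto y atTop (𝓝 L) := tendsto_iff_norm_sub_tendsto_zero.2 hyL
  have := hy'.sub hr0
  simpa [hy] using this

end EsscherVaR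

namespace EsscherVaR

open ProbabilityTheory

/-! ### Joint convergence of the four components -/

section Assembly

variable {d : ℕ} {ν : Measure (Vec d)} [IsProbabilityMeasure ν] {φ : Vec d → ℝ} {Ψ : ℝ → ℝ}
  {α : ℝ}

lemma measure_ind_pos (hφ : Measurable φ) (hα : α ∈ Set.Ioo (0 : ℝ) 1) {l : ℝ}
    (hl : l ∈ VaRSet ν φ α) : 0 < ν {x | 0 < ind φ l x} := by
  simp only [ind_pos_iff]
  have h := measureReal_lt_loss (ν := ν) hφ l
  rw [show lossCDF ν φ l = α from hl] at h
  refine (ENNReal.toReal_pos_iff.1 ?_).1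
  rw [← measureReal_def, h]
  exact sub_pos.2 hα.2

/-- Replacing `{φ ≥ ξ}` by `{φ > ξ}` does not affect positivity of the second weight. -/
lemma measure_sqWeight_pos (hφ : Measurable φ) (hF : Continuous (lossCDF ν φ)) {l : ℝ}
    (h : 0 < ν {x | 0 < (Ψ (φ x) - l) ^ 2 * Set.indicator {y | l ≤ φ y} (fun _ => (1 : ℝ)) x}) :
    0 < ν {x | 0 < sqWeight φ Ψ l x} := by
  refine h.trans_le (measure_mono_ae ?_)
  have : ∀ᵐ x ∂ν, φ x ≠ l := by
    rw [ae_iff]; simpa using measure_loss_eq_zero hφ hF l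
  filter_upwards [this] with x hx hx'
  have hx' : 0 < (Ψ (φ x) - l) ^ 2 * Set.indicator {y | l ≤ φ y} (fun _ => (1 : ℝ)) x := hx'
  show 0 < sqWeight φ Ψ l x
  by_cases hl : l ≤ φ x
  · have hlt : l < φ x := lt_of_le_of_ne hl (Ne.symm hx)
    rw [Set.indicator_of_mem (show x ∈ {y | l ≤ φ y} from hl)] at hx'
    rw [sqWeight, ind, Set.indicator_of_mem (show x ∈ {y | l < φ y} from hlt)]
    exact hx'
  · rw [Set.indicator_of_notMem (show x ∉ {y | l ≤ φ y} from hl), mul_zero] at hx'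
    exact absurd hx' (lt_irrefl _)

/-- Minimisers of the weighted objective are bounded uniformly over a compact set of levels. -/
lemma IsDampedWeight.exists_norm_argmin_le {G p : ℝ → Vec d → ℝ} (h : IsDampedWeight ν G p)
    (hψ : ExpMoments ν)
    (hlim : Tendsto (fun θ => cumulant ν θ - 2 * cumulant ν ((1 / 2 : ℝ) • θ))
      (Bornology.cobounded (Vec d)) atTop) {S : Set ℝ} (hS : IsCompact S)
    (hpos : ∀ ξ ∈ S, 0 < ν {x | 0 < G ξ x}) :
    ∃ R : ℝ, ∀ ξ ∈ S, ∀ t ∈ argmin fun s => weightedObj ν G s ξ, ‖t‖ ≤ R := by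
  choose! R hR using fun ξ hξ => h.eventually_weightedObj_zero_lt hψ hlim (hpos ξ hξ)
  obtain ⟨T, hT, hcov⟩ := hS.elim_nhds_subcover _ hR
  refine ⟨∑ ξ ∈ T, |R ξ|, fun ξ hξ t ht => ?_⟩
  obtain ⟨η, hη, hξη⟩ := Set.mem_iUnion₂.1 (hcov hξ)
  have h1 : ‖t‖ < R η := by
    by_contra hcon
    exact absurd (ht 0) (not_le.2 (hξη t (not_lt.1 hcon)))
  exact h1.le.trans ((le_abs_self _).trans
    (Finset.single_le_sum (f := fun ξ => |R ξ|) (fun i _ => abs_nonneg _) hη))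

/-- The parameters remain bounded if the damped steps are summable, which then forces the steps
themselves to be summable. -/
lemma summable_of_summable_damped {G p : ℝ → Vec d → ℝ} (h : IsDampedWeight ν G p)
    (hψ : ExpMoments ν) {g ξ : ℕ → ℝ} {t inc : ℕ → Vec d} (hg0 : ∀ n, 0 ≤ g n)
    (hstep : ∀ n, t (n + 1) = t n - g n • inc n)
    (hr : IsRegularPath g t inc fun n => meanIncr ν G p (ξ n) (t n))
    (hsum : Summable fun n => g n * Real.exp (-(cumulant ν (t n) + cumulant ν (-t n)) / 2)) :
    Summable g := by
  -- The drift of the parameter carries the square of the damping of ξ, which is smaller as the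
  -- damping is at most 1.
  have hs : Summable fun n => g n * Real.exp (-(cumulant ν (t n) + cumulant ν (-t n))) := by
    refine hsum.of_nonneg_of_le (fun n => mul_nonneg (hg0 n) (Real.exp_pos _).le) fun n => ?_
    have := cumulant_add_cumulant_neg_nonneg hψ (t n)
    exact mul_le_mul_of_nonneg_left (Real.exp_le_exp.2 (by linarith)) (hg0 n)
  obtain ⟨R, hR⟩ := exists_norm_le_of_summable h hψ hg0 hstep hr hs
  have hc := continuous_cumulant hψ
  obtain ⟨A, hA⟩ := (isCompact_closedBall (0 : Vec d) (R : ℝ)).exists_bound_of_continuousOn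
    (f := fun s => cumulant ν s + cumulant ν (-s)) (by fun_prop)
  refine (hs.mul_left (Real.exp A)).of_nonneg_of_le hg0 fun n => ?_
  rw [mul_left_comm, ← Real.exp_add]
  refine le_mul_of_one_le_right (hg0 n) (Real.one_le_exp ?_)
  have := (le_abs_self _).trans (hA (t n) (by simpa using hR n))
  linarith

variable {Ω : Type*} [mΩ : MeasurableSpace Ω] {P : Measure Ω} [IsProbabilityMeasure P]
  {ℱ : Filtration ℕ mΩ} {γ : ℕ → ℝ} {lam : ℝ} {X₁ X₂ X₃ X₄ : ℕ → Ω → Vec d}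
  {ξ C : ℕ → Ω → ℝ} {θ μ : ℕ → Ω → Vec d}

/-- The component C is left out: the other three do not depend on it and its limit is deterministic.
-/
lemma IsEsscherRecursion.measurable
    (hZ : IsEsscherRecursion P ℱ ν φ Ψ α lam γ X₁ X₂ X₃ X₄ ξ C θ μ) (hψ : ExpMoments ν)
    (hφ : Measurable φ) (h₃ : IsDampedWeight ν (ind φ) fun _ _ => 1)
    (h₄ : IsDampedWeight ν (sqWeight φ Ψ) (dampFactor ν lam)) (n : ℕ) :
    Measurable[ℱ n] (ξ n) ∧ Measurable[ℱ n] (θ n) ∧ Measurable[ℱ n] (μ n) := by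
  induction n with
  | zero => exact ⟨hZ.meas_ξ_zero, hZ.meas_θ_zero, hZ.meas_μ_zero⟩
  | succ n ih =>
    have hle : ℱ n ≤ ℱ (n + 1) := ℱ.mono n.le_succ
    have hξ : Measurable[ℱ (n + 1)] (ξ n) := ih.1.mono hle le_rfl
    have hθ : Measurable[ℱ (n + 1)] (θ n) := ih.2.1.mono hle le_rfl
    have hμ : Measurable[ℱ (n + 1)] (μ n) := ih.2.2.mono hle le_rfl
    refine ⟨?_, ?_, ?_⟩
    · rw [funext (hZ.step_ξ n)]
      exact hξ.sub (((measurable_L1 hψ hφ).comp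
        ((hξ.prodMk hθ).prodMk (hZ.meas_X₁ n))).const_mul (γ (n + 1)))
    · rw [funext (hZ.step_θ n)]
      simp_rw [L3_eq_weightedIncr]
      exact hθ.sub ((h₃.measurable_weightedIncr.comp
        ((hξ.prodMk hθ).prodMk (hZ.meas_X₃ n))).const_smul (γ (n + 1)))
    · rw [funext (hZ.step_μ n)]
      simp_rw [L4_eq_weightedIncr]
      exact hμ.sub ((h₄.measurable_weightedIncr.comp
        ((hξ.prodMk hμ).prodMk (hZ.meas_X₄ n))).const_smul (γ (n + 1)))

/-- Shifts the steps to an index starting at 0; their convergence to 0 comes from square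
summability. -/
lemma IsStepSequence.succ (hγ : IsStepSequence γ) :
    (∀ n, 0 ≤ γ (n + 1)) ∧ (Summable fun n => γ (n + 1) ^ 2) ∧
      Tendsto (fun n => γ (n + 1)) atTop (𝓝 0) ∧
      Tendsto (fun n => ∑ k ∈ Finset.range n, γ (k + 1)) atTop atTop := by
  have hs : Summable fun n => γ (n + 1) ^ 2 := (summable_nat_add_iff 1).2 hγ.2.2
  refine ⟨fun n => (hγ.1 _ n.succ_pos).le, hs, ?_, ?_⟩
  · have := hs.tendsto_atTop_zero.sqrt
    simp only [Real.sqrt_sq_eq_abs, Real.sqrt_zero] at this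
    exact (tendsto_zero_iff_abs_tendsto_zero _).2 this
  · refine hγ.2.1.congr fun n => ?_
    rw [Finset.range_eq_Ico, Finset.sum_Ico_add' γ 0 n 1, zero_add]
    rfl

/-- Pathwise convergence of the whole procedure. -/
lemma IsEsscherRecursion.ae_tendsto
    (hZ : IsEsscherRecursion P ℱ ν φ Ψ α lam γ X₁ X₂ X₃ X₄ ξ C θ μ) (hψ : ExpMoments ν)
    (hes : EsscherCondition (cumulant ν)) (hφ : Measurable φ) (hΨ : Continuous Ψ)
    (hα : α ∈ Set.Ioo (0 : ℝ) 1) (hF : Continuous (lossCDF ν φ))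
    (hA3 : ∀ ξ ∈ VaRSet ν φ α, 0 < ν {x | 0 < sqWeight φ Ψ ξ x}) {K : ℝ} (hlam : 0 ≤ lam)
    (hgrowth : ∀ x, |Ψ (φ x)| ≤ K * Real.exp (lam / 4 * ‖x‖)) (hγ : IsStepSequence γ) :
    ∀ᵐ ω ∂P, ∃ x ∈ VaRSet ν φ α, ∃ t ∈ argmin (fun t => Q1 ν φ t x),
      ∃ m ∈ argmin (fun m => Q2 ν φ Ψ m x),
        Tendsto (fun n => ξ n ω) atTop (𝓝 x) ∧
        Tendsto (fun n => C n ω) atTop (𝓝 (PsiCVaR ν φ Ψ α)) ∧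
        Tendsto (fun n => θ n ω) atTop (𝓝 t) ∧ Tendsto (fun n => μ n ω) atTop (𝓝 m) := by
  obtain ⟨hlim, δ, hδ0, hδ⟩ := hes
  obtain ⟨hg0, hg, hgl, hgs⟩ := hγ.succ
  have h₃ := isDampedWeight_ind hψ hδ0 hδ hφ hF
  have h₄ := isDampedWeight_sqWeight hψ hδ0 hδ hφ hF hΨ hlam hgrowth
  have hmeas := hZ.measurable hψ hφ h₃ h₄
  have hξm := fun n => (hmeas n).1
  have hθm := fun n => (hmeas n).2.1
  have hμm := fun n => (hmeas n).2.2
  have hint := integrable_loss (ν := ν) hψ hφ hΨ hgrowth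
  filter_upwards [ae_exists_tendsto_xi (g := fun n => γ (n + 1)) hψ hφ hF hα hg0 hg hgl hξm hθm
      hZ.meas_X₁ hZ.law_X₁ hZ.step_ξ,
    ae_isRegularPath (g := fun n => γ (n + 1)) h₃ hψ hg hξm hθm hZ.meas_X₃ hZ.law_X₃,
    ae_isRegularPath (g := fun n => γ (n + 1)) h₄ hψ hg hξm hμm hZ.meas_X₄ hZ.law_X₄,
    ae_tendsto_sum_wBar_noise (g := fun n => γ (n + 1)) hψ hφ hΨ hα hgrowth hlam hg hξm hμm
      hZ.meas_X₂ hZ.law_X₂] with ω hω₁ hω₃ hω₄ hω₂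
  obtain ⟨l, hl, hsum⟩ := hω₁
  have hθstep : ∀ n, θ (n + 1) ω = θ n ω - γ (n + 1) • weightedIncr ν (ind φ) (fun _ _ => 1)
      (ξ n ω) (θ n ω) (X₃ (n + 1) ω) := fun n => by
    rw [hZ.step_θ, L3_eq_weightedIncr]
  have hμstep : ∀ n, μ (n + 1) ω = μ n ω - γ (n + 1) • weightedIncr ν (sqWeight φ Ψ)
      (dampFactor ν lam) (ξ n ω) (μ n ω) (X₄ (n + 1) ω) := fun n => by
    rw [hZ.step_μ, L4_eq_weightedIncr]
  -- Otherwise the damped steps would be summable, which bounds θ and makes Σ γ itself finite.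
  have hlV : l ∈ VaRSet ν φ α := by
    by_contra hne
    have hs := summable_of_summable_damped h₃ hψ hg0 hθstep hω₃ (hsum hne)
    exact not_tendsto_nhds_of_tendsto_atTop hgs _ hs.hasSum.tendsto_sum_nat
  obtain ⟨t, ht, htl⟩ := exists_tendsto_argmin h₃ hψ hlim hg0 hgl hgs hθstep hω₃ hl
    (measure_ind_pos hφ hα hlV)
  obtain ⟨m, hm, hml⟩ := exists_tendsto_argmin h₄ hψ hlim hg0 hgl hgs hμstep hω₄ hl (hA3 l hlV)
  refine ⟨l, hlV, t, ht, m, hm, hl, ?_, htl, hml⟩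
  -- Convergence of ξ and μ bounds the whole path, so the noise series of C, available only on
  -- bounded paths, converges.
  obtain ⟨B₁, hB₁⟩ := (Metric.isBounded_range_of_tendsto _ hl).exists_norm_le
  obtain ⟨B₂, hB₂⟩ := (Metric.isBounded_range_of_tendsto _ hml).exists_norm_le
  obtain ⟨R, hR⟩ := exists_nat_ge (max B₁ B₂)
  obtain ⟨L, hL⟩ := hω₂ R
    (fun n => (hB₁ _ ⟨n, rfl⟩).trans ((le_max_left _ _).trans hR))
    (fun n => (hB₂ _ ⟨n, rfl⟩).trans ((le_max_right _ _).trans hR))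
  refine tendsto_of_averaging hg0 hgl hgs (c := fun n => C n ω)
    (w := fun n => wBar ν φ Ψ α (ξ n ω) (μ n ω) (X₂ (n + 1) ω)) (fun n => hZ.step_C n ω) hL ?_
  rw [← meanWBar_eq_PsiCVaR hφ hF hα hint hlV]
  exact ((continuous_meanWBar hφ hF hΨ hint).tendsto l).comp hl

end Assembly

end EsscherVaR
-- Measurable limits and their square integrability
theorem theorem4p1 {Ω : Type*} [mΩ : MeasurableSpace Ω] (P : Measure Ω)
    [IsProbabilityMeasure P] (ℱ : Filtration ℕ mΩ)
    {d : ℕ} (ν : Measure (Vec d)) [IsProbabilityMeasure ν]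
    (φ : Vec d → ℝ) (hφ : Measurable φ) (Ψ : ℝ → ℝ) (hΨ : Continuous Ψ)
    (α : ℝ) (hα : α ∈ Set.Ioo (0 : ℝ) 1)
    -- the cumulant generating function is finite everywhere and satisfies (H^es_δ)
    (hψ : ∀ θ : Vec d, Integrable (fun x => Real.exp (inner ℝ θ x)) ν)
    (hes : EsscherCondition (cumulant ν))
    -- (A2)_1
    (hA2_cdf : Continuous (lossCDF ν φ))
    (hA2_L2 : MemLp (fun x => Ψ (φ x)) 2 ν)
    -- (A3)
    (hA3 : ∀ ξ ∈ VaRSet ν φ α,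
      0 < ν {x | 0 < (Ψ (φ x) - ξ) ^ 2 * Set.indicator {y | ξ ≤ φ y} (fun _ => (1 : ℝ)) x})
    -- exponential moments and growth
    (hmom : ∀ θ : Vec d,
      Integrable (fun x => ‖x‖ * (1 + Ψ (φ x) ^ 2) * Real.exp (inner ℝ θ x)) ν)
    (K lam : ℝ) (hlam : 0 ≤ lam)
    (hgrowth : ∀ x, |Ψ (φ x)| ≤ K * Real.exp (lam / 4 * ‖x‖))
    (hlam_mom : Integrable (fun x => ‖x‖ ^ 2 * Real.exp (lam * ‖x‖)) ν)
    -- (A1) and the procedure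
    (γ : ℕ → ℝ) (hγ : IsStepSequence γ)
    (X₁ X₂ X₃ X₄ : ℕ → Ω → Vec d) (ξ C : ℕ → Ω → ℝ) (θ μ : ℕ → Ω → Vec d)
    (hZ : IsEsscherRecursion P ℱ ν φ Ψ α lam γ X₁ X₂ X₃ X₄ ξ C θ μ) :
    ∃ (ξs : Ω → ℝ) (θs μs : Ω → Vec d),
      MemLp ξs 2 P ∧ MemLp θs 2 P ∧ MemLp μs 2 P ∧
      ∀ᵐ ω ∂P,
        ξs ω ∈ VaRSet ν φ α ∧
        θs ω ∈ argmin (fun t => Q1 ν φ t (ξs ω)) ∧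
        μs ω ∈ argmin (fun m => Q2 ν φ Ψ m (ξs ω)) ∧
        Tendsto (fun n => (ξ n ω, C n ω, θ n ω, μ n ω)) atTop
          (𝓝 (ξs ω, PsiCVaR ν φ Ψ α, θs ω, μs ω)) := by
  have hpos₂ : ∀ x ∈ VaRSet ν φ α, 0 < ν {y | 0 < sqWeight φ Ψ x y} := fun x hx =>
    measure_sqWeight_pos hφ hA2_cdf (hA3 x hx)
  have hmain := hZ.ae_tendsto hψ hes hφ hΨ hα hA2_cdf hpos₂ hlam hgrowth hγ
  obtain ⟨hlim, δ, hδ0, hδ⟩ := hes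
  have h₃ := isDampedWeight_ind hψ hδ0 hδ hφ hA2_cdf
  have h₄ := isDampedWeight_sqWeight hψ hδ0 hδ hφ hA2_cdf hΨ hlam hgrowth
  have hmeas := hZ.measurable hψ hφ h₃ h₄
  -- Uniform bounds over the compact set of values-at-risk make the limits bounded, so membership in
  -- L² needs no moment of the iterates.
  have hV := isCompact_VaRSet hφ hA2_cdf hα
  obtain ⟨A, hA⟩ := hV.isBounded.exists_norm_le
  obtain ⟨R₁, hR₁⟩ := h₃.exists_norm_argmin_le hψ hlim hV fun x hx => measure_ind_pos hφ hα hx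
  obtain ⟨R₂, hR₂⟩ := h₄.exists_norm_argmin_le hψ hlim hV hpos₂
  obtain ⟨ξs, hξs, hξlim⟩ := measurable_limit_of_tendsto_metrizable_ae (L := atTop)
    (fun n => ((hmeas n).1.mono (ℱ.le n) le_rfl).aemeasurable)
    (hmain.mono fun ω ⟨x, _, _, _, _, _, hx, _⟩ => ⟨x, hx⟩)
  obtain ⟨θs, hθs, hθlim⟩ := measurable_limit_of_tendsto_metrizable_ae (L := atTop)
    (fun n => ((hmeas n).2.1.mono (ℱ.le n) le_rfl).aemeasurable)
    (hmain.mono fun ω ⟨_, _, t, _, _, _, _, _, ht, _⟩ => ⟨t, ht⟩)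
  obtain ⟨μs, hμs, hμlim⟩ := measurable_limit_of_tendsto_metrizable_ae (L := atTop)
    (fun n => ((hmeas n).2.2.mono (ℱ.le n) le_rfl).aemeasurable)
    (hmain.mono fun ω ⟨_, _, _, _, m, _, _, _, _, hm⟩ => ⟨m, hm⟩)
  -- The pathwise limits were chosen without measurability; uniqueness of limits transfers their
  -- properties to the measurable versions.
  have hall : ∀ᵐ ω ∂P, ξs ω ∈ VaRSet ν φ α ∧
      θs ω ∈ argmin (fun t => Q1 ν φ t (ξs ω)) ∧
      μs ω ∈ argmin (fun m => Q2 ν φ Ψ m (ξs ω)) ∧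
      Tendsto (fun n => (ξ n ω, C n ω, θ n ω, μ n ω)) atTop
        (𝓝 (ξs ω, PsiCVaR ν φ Ψ α, θs ω, μs ω)) := by
    filter_upwards [hmain, hξlim, hθlim, hμlim] with ω ⟨x, hx, t, ht, m, hm, h₁, h₂, h₃, h₄⟩ e₁ e₂ e₃
    obtain rfl := tendsto_nhds_unique h₁ e₁
    obtain rfl := tendsto_nhds_unique h₃ e₂
    obtain rfl := tendsto_nhds_unique h₄ e₃
    exact ⟨hx, ht, hm, h₁.prodMk_nhds (h₂.prodMk_nhds (h₃.prodMk_nhds h₄))⟩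
  exact ⟨ξs, θs, μs,
    .of_bound hξs.aestronglyMeasurable A (hall.mono fun ω h => hA _ h.1),
    .of_bound hθs.aestronglyMeasurable R₁ (hall.mono fun ω h => hR₁ _ h.1 _ h.2.1),
    .of_bound hμs.aestronglyMeasurable R₂ (hall.mono fun ω h => hR₂ _ h.1 _ h.2.2.1), hall⟩
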